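/- Let $p$ be a prime, let $K$ be a finite extension of $\mathbb{Q}_p$ with ring of integers $o$, let $G=GL_2(\mathbb{Z}_p)$, let $P\subset G$ be the subgroup of lower triangular matrices and $T\subset P$ the subgroup of diagonal matrices. For a profinite group $H$ put $o[[H]]=\varprojlim_N o[H/N]$ ($N$ running over the open normal subgroups of $H$) and $K[[H]]=K\otimes_o o[[H]]$; elements $\mu\in K[[H]]$ are viewed as bounded measures on $H$, with $\int_H f\,d\mu\in K$ for continuous $f:H\to K$. Let $\chi:T\to o^\times$ be a continuous character, also viewed as a character of $P$ via the projection $P\to T$. Let $$\mathrm{Ind}_P^G(\chi)=\{f\in C(G,K): f(gb)=\chi(b^{-1})f(g)\ \text{for all } g\in G,\ b\in P\},$$ a closed subspace of the Banach space $C(G,K)$, on which $G$ acts by left translation, $(gf)(h)=f(g^{-1}h)$; this is a $K$-Banach space representation of $G$. For a $K$-Banach space representation $E$ of $G$, the continuous dual $E'$ is a $K[[G]]$-module by $(\mu\ell)(v)=\int_G \ell(g^{-1}v)\,d\mu(g)$. For a continuous character $\psi:T\to o^\times$ let $M_\psi=K[[G]]\otimes_{K[[P]]}K^{(\psi)}$,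 where $K^{(\psi)}$ is $K$ with $K[[P]]$ acting through $K[[P]]\to K[[T]]\to K$, the second map being the extension of $\psi$. Then: 1. There is an isomorphism of $K[[G]]$-modules $M_{\chi^{-1}}\cong \mathrm{Ind}_P^G(\chi)'$, sending $\mu\otimes v$ to the linear form $f\mapsto v\int_G f\,d\mu$. 2. $\mathrm{Ind}_P^G(\chi)$ is admissible: it contains a $G$-invariant bounded open $o$-submodule $L$ such that, for every open normal subgroup $H$ of $G$, the $o$-module of $H$-invariants $N=(\mathrm{Ind}_P^G(\chi)/L)^H$ is of cofinite type, i.e. $\mathrm{Hom}_o(N,K/o)$ is a finitely generated $o$-module. 3. There is a unique $c(\chi)\in K$ such that $\chi\begin{pmatrix}a^{-1}&0\\0&a\end{pmatrix}=\exp(c(\chi)\log a)$ for all $a\in\mathbb{Z}_p^\times$ sufficiently close to $1$. If $c(\chi)\neq -n$ for every integer $n\ge 0$, then $\mathrm{Ind}_P^G(\chi)$ is topologically irreducible, i.e. it is nonzero and its only closed $G$-invariant subspaces are $0$ and the whole space. -/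

import Mathlib

open Filter Topology

set_option linter.unusedSectionVars false

noncomputable section

namespace IwasawaRep

/-! ### The coefficient ring and completed group rings -/

/-- The ring of integers `o = {x : ‖x‖ ≤ 1}` of `K`. -/
abbrev IntegerRing (K : Type*) [NontriviallyNormedField K] [IsUltrametricDist K] : Subring K :=
  (NormedField.valuation (K := K)).integer

section CompletedGroupRing

variable (K : Type*) [NontriviallyNormedField K] [IsUltrametricDist K]

/-- The transition map `o[G/H] → o[G/H']` for open normal subgroups `H ≤ H'`. -/
def transition {G : Type*} [Group G] [TopologicalSpace G] {H H' : OpenNormalSubgroup G}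
    (h : H ≤ H') :
    MonoidAlgebra (IntegerRing K) (G ⧸ H.toSubgroup) →ₐ[IntegerRing K]
      MonoidAlgebra (IntegerRing K) (G ⧸ H'.toSubgroup) :=
  MonoidAlgebra.mapDomainAlgHom (IntegerRing K) (IntegerRing K)
    (QuotientGroup.map H.toSubgroup H'.toSubgroup (MonoidHom.id G) h)

/-- The completed group ring `o[[G]] = lim o[G/H]`, the limit being over all open normal subgroups
`H` of `G`, as the algebra of compatible families. -/
def IntCompletedGroupRing (G : Type*) [Group G] [TopologicalSpace G] :
    Subalgebra (IntegerRing K)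
      (∀ H : OpenNormalSubgroup G, MonoidAlgebra (IntegerRing K) (G ⧸ H.toSubgroup)) where
  carrier := {x | ∀ (H H' : OpenNormalSubgroup G) (h : H ≤ H'), transition K h (x H) = x H'}
  mul_mem' hx hy H H' h := by
    simp only [Pi.mul_apply, map_mul, hx H H' h, hy H H' h]
  add_mem' hx hy H H' h := by
    simp only [Pi.add_apply, map_add, hx H H' h, hy H H' h]
  algebraMap_mem' r H H' h := by
    simp only [Pi.algebraMap_apply, AlgHom.commutes]

/-- `K[[G]] = K ⊗_o o[[G]]`. -/
abbrev CompletedGroupRing (G : Type*) [Group G] [TopologicalSpace G] : Type _ :=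
  TensorProduct (IntegerRing K) K (IntCompletedGroupRing K G)

variable {G₁ G₂ : Type*} [Group G₁] [TopologicalSpace G₁] [Group G₂] [TopologicalSpace G₂]

/-- The preimage of an open normal subgroup under a continuous homomorphism. -/
def comapOpenNormal (φ : G₁ →ₜ* G₂) (H : OpenNormalSubgroup G₂) : OpenNormalSubgroup G₁ where
  toOpenSubgroup := H.toOpenSubgroup.comap φ.toMonoidHom φ.continuous_toFun
  isNormal' := H.isNormal'.comap φ.toMonoidHom

/-- The map `o[G₁/φ⁻¹(H)] → o[G₂/H]` induced by `φ : G₁ → G₂`. -/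
def levelMap (φ : G₁ →ₜ* G₂) (H : OpenNormalSubgroup G₂) :
    MonoidAlgebra (IntegerRing K) (G₁ ⧸ (comapOpenNormal φ H).toSubgroup) →ₐ[IntegerRing K]
      MonoidAlgebra (IntegerRing K) (G₂ ⧸ H.toSubgroup) :=
  MonoidAlgebra.mapDomainAlgHom (IntegerRing K) (IntegerRing K)
    (QuotientGroup.map (comapOpenNormal φ H).toSubgroup H.toSubgroup φ.toMonoidHom le_rfl)

/-- The homomorphism `o[[G₁]] → o[[G₂]]` induced by a continuous homomorphism `G₁ → G₂`. -/
def mapInt (φ : G₁ →ₜ* G₂) :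
    IntCompletedGroupRing K G₁ →ₐ[IntegerRing K] IntCompletedGroupRing K G₂ :=
  AlgHom.codRestrict
    (AlgHom.comp
      (AlgHom.pi (R := IntegerRing K) fun H : OpenNormalSubgroup G₂ =>
        (levelMap K φ H).comp (Pi.evalAlgHom (IntegerRing K)
          (fun H : OpenNormalSubgroup G₁ => MonoidAlgebra (IntegerRing K) (G₁ ⧸ H.toSubgroup))
          (comapOpenNormal φ H)))
      (IntCompletedGroupRing K G₁).val)
    (IntCompletedGroupRing K G₂)
    (by
      intro x H H' h
      have hx := x.2 (comapOpenNormal φ H) (comapOpenNormal φ H') (fun g hg => h hg)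
      simp only [AlgHom.comp_apply, AlgHom.pi_apply, Pi.evalAlgHom_apply, Subalgebra.coe_val]
      rw [← hx]
      simp only [transition, levelMap]
      rw [← AlgHom.comp_apply, ← AlgHom.comp_apply, ← MonoidAlgebra.mapDomainAlgHom_comp,
        ← MonoidAlgebra.mapDomainAlgHom_comp]
      congr 2
      ext g
      rfl)

/-- The homomorphism `K[[G₁]] → K[[G₂]]` induced by a continuous homomorphism `G₁ → G₂`. -/
def mapCompleted (φ : G₁ →ₜ* G₂) : CompletedGroupRing K G₁ →ₐ[K] CompletedGroupRing K G₂ :=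
  Algebra.TensorProduct.map (AlgHom.id K K) (mapInt K φ)

end CompletedGroupRing

/-! ### Elements of `K[[G]]` as bounded measures on `G` -/

section Integral

variable {K : Type*} [NontriviallyNormedField K] [IsUltrametricDist K]

/-- The `o`-linear extension `o[Q] → K` of a map `u : Q → K`. -/
def linExt {Q : Type*} (u : Q → K) : MonoidAlgebra (IntegerRing K) Q →ₗ[IntegerRing K] K :=
  (Finsupp.linearCombination (IntegerRing K) u).comp
    (MonoidAlgebra.coeffLinearEquiv (IntegerRing K)).toLinearMap

lemma linExt_single {Q : Type*} (u : Q → K) (q : Q) (c : IntegerRing K) :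
    linExt u (MonoidAlgebra.single q c) = c * u q := by
  simp [linExt, Finsupp.linearCombination_single, Subring.smul_def]

lemma norm_linExt_le {Q : Type*} {u : Q → K} {ε : ℝ} (hε : 0 ≤ ε) (hu : ∀ q, ‖u q‖ ≤ ε)
    (a : MonoidAlgebra (IntegerRing K) Q) : ‖linExt u a‖ ≤ ε := by
  induction a using MonoidAlgebra.induction_linear with
  | zero => simpa using hε
  | add x y hx hy =>
    rw [map_add]
    exact (IsUltrametricDist.norm_add_le_max _ _).trans (max_le hx hy)
  | single q c =>
    rw [linExt_single, norm_mul]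
    have hc : ‖(c : K)‖ ≤ 1 := c.2
    calc ‖(c : K)‖ * ‖u q‖ ≤ 1 * ε := mul_le_mul hc (hu q) (norm_nonneg _) zero_le_one
      _ = ε := one_mul ε

lemma norm_sub_le_max' (x y : K) : ‖x - y‖ ≤ max ‖x‖ ‖y‖ := by
  rw [sub_eq_add_neg, ← norm_neg y]
  exact IsUltrametricDist.norm_add_le_max _ _

lemma linExt_sub {Q : Type*} (u v : Q → K) (a : MonoidAlgebra (IntegerRing K) Q) :
    linExt u a - linExt v a = linExt (fun q => u q - v q) a := by
  induction a using MonoidAlgebra.induction_linear with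
  | zero => simp
  | add x y hx hy => simp only [map_add, ← hx, ← hy]; ring
  | single q c => simp only [linExt_single]; ring

lemma linExt_add {Q : Type*} (u v : Q → K) (a : MonoidAlgebra (IntegerRing K) Q) :
    linExt (fun q => u q + v q) a = linExt u a + linExt v a := by
  induction a using MonoidAlgebra.induction_linear with
  | zero => simp
  | add x y hx hy => simp only [map_add, hx, hy]; ring
  | single q c => simp only [linExt_single]; ring

lemma linExt_smul {Q : Type*} (c : K) (u : Q → K) (a : MonoidAlgebra (IntegerRing K) Q) :
    linExt (fun q => c * u q) a = c * linExt u a := by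
  induction a using MonoidAlgebra.induction_linear with
  | zero => simp
  | add x y hx hy => simp only [map_add, hx, hy]; ring
  | single q c => simp only [linExt_single]; ring

lemma linExt_mapDomain {Q Q' : Type*} [Group Q] [Group Q'] (π : Q →* Q') (u : Q' → K)
    (a : MonoidAlgebra (IntegerRing K) Q) :
    linExt u (MonoidAlgebra.mapDomainAlgHom (IntegerRing K) (IntegerRing K) π a) =
      linExt (fun q => u (π q)) a := by
  induction a using MonoidAlgebra.induction_linear with
  | zero => simp
  | add x y hx hy => simp only [map_add, hx, hy]
  | single q c => simp [linExt_single]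

lemma linExt_mul {Q : Type*} [Group Q] (u : Q → K) (a b : MonoidAlgebra (IntegerRing K) Q) :
    linExt u (a * b) = linExt (fun x => linExt (fun y => u (x * y)) b) a := by
  induction a using MonoidAlgebra.induction_linear with
  | zero => simp
  | add x y hx hy => simp only [map_add, add_mul, hx, hy]
  | single q c =>
    rw [linExt_single]
    induction b using MonoidAlgebra.induction_linear with
    | zero => simp
    | add x y hx hy => simp only [map_add, mul_add, hx, hy]
    | single r d => simp only [MonoidAlgebra.single_mul_single, linExt_single]; push_cast; ring

variable {G : Type*} [Group G] [TopologicalSpace G]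

/-- The Riemann sum `∑_{x ∈ G/H} μ(xH) f(x)` (with a choice of representatives) of a function
`f` against `μ ∈ o[[G]]`. -/
def riemannSum (f : G → K) (H : OpenNormalSubgroup G) (μ : IntCompletedGroupRing K G) : K :=
  linExt (fun x : G ⧸ H.toSubgroup => f x.out) (μ.1 H)

/-- `f` varies by at most `ε` on the cosets of `H`. -/
def SmallOn (f : G → K) (H : OpenNormalSubgroup G) (ε : ℝ) : Prop :=
  ∀ g h : G, h ∈ H → ‖f (g * h) - f g‖ ≤ ε

lemma SmallOn.of_mk_eq {f : G → K} {H : OpenNormalSubgroup G} {ε : ℝ} (hf : SmallOn f H ε)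
    {a b : G} (hab : (a : G ⧸ H.toSubgroup) = b) : ‖f a - f b‖ ≤ ε := by
  have h := hf b (b⁻¹ * a) (QuotientGroup.eq.1 hab.symm)
  simpa using h

lemma norm_riemannSum_sub_le {f : G → K} {H H' : OpenNormalSubgroup G} {ε : ℝ} (hε : 0 ≤ ε)
    (hf : SmallOn f H' ε) (h : H ≤ H') (μ : IntCompletedGroupRing K G) :
    ‖riemannSum f H μ - riemannSum f H' μ‖ ≤ ε := by
  unfold riemannSum
  rw [← μ.2 H H' h, transition, linExt_mapDomain, linExt_sub]
  refine norm_linExt_le hε (fun q => hf.of_mk_eq ?_) _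
  rw [QuotientGroup.out_eq']
  conv_rhs => rw [← QuotientGroup.out_eq' q]
  rfl

instance : Nonempty (OpenNormalSubgroup G) :=
  ⟨{ toSubgroup := ⊤, isOpen' := isOpen_univ, isNormal' := inferInstance }⟩

/-- The integral `∫ f dμ`, for `μ ∈ o[[G]]`: the limit of the Riemann sums as the open normal
subgroup `H` shrinks. -/
def integral (f : G → K) (μ : IntCompletedGroupRing K G) : K :=
  limUnder (atBot : Filter (OpenNormalSubgroup G)) fun H => riemannSum f H μ

variable [IsTopologicalGroup G] [CompactSpace G] [TotallyDisconnectedSpace G]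

lemma exists_smallOn (f : C(G, K)) {ε : ℝ} (hε : 0 < ε) :
    ∃ H : OpenNormalSubgroup G, SmallOn f H ε := by
  have hcont : Continuous fun q : G × G => f (q.2 * q.1) - f q.2 := by fun_prop
  have hopen : ∀ᶠ h in 𝓝 (1 : G), ∀ g ∈ (Set.univ : Set G), ‖f (g * h) - f g‖ < ε := by
    refine isCompact_univ.eventually_forall_of_forall_eventually fun g _ => ?_
    have : Tendsto (fun q : G × G => ‖f (q.2 * q.1) - f q.2‖) (𝓝 ((1 : G), g)) (𝓝 0) := by
      have := hcont.norm.tendsto ((1 : G), g)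
      simpa using this
    exact this.eventually (gt_mem_nhds hε)
  obtain ⟨U, hU, hUo, h1⟩ := mem_nhds_iff.1 hopen
  obtain ⟨H, hH⟩ := ProfiniteGrp.exist_openNormalSubgroup_sub_open_nhds_of_one hUo h1
  exact ⟨H, fun g h hh => (hU (hH hh) g trivial).le⟩

variable [CompleteSpace K]

lemma tendsto_riemannSum (f : C(G, K)) (μ : IntCompletedGroupRing K G) :
    Tendsto (fun H => riemannSum f H μ) atBot (𝓝 (integral f μ)) := by
  refine tendsto_nhds_limUnder (cauchy_map_iff_exists_tendsto.1 ?_)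
  refine Metric.cauchy_iff.2 ⟨inferInstance, fun ε hε => ?_⟩
  obtain ⟨H₀, hH₀⟩ := exists_smallOn f (half_pos hε)
  refine ⟨_, image_mem_map (Iic_mem_atBot H₀), ?_⟩
  rintro _ ⟨H, hH, rfl⟩ _ ⟨H', hH', rfl⟩
  have h1 := norm_riemannSum_sub_le (half_pos hε).le hH₀ hH μ
  have h2 := norm_riemannSum_sub_le (half_pos hε).le hH₀ hH' μ
  have h3 : riemannSum f H μ - riemannSum f H' μ =
    (riemannSum f H μ - riemannSum f H₀ μ) + -(riemannSum f H' μ - riemannSum f H₀ μ) := by ring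
  rw [dist_eq_norm, h3]
  refine (IsUltrametricDist.norm_add_le_max _ _).trans_lt ?_
  rw [norm_neg]
  exact (max_le h1 h2).trans_lt (half_lt_self hε)

lemma norm_integral_sub_le (f : C(G, K)) {H : OpenNormalSubgroup G} {ε : ℝ} (hε : 0 ≤ ε)
    (hf : SmallOn f H ε) (μ : IntCompletedGroupRing K G) :
    ‖integral f μ - riemannSum f H μ‖ ≤ ε :=
  le_of_tendsto ((tendsto_riemannSum f μ).sub_const _).norm
    ((eventually_le_atBot H).mono fun _ h => norm_riemannSum_sub_le hε hf h μ)

lemma norm_integral_le (f : C(G, K)) (μ : IntCompletedGroupRing K G) :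
    ‖integral f μ‖ ≤ ‖f‖ :=
  le_of_tendsto (tendsto_riemannSum f μ).norm
    (Eventually.of_forall fun _ => norm_linExt_le (norm_nonneg _) (fun _ => f.norm_coe_le_norm _) _)

lemma integral_add (f g : C(G, K)) (μ : IntCompletedGroupRing K G) :
    integral (f + g : C(G, K)) μ = integral f μ + integral g μ := by
  refine tendsto_nhds_unique (tendsto_riemannSum (f + g) μ) ?_
  refine ((tendsto_riemannSum f μ).add (tendsto_riemannSum g μ)).congr fun H => ?_
  exact (linExt_add _ _ _).symm

lemma integral_smul (c : K) (f : C(G, K)) (μ : IntCompletedGroupRing K G) :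
    integral (c • f : C(G, K)) μ = c * integral f μ := by
  refine tendsto_nhds_unique (tendsto_riemannSum (c • f) μ) ?_
  refine ((tendsto_riemannSum f μ).const_mul c).congr fun H => ?_
  exact (linExt_smul _ _ _).symm

/-- Integration against `μ ∈ o[[G]]` as a continuous linear form on `C(G, K)`. -/
def integralCLM (μ : IntCompletedGroupRing K G) : C(G, K) →L[K] K :=
  LinearMap.mkContinuous
    { toFun := fun f => integral f μ
      map_add' := fun f g => integral_add f g μ
      map_smul' := fun c f => integral_smul c f μ } 1
    fun f => by simpa using norm_integral_le f μ

lemma integralCLM_apply (μ : IntCompletedGroupRing K G) (f : C(G, K)) :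
    integralCLM μ f = integral f μ := rfl

lemma integralCLM_add (μ ν : IntCompletedGroupRing K G) :
    integralCLM (μ + ν) = integralCLM μ + integralCLM ν := by
  ext f
  refine tendsto_nhds_unique (tendsto_riemannSum f (μ + ν)) ?_
  refine ((tendsto_riemannSum f μ).add (tendsto_riemannSum f ν)).congr fun H => ?_
  exact (map_add (linExt _) _ _).symm

lemma integralCLM_smul (c : IntegerRing K) (μ : IntCompletedGroupRing K G) :
    integralCLM (c • μ) = (c : K) • integralCLM μ := by
  ext f
  refine tendsto_nhds_unique (tendsto_riemannSum f (c • μ)) ?_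
  refine ((tendsto_riemannSum f μ).const_mul (c : K)).congr fun H => ?_
  exact (map_smul (linExt _) c _).symm

lemma integralCLM_one (f : C(G, K)) : integralCLM 1 f = f 1 := by
  refine eq_of_forall_dist_le fun ε hε => ?_
  obtain ⟨H, hH⟩ := exists_smallOn f hε
  have h1 := norm_integral_sub_le f hε.le hH 1
  have h2 : riemannSum f H 1 = f (1 : G ⧸ H.toSubgroup).out := by
    have : ((1 : IntCompletedGroupRing K G).1 H) = MonoidAlgebra.single 1 1 := rfl
    rw [riemannSum, this, linExt_single]; simp
  have h3 : ‖f (1 : G ⧸ H.toSubgroup).out - f 1‖ ≤ ε :=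
    hH.of_mk_eq (by rw [QuotientGroup.out_eq']; rfl)
  rw [dist_eq_norm, integralCLM_apply,
    ← sub_add_sub_cancel (integral f 1) (riemannSum f H 1) (f 1)]
  exact (IsUltrametricDist.norm_add_le_max _ _).trans (max_le h1 (h2 ▸ h3))

/-- The left translates `h ↦ f (g h)` of `f`, as a continuous function of `g`. -/
def leftTranslates (f : C(G, K)) : C(G, C(G, K)) :=
  ContinuousMap.curry ⟨fun q : G × G => f (q.1 * q.2), by fun_prop⟩

lemma leftTranslates_apply (f : C(G, K)) (g h : G) : leftTranslates f g h = f (g * h) := rfl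

/-- The function `g ↦ ∫ f (g h) dν(h)`. -/
def partialIntegral (f : C(G, K)) (ν : IntCompletedGroupRing K G) : C(G, K) :=
  (⟨integralCLM ν, (integralCLM ν).continuous⟩ : C(C(G, K), K)).comp (leftTranslates f)

lemma partialIntegral_apply (f : C(G, K)) (ν : IntCompletedGroupRing K G) (g : G) :
    partialIntegral f ν g = integralCLM ν (leftTranslates f g) := rfl

/-- The multiplication of `o[[G]]` is the convolution of measures:
`∫ f d(μν) = ∫∫ f (g h) dν(h) dμ(g)`. -/
lemma integralCLM_mul (μ ν : IntCompletedGroupRing K G) (f : C(G, K)) :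
    integralCLM (μ * ν) f = integralCLM μ (partialIntegral f ν) := by
  refine eq_of_forall_dist_le fun ε hε => ?_
  obtain ⟨H, hH⟩ := exists_smallOn f hε
  have hH' : ∀ g, SmallOn (leftTranslates f g) H ε := fun g a h hh => by
    simpa [leftTranslates_apply, mul_assoc] using hH (g * a) h hh
  have hP : SmallOn (partialIntegral f ν) H ε := fun g h hh => by
    rw [partialIntegral_apply, partialIntegral_apply, ← map_sub]
    refine (norm_integral_le _ _).trans ?_
    refine (ContinuousMap.norm_le _ hε.le).2 fun a => ?_
    rw [ContinuousMap.sub_apply, leftTranslates_apply, leftTranslates_apply]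
    refine hH.of_mk_eq ?_
    have hh1 : (h : G ⧸ H.toSubgroup) = 1 := (QuotientGroup.eq_one_iff h).2 hh
    simp only [QuotientGroup.mk_mul, hh1, mul_one]
  have h1 := norm_integral_sub_le f hε.le hH (μ * ν)
  have h2 := norm_integral_sub_le (partialIntegral f ν) hε.le hP μ
  have h3 : ‖riemannSum f H (μ * ν) - riemannSum (partialIntegral f ν) H μ‖ ≤ ε := by
    have e : riemannSum f H (μ * ν) = linExt (fun x : G ⧸ H.toSubgroup =>
        linExt (fun y : G ⧸ H.toSubgroup => f (x * y).out) (ν.1 H)) (μ.1 H) := linExt_mul _ _ _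
    rw [e, riemannSum, linExt_sub]
    refine norm_linExt_le hε.le (fun x => ?_) _
    rw [partialIntegral_apply, integralCLM_apply]
    have h4 := norm_integral_sub_le (leftTranslates f x.out) hε.le (hH' _) ν
    have h5 : ‖linExt (fun y : G ⧸ H.toSubgroup => f (x * y).out) (ν.1 H) -
        riemannSum (leftTranslates f x.out) H ν‖ ≤ ε := by
      rw [riemannSum, linExt_sub]
      refine norm_linExt_le hε.le (fun y => ?_) _
      rw [leftTranslates_apply]
      refine hH.of_mk_eq ?_
      simp only [QuotientGroup.mk_mul, QuotientGroup.out_eq']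
    rw [← sub_sub_sub_cancel_right _ _ (riemannSum (leftTranslates f x.out) H ν)]
    exact (norm_sub_le_max' _ _).trans (max_le h5 h4)
  rw [dist_eq_norm, integralCLM_apply, integralCLM_apply,
    ← sub_add_sub_cancel _ (riemannSum f H (μ * ν)) _]
  refine (IsUltrametricDist.norm_add_le_max _ _).trans (max_le h1 ?_)
  rw [← sub_sub_sub_cancel_right _ _ (riemannSum (partialIntegral f ν) H μ)]
  exact (norm_sub_le_max' _ _).trans (max_le h3 h2)

/-- Integration of a continuous function against elements of `K[[G]]`. -/
def integralK (f : C(G, K)) : CompletedGroupRing K G →ₗ[K] K :=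
  LinearMap.liftBaseChange K
    { toFun := fun μ => integralCLM μ f
      map_add' := fun μ ν => by rw [integralCLM_add]; rfl
      map_smul' := fun c μ => by rw [integralCLM_smul]; rfl }

/-- The homomorphism `o[[G]] → K` extending a continuous character `ψ : G → oˣ`. -/
def intCharacter (ψ : G →ₜ* (IntegerRing K)ˣ) : IntCompletedGroupRing K G →ₐ[IntegerRing K] K :=
  let f : C(G, K) :=
    ⟨fun g => ((ψ g : IntegerRing K) : K),
      continuous_subtype_val.comp (Units.continuous_val.comp ψ.continuous_toFun)⟩
  have hf : ∀ (c : IntegerRing K), integralCLM (algebraMap _ (IntCompletedGroupRing K G) c) f =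
      (c : K) := fun c => by
    rw [Algebra.algebraMap_eq_smul_one, integralCLM_smul, smul_apply,
      integralCLM_one]
    simp [f]
  { toFun := fun μ => integralCLM μ f
    map_one' := by rw [integralCLM_one]; simp [f]
    map_mul' := fun μ ν => by
      have : partialIntegral f ν = integralCLM ν f • f := by
        ext g
        have : leftTranslates f g = f g • f := by
          ext h; simp [leftTranslates_apply, f]
        rw [partialIntegral_apply, this, map_smul]
        simp [mul_comm]
      rw [integralCLM_mul, this, map_smul, smul_eq_mul, mul_comm]
    map_zero' := by simpa using hf 0
    map_add' := fun μ ν => by rw [integralCLM_add]; rfl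
    commutes' := hf }

/-- The homomorphism of `K`-algebras `K[[G]] → K` extending a continuous character
`ψ : G → oˣ`. -/
def character (ψ : G →ₜ* (IntegerRing K)ˣ) : CompletedGroupRing K G →ₐ[K] K :=
  Algebra.TensorProduct.lift (AlgHom.id K K) (intCharacter ψ) fun _ _ => mul_comm _ _

end Integral

/-! ### Banach space representations -/

section Representations

variable (K : Type*) [NontriviallyNormedField K] [IsUltrametricDist K]
  (G : Type*) [Group G] [TopologicalSpace G] [IsTopologicalGroup G]

/-- A `K`-Banach space representation of `G` on the Banach space `E`: an action of `G` by continuous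
linear automorphisms such that `G × E → E` is continuous. -/
structure BanachRep (E : Type*) [NormedAddCommGroup E] [NormedSpace K E] [CompleteSpace E] where
  /-- The action of `G` on `E`. -/
  action : G →* (E →L[K] E)
  continuous_action : Continuous fun q : G × E => action q.1 q.2

variable {K G} {E : Type*} [NormedAddCommGroup E] [NormedSpace K E] [CompleteSpace E]

namespace BanachRep

/-- Topological irreducibility: `E` is nonzero, and `0` and `E` are the only closed `G`-invariant
subspaces. -/
def IsTopologicallyIrreducible (ρ : BanachRep K G E) : Prop :=
  Nontrivial E ∧ ∀ W : Submodule K E, IsClosed (W : Set E) →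
    (∀ g : G, ∀ v ∈ W, ρ.action g v ∈ W) → W = ⊥ ∨ W = ⊤

/-- The vectors `v` whose class in `E/L` is fixed by `H`. -/
def fixedModulo (ρ : BanachRep K G E) (L : Submodule (IntegerRing K) E) (H : Subgroup G) :
    Submodule (IntegerRing K) E where
  carrier := {v | ∀ h ∈ H, ρ.action h v - v ∈ L}
  zero_mem' h _ := by simp
  add_mem' {v w} hv hw h hh := by
    rw [map_add, add_sub_add_comm]
    exact L.add_mem (hv h hh) (hw h hh)
  smul_mem' c v hv h hh := by
    have : ρ.action h (c • v) - c • v = c • (ρ.action h v - v) := by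
      rw [smul_sub, Subring.smul_def, Subring.smul_def, map_smul]
    rw [this]
    exact L.smul_mem c (hv h hh)

/-- The submodule `(E/L)^H` of `H`-invariants in `E/L`, for a `G`-invariant `L`. -/
def quotientInvariants (ρ : BanachRep K G E) (L : Submodule (IntegerRing K) E) (H : Subgroup G) :
    Submodule (IntegerRing K) (E ⧸ L) :=
  (ρ.fixedModulo L H).map L.mkQ

end BanachRep

/-- An `o`-module `N` is of cofinite type if its Pontrjagin dual `Hom_o(N, K/o)` is finitely
generated. -/
def IsOfCofiniteType (K : Type*) [NontriviallyNormedField K] [IsUltrametricDist K]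
    (N : Type*) [AddCommGroup N] [Module (IntegerRing K) N] : Prop :=
  Module.Finite (IntegerRing K)
    (N →ₗ[IntegerRing K] (K ⧸ LinearMap.range (Algebra.linearMap (IntegerRing K) K)))

namespace BanachRep

/-- Admissibility: there is a `G`-invariant bounded open `o`-submodule `L` of `E` such that
`(E/L)^H` is of cofinite type for every open normal subgroup `H` of `G`. -/
def IsAdmissible (ρ : BanachRep K G E) : Prop :=
  ∃ L : Submodule (IntegerRing K) E,
    (∀ g : G, ∀ v ∈ L, ρ.action g v ∈ L) ∧
    Bornology.IsBounded (L : Set E) ∧ IsOpen (L : Set E) ∧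
    ∀ H : OpenNormalSubgroup G, IsOfCofiniteType K (ρ.quotientInvariants L H.toSubgroup)

variable [CompactSpace G]

/-- For a continuous linear form `ℓ`, the map sending `v ∈ E` to the continuous function
`g ↦ ℓ(g⁻¹ v)`. -/
def coefficient (ρ : BanachRep K G E) (ℓ : E →L[K] K) : E →L[K] C(G, K) where
  toFun v := ⟨fun g => ℓ (ρ.action g⁻¹ v),
    ℓ.continuous.comp (ρ.continuous_action.comp
      (continuous_inv.prodMk continuous_const))⟩
  map_add' v w := by ext g; simp
  map_smul' c v := by ext g; simp
  cont := by
    have h : Continuous fun q : E × G => ℓ (ρ.action q.2⁻¹ q.1) :=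
      ℓ.continuous.comp (ρ.continuous_action.comp (continuous_snd.inv.prodMk continuous_fst))
    exact (ContinuousMap.curry ⟨_, h⟩).continuous

lemma coefficient_apply (ρ : BanachRep K G E) (ℓ : E →L[K] K) (v : E) (g : G) :
    ρ.coefficient ℓ v g = ℓ (ρ.action g⁻¹ v) := rfl

/-- The continuous dual `E'` of a Banach space representation. -/
def Dual (_ρ : BanachRep K G E) : Type _ := E →L[K] K

instance (ρ : BanachRep K G E) : AddCommGroup ρ.Dual := inferInstanceAs (AddCommGroup (E →L[K] K))

instance (ρ : BanachRep K G E) : Module K ρ.Dual := inferInstanceAs (Module K (E →L[K] K))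

/-- The linear form underlying an element of the dual. -/
def Dual.form {ρ : BanachRep K G E} (ℓ : ρ.Dual) : E →L[K] K := ℓ

variable [TotallyDisconnectedSpace G] [CompleteSpace K]

/-- The action of `o[[G]]` on the dual: `(μ ℓ)(v) = ∫ ℓ(g⁻¹ v) dμ(g)`. -/
def intDualAction (ρ : BanachRep K G E) :
    IntCompletedGroupRing K G →ₐ[IntegerRing K] Module.End K (E →L[K] K) :=
  AlgHom.ofLinearMap
    { toFun := fun μ =>
        { toFun := fun ℓ => (integralCLM μ).comp (ρ.coefficient ℓ)
          map_add' := fun ℓ ℓ' => by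
            ext v
            have : ρ.coefficient (ℓ + ℓ') v = ρ.coefficient ℓ v + ρ.coefficient ℓ' v := by
              ext g; simp [coefficient_apply]
            simp [this]
          map_smul' := fun c ℓ => by
            ext v
            have : ρ.coefficient (c • ℓ) v = c • ρ.coefficient ℓ v := by
              ext g; simp [coefficient_apply]
            simp [this] }
      map_add' := fun μ ν => by ext ℓ v; simp [integralCLM_add]
      map_smul' := fun c μ => by
        ext ℓ v
        simp [integralCLM_smul, Subring.smul_def] }
    (by
      ext ℓ v
      simp [integralCLM_one, coefficient_apply])
    (fun μ ν => by
      ext ℓ v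
      have : partialIntegral (ρ.coefficient ℓ v) ν =
          ρ.coefficient ((integralCLM ν).comp (ρ.coefficient ℓ)) v := by
        ext g
        have : leftTranslates (ρ.coefficient ℓ v) g = ρ.coefficient ℓ (ρ.action g⁻¹ v) := by
          ext h
          simp [leftTranslates_apply, coefficient_apply, map_mul]
        rw [partialIntegral_apply, this]
        rfl
      simp only [LinearMap.coe_mk, AddHom.coe_mk, ContinuousLinearMap.comp_apply,
        Module.End.mul_apply]
      rw [integralCLM_mul, this])

/-- The action of `K[[G]]` on the dual. -/
def dualAction (ρ : BanachRep K G E) : CompletedGroupRing K G →ₐ[K] Module.End K (E →L[K] K) :=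
  Algebra.TensorProduct.lift (Algebra.ofId K (Module.End K (E →L[K] K))) ρ.intDualAction
    fun c _ => Algebra.commutes c _

/-- The dual of a Banach space representation as a `K[[G]]`-module. -/
instance (ρ : BanachRep K G E) : Module (CompletedGroupRing K G) ρ.Dual :=
  letI : Module (Module.End K (E →L[K] K)) ρ.Dual :=
    inferInstanceAs (Module (Module.End K (E →L[K] K)) (E →L[K] K))
  Module.compHom ρ.Dual ρ.dualAction.toRingHom

end BanachRep

end Representations

/-! ### Extension of scalars along a homomorphism of (noncommutative) rings -/

section Induced

open TensorProduct

variable {R A K : Type*} [Ring R] [Ring A] [Field K]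

/-- The relations `(a r) ⊗ v = a ⊗ (r v)` defining `A ⊗_R K`. -/
def balancedRelations (i : R →+* A) (χ : R →+* K) : Submodule A (A ⊗[ℤ] K) :=
  Submodule.span A {z | ∃ (a : A) (r : R) (v : K), z = (a * i r) ⊗ₜ[ℤ] v - a ⊗ₜ[ℤ] (χ r * v)}

/-- The left `A`-module `A ⊗_R K^{(χ)}`, where `A` is a right `R`-module through `i : R → A` and
`K^{(χ)}` is `K` with `R` acting through `χ : R → K`. -/
abbrev InducedModule (i : R →+* A) (χ : R →+* K) : Type _ :=
  (A ⊗[ℤ] K) ⧸ balancedRelations i χ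

/-- The element `a ⊗ v` of `A ⊗_R K^{(χ)}`. -/
def InducedModule.tmul (i : R →+* A) (χ : R →+* K) (a : A) (v : K) : InducedModule i χ :=
  Submodule.Quotient.mk (a ⊗ₜ[ℤ] v)

end Induced

/-! ### The group `GL₂(ℤ_p)` and its principal series -/

section GLTwo

variable (p : ℕ) [Fact p.Prime]

/-- The group `GL₂(ℤ_p)`. -/
abbrev GLTwo : Type := GL (Fin 2) ℤ_[p]

instance : CompactSpace (Matrix (Fin 2) (Fin 2) ℤ_[p]) :=
  inferInstanceAs (CompactSpace (Fin 2 → Fin 2 → ℤ_[p]))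

instance : TotallyDisconnectedSpace (Matrix (Fin 2) (Fin 2) ℤ_[p]) :=
  inferInstanceAs (TotallyDisconnectedSpace (Fin 2 → Fin 2 → ℤ_[p]))

instance : CompactSpace (GLTwo p) :=
  inferInstanceAs (CompactSpace (Matrix (Fin 2) (Fin 2) ℤ_[p])ˣ)

instance : TotallyDisconnectedSpace (GLTwo p) :=
  ⟨isTotallyDisconnected_of_image (f := fun g : GLTwo p => g.1) Units.continuous_val.continuousOn
    Units.val_injective (isTotallyDisconnected_of_totallyDisconnectedSpace _)⟩

lemma inv_zero_one (g : GLTwo p) (h : g.1 0 1 = 0) : (g⁻¹).1 0 1 = 0 := by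
  rw [Matrix.coe_units_inv, Matrix.inv_def, Matrix.adjugate_fin_two]
  simp [h]

lemma inv_one_zero (g : GLTwo p) (h : g.1 1 0 = 0) : (g⁻¹).1 1 0 = 0 := by
  rw [Matrix.coe_units_inv, Matrix.inv_def, Matrix.adjugate_fin_two]
  simp [h]

/-- The subgroup `P` of lower triangular matrices. -/
def lowerTriangular : Subgroup (GLTwo p) where
  carrier := {g | g.1 0 1 = 0}
  one_mem' := by simp
  mul_mem' {g h} hg hh := by
    simp only [Set.mem_ofPred_eq] at hg hh ⊢
    simp [Matrix.mul_apply, Fin.sum_univ_two, hg, hh]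
  inv_mem' {g} hg := inv_zero_one p g hg

/-- The subgroup `T` of diagonal matrices. -/
def torus : Subgroup (GLTwo p) where
  carrier := {g | g.1 0 1 = 0 ∧ g.1 1 0 = 0}
  one_mem' := by simp
  mul_mem' {g h} hg hh := by
    simp only [Set.mem_ofPred_eq] at hg hh ⊢
    simp [Matrix.mul_apply, Fin.sum_univ_two, hg, hh]
  inv_mem' {g} hg := ⟨inv_zero_one p g hg.1, inv_one_zero p g hg.2⟩

lemma continuous_entry (i j : Fin 2) : Continuous fun g : GLTwo p => g.1 i j :=
  Continuous.matrix_elem Units.continuous_val i j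

instance : CompactSpace (lowerTriangular p) :=
  isCompact_iff_compactSpace.1
    (isClosed_eq (continuous_entry p 0 1) continuous_const).isCompact

instance : CompactSpace (torus p) :=
  isCompact_iff_compactSpace.1
    ((isClosed_eq (continuous_entry p 0 1) continuous_const).inter
      (isClosed_eq (continuous_entry p 1 0) continuous_const)).isCompact

/-- The diagonal matrix with entries `a`, `d`. -/
def diagonalElement (a d : ℤ_[p]ˣ) : torus p :=
  ⟨⟨!![(a : ℤ_[p]), 0; 0, d], !![((a⁻¹ : ℤ_[p]ˣ) : ℤ_[p]), 0; 0, ((d⁻¹ : ℤ_[p]ˣ) : ℤ_[p])],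
    by simp [Matrix.one_fin_two],
    by simp [Matrix.one_fin_two]⟩, by constructor <;> simp⟩

/-- The `i`-th diagonal entry of a lower triangular matrix, as a unit. -/
def diagonalEntry (i : Fin 2) (g : lowerTriangular p) : ℤ_[p]ˣ where
  val := g.1.1 i i
  inv := (g⁻¹).1.1 i i
  val_inv := by
    have h : (g.1.1 * (g⁻¹).1.1) i i = 1 := by
      rw [show g.1.1 * (g⁻¹).1.1 = 1 from g.1.mul_inv, Matrix.one_apply_eq]
    have h0 : g.1.1 0 1 = 0 := g.2
    have h1 : (g⁻¹).1.1 0 1 = 0 := (g⁻¹).2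
    rw [Matrix.mul_apply, Fin.sum_univ_two] at h
    fin_cases i
    · simpa only [Fin.zero_eta, h0, h1, zero_mul, add_zero] using h
    · simpa only [Fin.mk_one, h0, h1, mul_zero, zero_add] using h
  inv_val := by
    have h : ((g⁻¹).1.1 * g.1.1) i i = 1 := by
      rw [show (g⁻¹).1.1 * g.1.1 = 1 from g.1.inv_mul, Matrix.one_apply_eq]
    have h0 : g.1.1 0 1 = 0 := g.2
    have h1 : (g⁻¹).1.1 0 1 = 0 := (g⁻¹).2
    rw [Matrix.mul_apply, Fin.sum_univ_two] at h
    fin_cases i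
    · simpa only [Fin.zero_eta, h0, h1, zero_mul, add_zero] using h
    · simpa only [Fin.mk_one, h0, h1, mul_zero, zero_add] using h

/-- The projection `P → T`, replacing the off-diagonal entry by `0`. -/
def projectionToTorus : lowerTriangular p →ₜ* torus p where
  toFun g := diagonalElement p (diagonalEntry p 0 g) (diagonalEntry p 1 g)
  map_one' := by
    ext i j
    fin_cases i <;> fin_cases j <;> simp [diagonalElement, diagonalEntry]
  map_mul' g h := by
    have h0 : g.1.1 0 1 = 0 := g.2
    have h1 : h.1.1 0 1 = 0 := h.2
    ext i j
    fin_cases i <;> fin_cases j <;>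
      simp [diagonalElement, diagonalEntry, Matrix.mul_apply, Fin.sum_univ_two, h0, h1]
  continuous_toFun := by
    refine Continuous.subtype_mk (Units.continuous_iff.2 ⟨?_, ?_⟩) _
    · refine continuous_matrix fun i j => ?_
      fin_cases i <;> fin_cases j
      · change Continuous fun g : lowerTriangular p => g.1.1 0 0
        exact (continuous_entry p 0 0).comp continuous_subtype_val
      · exact continuous_const
      · exact continuous_const
      · change Continuous fun g : lowerTriangular p => g.1.1 1 1
        exact (continuous_entry p 1 1).comp continuous_subtype_val
    · refine continuous_matrix fun i j => ?_
      fin_cases i <;> fin_cases j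
      · change Continuous fun g : lowerTriangular p => (g⁻¹).1.1 0 0
        exact (continuous_entry p 0 0).comp (continuous_subtype_val.comp continuous_inv)
      · exact continuous_const
      · exact continuous_const
      · change Continuous fun g : lowerTriangular p => (g⁻¹).1.1 1 1
        exact (continuous_entry p 1 1).comp (continuous_subtype_val.comp continuous_inv)

/-- The inclusion `P → G`. -/
def inclusionLower : lowerTriangular p →ₜ* GLTwo p where
  toMonoidHom := (lowerTriangular p).subtype
  continuous_toFun := continuous_subtype_val

variable {p} {K : Type*} [NontriviallyNormedField K] [IsUltrametricDist K]

/-- `Ind_P^G(χ)`: the continuous functions `f : G → K` with `f(gb) = χ(b⁻¹) f(g)` for `g ∈ G` and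
`b ∈ P`, where `χ` is viewed as a character of `P` through the projection `P → T`. -/
def Ind (χ : torus p →ₜ* (IntegerRing K)ˣ) : Submodule K C(GLTwo p, K) where
  carrier := {f | ∀ (g : GLTwo p) (b : lowerTriangular p),
    f (g * b) = ((χ (projectionToTorus p b⁻¹) : IntegerRing K) : K) * f g}
  zero_mem' g b := by simp
  add_mem' {f f'} hf hf' g b := by
    rw [ContinuousMap.add_apply, ContinuousMap.add_apply, hf g b, hf' g b, mul_add]
  smul_mem' c f hf g b := by
    rw [ContinuousMap.smul_apply, ContinuousMap.smul_apply, hf g b, smul_eq_mul, smul_eq_mul,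
      mul_left_comm]

lemma isClosed_Ind (χ : torus p →ₜ* (IntegerRing K)ˣ) :
    IsClosed (Ind χ : Set C(GLTwo p, K)) := by
  have : (Ind χ : Set C(GLTwo p, K)) = ⋂ (g : GLTwo p) (b : lowerTriangular p),
      {f | f (g * b) = ((χ (projectionToTorus p b⁻¹) : IntegerRing K) : K) * f g} := by
    ext f; simp [Ind]
  rw [this]
  exact isClosed_iInter fun g => isClosed_iInter fun b =>
    isClosed_eq (continuous_eval_const _)
      (continuous_const.mul (continuous_eval_const _))

variable [CompleteSpace K]

instance (χ : torus p →ₜ* (IntegerRing K)ˣ) : CompleteSpace (Ind χ) :=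
  (isClosed_Ind χ).completeSpace_coe

/-- The principal series: `G` acts on `Ind_P^G(χ)` by left translation, `(g f)(h) = f(g⁻¹ h)`. -/
def principalSeries (χ : torus p →ₜ* (IntegerRing K)ˣ) : BanachRep K (GLTwo p) (Ind χ) where
  action :=
    { toFun := fun g =>
        { toFun := fun f => ⟨f.1.comp ⟨fun h => g⁻¹ * h, by fun_prop⟩, fun h b => by
            simpa [mul_assoc] using f.2 (g⁻¹ * h) b⟩
          map_add' := fun _ _ => rfl
          map_smul' := fun _ _ => rfl
          cont := Continuous.subtype_mk
            ((ContinuousMap.continuous_precomp _).comp continuous_subtype_val) _ }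
      map_one' := by ext f h; simp
      map_mul' := fun g g' => by ext f h; simp [mul_assoc] }
  continuous_action := by
    refine Continuous.subtype_mk ?_ _
    have h : Continuous fun g : GLTwo p =>
        (⟨fun h => g⁻¹ * h, by fun_prop⟩ : C(GLTwo p, GLTwo p)) :=
      (ContinuousMap.curry ⟨fun q : GLTwo p × GLTwo p => q.1⁻¹ * q.2, by fun_prop⟩).continuous
    exact ContinuousMap.continuous_comp'.comp
      ((h.comp continuous_fst).prodMk (continuous_subtype_val.comp continuous_snd))

/-- The module `M_χ = K[[G]] ⊗_{K[[P]]} K^{(χ)}`, where `K^{(χ)}` is the one-dimensional module given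
by `K[[P]] → K[[T]] → K`, the second map being the extension of `χ`. -/
abbrev InducedIwasawaModule (χ : torus p →ₜ* (IntegerRing K)ˣ) : Type _ :=
  InducedModule (mapCompleted K (inclusionLower p)).toRingHom
    ((character χ).comp (mapCompleted K (projectionToTorus p))).toRingHom

/-- The element `a ⊗ v` of `M_χ`. -/
def InducedIwasawaModule.tmul (χ : torus p →ₜ* (IntegerRing K)ˣ)
    (a : CompletedGroupRing K (GLTwo p)) (v : K) : InducedIwasawaModule χ :=
  InducedModule.tmul _ _ a v

/-- The logarithm series `log x = ∑_{n ≥ 1} (-1)^{n+1} (x - 1)^n / n`, convergent for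
`‖x - 1‖ < 1`. -/
def logSeries (x : K) : K := ∑' n : ℕ, (-1) ^ n * (x - 1) ^ (n + 1) / ((n : K) + 1)

/-- `c = c(χ)`: for all `a` sufficiently close to `1`,
`χ(diag(a⁻¹, a)) = exp(c log a)`. -/
def HasExponent [NormedAlgebra ℚ_[p] K] (χ : torus p →ₜ* (IntegerRing K)ˣ) (c : K) : Prop :=
  ∀ᶠ a in 𝓝 (1 : ℤ_[p]ˣ), ((χ (diagonalElement p a⁻¹ a) : IntegerRing K) : K) =
    NormedSpace.exp (c * logSeries (algebraMap ℚ_[p] K ((a : ℤ_[p]) : ℚ_[p])))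

end GLTwo

end IwasawaRep
end

/-! Duality. Values on indicator functions of cosets identify `o[[G]]` with the unit ball of the
dual of `C(G, K)`. Evaluation at `1` on `Ind_P^G(χ)` is an eigenvector of `P` for `χ⁻¹`, which gives
the map `toDual`. It is onto because a continuous section of `G → G/P` splits off `Ind_P^G(χ)` from
`C(G, K)`, so that linear forms extend. For injectivity the tensor product is not completed, so a
measure killing `Ind_P^G(χ)` must be a finite sum of terms `κ_j (δ_{b_j} - χ⁻¹(b_j))`. This works
because `P` is topologically finitely generated: at each finite level the `κ_j` come from
telescoping along words in the generators, with norms at most one, and weak-* compactness of the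
unit ball passes to the limit (`exists_form_of_vanishing`).

Admissibility. For the unit ball `L`, the `H`-invariants of the quotient embed into finitely many
copies of `K/o` by evaluation on `G/H`. Since `K/o` is injective with endomorphism ring `o`, the
Pontrjagin dual is a quotient of a finite free module.

Irreducibility. Read functions on the upper unipotents as functions on `ℤ_p`. A closed subspace
stable under translations either maps onto `C(ℤ_p, K)` or has reductions of bounded degree in the
Mahler basis (`surjective_or_mahlerCoeff_lt_one`); with enough charts the second case forces finite
dimension. A finite-dimensional stable subspace is impossible unless its chart vanishes. Translation
is conjugate to its `(1+p)`-th power by a dilation, so it has a periodic vector, hence a function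
constant near `0`. The lower unipotents then turn `xⁿ` into `-(c+n) xⁿ⁺¹`, so all monomials occur
when `c ≠ -n` (`chart_eq_zero_of_finiteDimensional`). So a nonzero closed invariant `W` maps onto
`C(ℤ_p, K)`. If that map were injective, every `f` in `W` would be a difference `u f' - f'` with `u`
upper unipotent and would vanish at the fixed point of `u` on `G/P`, forcing `W = 0`. Hence `W`
contains a nonzero function supported on the small cell. The dichotomy, applied to the functions of
`W` with that support, yields all of them, and their translates span `Ind_P^G(χ)`. -/

namespace IwasawaRep

/-! ### The `p`-adic exponential and logarithm -/

section ExpLog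

variable {K : Type*} [NontriviallyNormedField K]

variable (K) in
/-- `K` is a field of characteristic zero. -/
lemma charZero_of_padicAlgebra (p : ℕ) [Fact p.Prime] [NormedAlgebra ℚ_[p] K] : CharZero K :=
  charZero_of_injective_algebraMap (FaithfulSMul.algebraMap_injective ℚ_[p] K)

lemma norm_natCast_eq (p : ℕ) [Fact p.Prime] [NormedAlgebra ℚ_[p] K] (n : ℕ) : ‖(n : K)‖ = ‖(n : ℚ_[p])‖ := by
  rw [← map_natCast (algebraMap ℚ_[p] K), norm_algebraMap']

/-- Legendre's formula: `(p-1) v(n!)` is `n` minus the digit sum of `n`, so `v(n!) ≤ n`. This crude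
bound already gives a positive radius of convergence. -/
lemma norm_factorial_inv_le (p : ℕ) [Fact p.Prime] [NormedAlgebra ℚ_[p] K] (n : ℕ) : ‖((n.factorial : ℕ) : K)‖⁻¹ ≤ (p : ℝ) ^ n := by
  have hp : p.Prime := Fact.out
  rw [norm_natCast_eq p, Padic.norm_eq_zpow_neg_valuation
    (Nat.cast_ne_zero.2 n.factorial_ne_zero), Padic.valuation_natCast, ← zpow_neg, neg_neg,
    zpow_natCast]
  refine pow_le_pow_right₀ (by exact_mod_cast hp.one_lt.le) ?_
  have h := sub_one_mul_padicValNat_factorial (p := p) n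
  have h1 : 1 ≤ p - 1 := by have := hp.two_le; omega
  calc padicValNat p n.factorial ≤ (p - 1) * padicValNat p n.factorial :=
        Nat.le_mul_of_pos_left _ h1
    _ ≤ n := by rw [h]; exact Nat.sub_le _ _

lemma norm_succ_inv_le (p : ℕ) [Fact p.Prime] [NormedAlgebra ℚ_[p] K] (n : ℕ) : ‖((n : K) + 1)‖⁻¹ ≤ (p : ℝ) ^ (n + 1) := by
  have := charZero_of_padicAlgebra K p
  refine le_trans ?_ (norm_factorial_inv_le p (K := K) (n + 1))
  rw [Nat.factorial_succ, Nat.cast_mul, norm_mul, mul_inv, Nat.cast_succ]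
  refine le_mul_of_one_le_right (by positivity) ?_
  rw [norm_natCast_eq p]
  exact (one_le_inv₀ (norm_pos_iff.2 (Nat.cast_ne_zero.2 n.factorial_ne_zero))).2
    (by simpa using Padic.norm_int_le_one (p := p) (n.factorial : ℤ))

lemma radius_pos_of_norm_le (p : ℕ) [Fact p.Prime] {c : ℕ → K} {C : ℝ} (h : ∀ n, ‖c n‖ ≤ C * (p : ℝ) ^ n) :
    0 < (FormalMultilinearSeries.ofScalars K c).radius := by
  have hp : (0 : ℝ) < p := by exact_mod_cast (Fact.out : p.Prime).pos
  have : ((p : NNReal)⁻¹ : NNReal) ≤ (FormalMultilinearSeries.ofScalars K c).radius := by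
    refine FormalMultilinearSeries.le_radius_of_bound _ C fun n => ?_
    rw [FormalMultilinearSeries.ofScalars_norm]
    push_cast
    rw [inv_pow, mul_inv_le_iff₀ (by positivity)]
    exact h n
  refine lt_of_lt_of_le ?_ this
  simp only [ENNReal.coe_pos]
  exact inv_pos.2 (by exact_mod_cast (Fact.out : p.Prime).pos)

variable (K) in
lemma expSeries_radius_pos' (p : ℕ) [Fact p.Prime] [NormedAlgebra ℚ_[p] K] : 0 < (NormedSpace.expSeries K K).radius := by
  rw [NormedSpace.expSeries_eq_ofScalars]
  exact radius_pos_of_norm_le p (C := 1) fun n => by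
    rw [norm_inv, one_mul]; exact norm_factorial_inv_le p n

/-- The coefficients of the logarithm series at `1`. -/
def logCoeff (K : Type*) [Field K] (n : ℕ) : K := if n = 0 then 0 else (-1) ^ (n + 1) / n

variable (K) in
lemma logCoeff_radius_pos (p : ℕ) [Fact p.Prime] [NormedAlgebra ℚ_[p] K] : 0 < (FormalMultilinearSeries.ofScalars K (logCoeff K)).radius := by
  refine radius_pos_of_norm_le p (C := 1) fun n => ?_
  rcases n with _ | n
  · simp [logCoeff]
  · have := norm_succ_inv_le p (K := K) n
    simpa [logCoeff] using! this

lemma logSeries_eq (z : K) (hz : Summable fun n => logCoeff K n * z ^ n) :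
    logSeries (1 + z) = FormalMultilinearSeries.ofScalarsSum (logCoeff K) z := by
  rw [FormalMultilinearSeries.ofScalarsSum_eq_tsum]
  simp only [smul_eq_mul]
  rw [hz.tsum_eq_zero_add, logSeries]
  simp only [logCoeff, if_pos, zero_mul, zero_add, add_sub_cancel_left, Nat.add_eq_zero_iff,
    one_ne_zero, and_false, if_false]
  exact tsum_congr fun n => by push_cast; ring

variable [CompleteSpace K]

variable (K) in
lemma hasFPowerSeriesAt_log (p : ℕ) [Fact p.Prime] [NormedAlgebra ℚ_[p] K] : HasFPowerSeriesAt (fun z : K => logSeries (1 + z))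
    (FormalMultilinearSeries.ofScalars K (logCoeff K)) 0 := by
  have h := (FormalMultilinearSeries.ofScalars K (logCoeff K)).hasFPowerSeriesOnBall
    (logCoeff_radius_pos K p)
  refine h.hasFPowerSeriesAt.congr ?_
  filter_upwards [Metric.eball_mem_nhds (0 : K) (logCoeff_radius_pos K p)] with z hz
  refine (logSeries_eq z ?_).symm
  have := (FormalMultilinearSeries.ofScalars K (logCoeff K)).summable hz
  simpa [FormalMultilinearSeries.ofScalars_apply_eq, mul_comm] using this

/-- The derivative series is evaluated in the direction `z` itself, so that every term lies on the
diagonal. The price is the factor `z`, to be cancelled where `z ≠ 0`. -/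
lemma hasSum_deriv_mul {c : ℕ → K} {f : K → K} {r : ENNReal}
    (hf : HasFPowerSeriesOnBall f (FormalMultilinearSeries.ofScalars K c) 0 r) {z : K}
    (hz : z ∈ Metric.eball 0 r) :
    HasSum (fun n : ℕ => ((n : K) + 1) * (c (n + 1) * z ^ (n + 1))) (deriv f z * z) := by
  have h2 := hf.fderiv.hasSum hz
  rw [zero_add] at h2
  have h3 : HasSum (fun n => (FormalMultilinearSeries.ofScalars K c).derivSeries n (fun _ => z) z)
      (fderiv K f z z) := h2.mapL (ContinuousLinearMap.apply K K z)
  have h4 : fderiv K f z z = deriv f z * z := by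
    rw [← fderiv_apply_one_eq_deriv, mul_comm, ← smul_eq_mul, ← map_smul, smul_eq_mul, mul_one]
  rw [h4] at h3
  refine h3.congr_fun fun n => ?_
  rw [FormalMultilinearSeries.derivSeries_apply_diag, FormalMultilinearSeries.ofScalars_apply_eq,
    nsmul_eq_mul, smul_eq_mul]
  push_cast
  rfl

lemma logCoeff_one : logCoeff K 1 = 1 := by simp [logCoeff]

/-- The termwise derivative of the logarithm is a geometric series in `-z`. -/
lemma succ_mul_logCoeff [CharZero K] (z : K) (n : ℕ) :
    ((n : K) + 1) * (logCoeff K (n + 1) * z ^ (n + 1)) = (-z) ^ n * z := by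
  have hn : (n : K) + 1 ≠ 0 := Nat.cast_add_one_ne_zero n
  rw [logCoeff, if_neg n.succ_ne_zero, neg_pow z]
  push_cast
  field_simp
  ring

variable (K) in
lemma hasDerivAt_log_zero (p : ℕ) [Fact p.Prime] [NormedAlgebra ℚ_[p] K] :
    HasDerivAt (fun z : K => logSeries (1 + z)) 1 0 := by
  have h := (hasFPowerSeriesAt_log K p).hasStrictDerivAt.hasDerivAt
  rw [FormalMultilinearSeries.ofScalars_apply_eq, logCoeff_one] at h
  simpa using h

variable (K) in
lemma deriv_log_eventually (p : ℕ) [Fact p.Prime] [NormedAlgebra ℚ_[p] K] : ∀ᶠ z : K in 𝓝 0,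
    HasDerivAt (fun z : K => logSeries (1 + z)) (1 + z)⁻¹ z := by
  have := charZero_of_padicAlgebra K p
  obtain ⟨r, hr⟩ := hasFPowerSeriesAt_log K p
  filter_upwards [Metric.eball_mem_nhds (0 : K) hr.r_pos, Metric.ball_mem_nhds (0 : K) one_pos]
    with z hz hz1
  rcases eq_or_ne z 0 with hz0 | hz0
  · rw [hz0, add_zero, inv_one]
    exact hasDerivAt_log_zero K p
  have hz2 : ‖-z‖ < 1 := by rw [norm_neg]; exact mem_ball_zero_iff.1 hz1
  have h1 := (hasSum_geometric_of_norm_lt_one hz2).mul_right z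
  have h2 := hasSum_deriv_mul hr hz
  simp only [succ_mul_logCoeff] at h2
  have h4 := mul_right_cancel₀ hz0 (h2.unique h1)
  rw [sub_neg_eq_add] at h4
  have hd : DifferentiableAt K (fun z : K => logSeries (1 + z)) z :=
    (hr.analyticAt_of_mem hz).differentiableAt
  exact h4 ▸ hd.hasDerivAt

lemma logSeries_one {K : Type*} [NontriviallyNormedField K] : logSeries (1 : K) = 0 := by simp [logSeries]

/-- An analytic function whose derivative vanishes near a point is constant near that point. -/
lemma eventually_eq_of_deriv_eq_zero [CharZero K] {f : K → K} {x : K} (hf : AnalyticAt K f x)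
    (h : ∀ᶠ z in 𝓝 x, deriv f z = 0) : ∀ᶠ z in 𝓝 x, f z = f x := by
  obtain ⟨q, r, hq⟩ := hf
  -- Over an ultrametric field a vanishing derivative alone does not force local constancy.
  -- Analyticity does: every Taylor coefficient of positive order vanishes.
  have hz : ∀ n, 1 ≤ n → iteratedDeriv n f x = 0 := by
    intro n hn
    obtain ⟨m, rfl⟩ := Nat.exists_eq_add_of_le' hn
    rw [iteratedDeriv_succ']
    have h' : deriv f =ᶠ[𝓝 x] fun _ => (0 : K) := h
    rw [h'.iteratedDeriv_eq]
    simp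
  filter_upwards [Metric.eball_mem_nhds x hq.r_pos] with z hzz
  have hy : z - x ∈ Metric.eball (0 : K) r := by
    simpa [edist_eq_enorm_sub] using hzz
  have h1 := hq.hasSum_iteratedFDeriv hy
  rw [add_sub_cancel] at h1
  refine h1.unique ?_
  refine (hasSum_ite_eq (0 : ℕ) (f x)).congr_fun fun n => ?_
  rcases n with _ | n
  · simp
  · have := hz (n + 1) (by omega)
    rw [iteratedDeriv_eq_iteratedFDeriv] at this
    have h2 : (iteratedFDeriv K (n + 1) f x fun _ => z - x) = 0 := by
      have := (iteratedFDeriv K (n + 1) f x).map_smul_univ (fun _ => z - x) (fun _ => (1 : K))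
      simp only [smul_eq_mul, mul_one] at this
      rw [this, ‹iteratedFDeriv K (n + 1) f x (fun _ => 1) = 0›, mul_zero]
    simp [h2]

-- The function `exp(log(1+z)) / (1+z)` is analytic with zero derivative near `0`, and its value at
-- `0` is `1`.
variable (K) in
lemma exp_log_eventually (p : ℕ) [Fact p.Prime] [NormedAlgebra ℚ_[p] K] :
    ∀ᶠ x : K in 𝓝 1, NormedSpace.exp (logSeries x) = x := by
  have := charZero_of_padicAlgebra K p
  have hlog := (hasFPowerSeriesAt_log K p).analyticAt
  have hl0 : (fun z : K => logSeries (1 + z)) 0 = 0 := by simp [logSeries_one]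
  have hexp : AnalyticAt K (NormedSpace.exp : K → K) ((fun z : K => logSeries (1 + z)) 0) := by
    rw [hl0]
    exact (NormedSpace.hasFPowerSeriesAt_exp_zero_of_radius_pos
      (expSeries_radius_pos' K p)).analyticAt
  have hinv : AnalyticAt K (fun z : K => (1 + z)⁻¹) 0 :=
    (analyticAt_const.add analyticAt_id).inv (by simp)
  have hf : AnalyticAt K (fun z : K => NormedSpace.exp (logSeries (1 + z)) * (1 + z)⁻¹) 0 :=
    (hexp.comp (f := fun z : K => logSeries (1 + z)) hlog).mul hinv
  have hball : ∀ᶠ z : K in 𝓝 0,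
      logSeries (1 + z) ∈ Metric.eball (0 : K) (NormedSpace.expSeries K K).radius := by
    refine hlog.continuousAt.eventually_mem ?_
    simp only [add_zero, logSeries_one]
    exact Metric.eball_mem_nhds _ (expSeries_radius_pos' K p)
  have hne : ∀ᶠ z : K in 𝓝 0, 1 + z ≠ 0 := by
    refine ContinuousAt.eventually_ne (by fun_prop) (by simp)
  have hd : ∀ᶠ z : K in 𝓝 0,
      deriv (fun z : K => NormedSpace.exp (logSeries (1 + z)) * (1 + z)⁻¹) z = 0 := by
    filter_upwards [deriv_log_eventually K p, hball, hne] with z h1 h2 h3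
    have h4 := (hasDerivAt_exp_of_mem_ball h2).comp z h1
    have h5 := h4.mul (((hasDerivAt_id z).const_add 1).inv h3)
    refine HasDerivAt.deriv (h5.congr_deriv ?_)
    simp only [Function.comp, id, Pi.inv_apply]
    field_simp
    ring
  have h := eventually_eq_of_deriv_eq_zero hf hd
  have ht : Tendsto (fun x : K => x - 1) (𝓝 1) (𝓝 0) := by
    have : ContinuousAt (fun x : K => x - 1) 1 := by fun_prop
    simpa [ContinuousAt] using this
  filter_upwards [ht.eventually h, ht.eventually hne] with x hx hx0
  simp only [add_sub_cancel, add_zero, logSeries_one, NormedSpace.exp_zero, inv_one,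
    mul_one] at hx hx0
  exact (mul_inv_eq_one₀ hx0).1 hx

end ExpLog
end IwasawaRep

namespace IwasawaRep

section ExpLogRadius

variable {K : Type*} [NontriviallyNormedField K] [IsUltrametricDist K] [CompleteSpace K]

variable (K) in
/-- A radius within which the usual rules for the exponential and the logarithm hold. -/
structure IsExpLogRadius (r : ℝ) : Prop where
  pos : 0 < r
  exp_add : ∀ x y : K, ‖x‖ < r → ‖y‖ < r →
    NormedSpace.exp (x + y) = NormedSpace.exp x * NormedSpace.exp y
  continuousAt_exp : ∀ x : K, ‖x‖ < r → ContinuousAt NormedSpace.exp x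
  eq_zero_of_exp_eq_one : ∀ x : K, ‖x‖ < r → NormedSpace.exp x = 1 → x = 0
  exp_log : ∀ x : K, ‖x - 1‖ < r → NormedSpace.exp (logSeries x) = x
  norm_log : ∀ x : K, ‖x - 1‖ < r → ‖logSeries x‖ = ‖x - 1‖

lemma norm_eq_of_norm_sub_le {x y : K} (h : ‖x - y‖ ≤ 2⁻¹ * ‖y‖) : ‖x‖ = ‖y‖ := by
  rcases eq_or_ne y 0 with rfl | hy
  · simpa using h
  have hy' := norm_pos_iff.2 hy
  have h1 : ‖x - y‖ < ‖y‖ := by linarith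
  have := IsUltrametricDist.norm_add_eq_max_of_norm_ne_norm (x := x - y) (y := y) h1.ne
  rwa [sub_add_cancel, max_eq_right h1.le] at this

-- The logarithm has derivative `1` at `1`, so `log x` and `x - 1` differ by at most half of `‖x -
-- 1‖`; in an ultrametric field their norms then agree.
variable (K) in
lemma norm_log_eventually (p : ℕ) [Fact p.Prime] [NormedAlgebra ℚ_[p] K] :
    ∀ᶠ x : K in 𝓝 1, ‖logSeries x‖ = ‖x - 1‖ := by
  have h := (hasDerivAt_log_zero K p).isLittleO.def (c := 2⁻¹) (by norm_num)
  have ht : Tendsto (fun x : K => x - 1) (𝓝 1) (𝓝 0) := by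
    have : ContinuousAt (fun x : K => x - 1) 1 := by fun_prop
    simpa [ContinuousAt] using this
  filter_upwards [ht.eventually h] with x hx
  refine norm_eq_of_norm_sub_le ?_
  simpa [logSeries_one] using hx

lemma eventually_norm_sub_lt {x₀ : K} {P : K → Prop} (h : ∀ᶠ x in 𝓝 x₀, P x) :
    ∃ r > 0, ∀ x, ‖x - x₀‖ < r → P x := by
  obtain ⟨r, hr, h⟩ := Metric.eventually_nhds_iff.1 h
  exact ⟨r, hr, fun x hx => h (by rwa [dist_eq_norm])⟩

variable (K) in
lemma exists_isExpLogRadius (p : ℕ) [Fact p.Prime] [NormedAlgebra ℚ_[p] K] :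
    ∃ r, IsExpLogRadius K r := by
  have := charZero_of_padicAlgebra K p
  have hpos := expSeries_radius_pos' K p
  obtain ⟨r₁, h₁, H₁⟩ := eventually_norm_sub_lt (x₀ := (0 : K)) (Metric.eball_mem_nhds _ hpos)
  -- Since `exp` has derivative `1` at `0`, it omits the value `exp 0 = 1` on a punctured
  -- neighbourhood.
  have hne : ∀ᶠ x in 𝓝 (0 : K), NormedSpace.exp x = 1 → x = 0 := by
    have h := (hasDerivAt_exp_zero_of_radius_pos hpos).eventually_ne (c := 1) one_ne_zero
    rw [eventually_nhdsWithin_iff] at h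
    exact h.mono fun x hx h1 => by_contra fun h0 => hx h0 h1
  obtain ⟨r₂, h₂, H₂⟩ := eventually_norm_sub_lt hne
  obtain ⟨r₃, h₃, H₃⟩ := eventually_norm_sub_lt (exp_log_eventually K p)
  obtain ⟨r₄, h₄, H₄⟩ := eventually_norm_sub_lt (norm_log_eventually K p)
  simp only [sub_zero] at H₁ H₂
  refine ⟨min (min r₁ r₂) (min r₃ r₄), by positivity, fun x y hx hy => ?_, fun x hx => ?_,
    fun x hx => ?_, fun x hx => ?_, fun x hx => ?_⟩
  · simp only [lt_min_iff] at hx hy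
    exact NormedSpace.exp_add_of_mem_ball (H₁ x hx.1.1) (H₁ y hy.1.1)
  · simp only [lt_min_iff] at hx
    exact (hasDerivAt_exp_of_mem_ball (H₁ x hx.1.1)).continuousAt
  · simp only [lt_min_iff] at hx
    exact H₂ x hx.1.2
  · simp only [lt_min_iff] at hx
    exact H₃ x hx.2.1
  · simp only [lt_min_iff] at hx
    exact H₄ x hx.2.2

namespace IsExpLogRadius

variable {r : ℝ} (h : IsExpLogRadius K r)
include h

lemma exp_injective {x y : K} (hx : ‖x‖ < r) (hy : ‖y‖ < r)
    (hxy : NormedSpace.exp x = NormedSpace.exp y) : x = y := by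
  have h1 : ‖x - y‖ < r := (norm_sub_le_max' x y).trans_lt (max_lt hx hy)
  have h2 := h.exp_add (x - y) y h1 hy
  have h3 := h.exp_add y (-y) hy (by rwa [norm_neg])
  rw [add_neg_cancel, NormedSpace.exp_zero] at h3
  rw [sub_add_cancel, hxy] at h2
  exact sub_eq_zero.1 (h.eq_zero_of_exp_eq_one _ h1
    (mul_right_cancel₀ (left_ne_zero_of_mul_eq_one h3.symm) (by rw [← h2, one_mul])))

lemma exp_natCast_mul (p : ℕ) [Fact p.Prime] [NormedAlgebra ℚ_[p] K] {x : K} (hx : ‖x‖ < r)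
    (n : ℕ) : NormedSpace.exp ((n : K) * x) = NormedSpace.exp x ^ n := by
  induction n with
  | zero => simp [NormedSpace.exp_zero]
  | succ n ih =>
    have hn : ‖(n : K) * x‖ < r := by
      rw [norm_mul]
      refine lt_of_le_of_lt (mul_le_of_le_one_left (norm_nonneg _) ?_) hx
      rw [norm_natCast_eq p]
      simpa using Padic.norm_int_le_one (p := p) (n : ℤ)
    rw [Nat.cast_succ, add_mul, one_mul, h.exp_add _ _ hn hx, ih, pow_succ]

/-- Near `1` one has `xⁿ = exp(n log x)`, which is continuous in `n` for the `p`-adic topology. -/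
lemma tendsto_pow (p : ℕ) [Fact p.Prime] [NormedAlgebra ℚ_[p] K] {x : K} (hx : ‖x - 1‖ < r)
    {n : ℕ → ℕ} {t : ℚ_[p]} (ht : ‖t‖ ≤ 1)
    (hn : Tendsto (fun i => (n i : ℚ_[p])) atTop (𝓝 t)) :
    Tendsto (fun i => x ^ n i) atTop (𝓝 (NormedSpace.exp (algebraMap ℚ_[p] K t * logSeries x))) := by
  have hl : ‖logSeries x‖ < r := by rwa [h.norm_log x hx]
  have h1 : Tendsto (fun i => (n i : K) * logSeries x) atTop
      (𝓝 (algebraMap ℚ_[p] K t * logSeries x)) := by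
    refine Tendsto.mul_const _ ?_
    have := ((continuous_algebraMap ℚ_[p] K).tendsto t).comp hn
    simpa [Function.comp_def] using this
  have h2 : ‖algebraMap ℚ_[p] K t * logSeries x‖ < r := by
    rw [norm_mul, norm_algebraMap']
    exact (mul_le_of_le_one_left (norm_nonneg _) ht).trans_lt hl
  refine ((h.continuousAt_exp _ h2).tendsto.comp h1).congr fun i => ?_
  rw [Function.comp, h.exp_natCast_mul p hl, h.exp_log x hx]

end IsExpLogRadius

end ExpLogRadius

/-! ### Continuous characters of `ℤ_pˣ` near `1` -/

section UnitsPadic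

variable {p : ℕ} [Fact p.Prime]

lemma logSeries_algebraMap {K : Type*} [NontriviallyNormedField K] [NormedAlgebra ℚ_[p] K]
    (x : ℚ_[p]) : logSeries (algebraMap ℚ_[p] K x) = algebraMap ℚ_[p] K (logSeries x) := by
  have : IsClosedEmbedding (algebraMap ℚ_[p] K) :=
    (algebraMap_isometry ℚ_[p] K).isClosedEmbedding
  rw [logSeries, logSeries, this.map_tsum]
  exact tsum_congr fun n => by simp

lemma norm_natPrime_lt_one : ‖(p : ℤ_[p])‖ < 1 := by
  rw [PadicInt.norm_p]
  exact inv_lt_one_of_one_lt₀ (by exact_mod_cast (Fact.out : p.Prime).one_lt)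

lemma exists_unit_ne_one {U : Set ℤ_[p]ˣ} (hU : U ∈ 𝓝 1) : ∃ γ ∈ U, γ ≠ 1 := by
  rw [Units.isOpenEmbedding_val.isEmbedding.nhds_eq_comap, Units.val_one] at hU
  obtain ⟨V, hV, hVU⟩ := hU
  have ht : Tendsto (fun k : ℕ => 1 + (p : ℤ_[p]) ^ (k + 1)) atTop (𝓝 1) := by
    have h1 : Tendsto (fun k : ℕ => (p : ℤ_[p]) ^ k) atTop (𝓝 0) :=
      tendsto_pow_atTop_nhds_zero_of_norm_lt_one norm_natPrime_lt_one
    simpa using (tendsto_const_nhds (x := (1 : ℤ_[p]))).add ((tendsto_add_atTop_iff_nat 1).2 h1)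
  obtain ⟨k, hk⟩ := (ht.eventually hV).exists
  have hu : IsUnit (1 + (p : ℤ_[p]) ^ (k + 1)) := by
    by_contra hu
    have h1 := PadicInt.mem_nonunits.1 hu
    have h2 : ‖(p : ℤ_[p]) ^ (k + 1)‖ < 1 := by
      rw [norm_pow]; exact pow_lt_one₀ (norm_nonneg _) norm_natPrime_lt_one (by simp)
    have h3 := PadicInt.nonarchimedean (1 + (p : ℤ_[p]) ^ (k + 1)) (-(p : ℤ_[p]) ^ (k + 1))
    rw [add_neg_cancel_right, norm_neg, norm_one] at h3
    exact absurd h3 (not_le.2 (max_lt h1 h2))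
  refine ⟨hu.unit, hVU hk, fun h => ?_⟩
  have h1 := congrArg Units.val h
  rw [IsUnit.unit_spec, Units.val_one, add_eq_left] at h1
  exact pow_ne_zero _ (by exact_mod_cast (Fact.out : p.Prime).ne_zero) h1

lemma continuous_padicIntVal : Continuous fun a : ℤ_[p] => (a : ℚ_[p]) :=
  continuous_subtype_val

lemma continuous_unitVal : Continuous fun a : ℤ_[p]ˣ => ((a : ℤ_[p]) : ℚ_[p]) :=
  continuous_padicIntVal.comp Units.continuous_val

/-- Every unit close to `1` is a limit of powers of a suitable unit `γ`. -/
lemma exists_tendsto_pow {U : Set ℤ_[p]ˣ} (hU : U ∈ 𝓝 1) :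
    ∃ γ ∈ U, logSeries ((γ : ℤ_[p]) : ℚ_[p]) ≠ 0 ∧ ∀ᶠ a : ℤ_[p]ˣ in 𝓝 1,
      ∃ (t : ℚ_[p]) (n : ℕ → ℕ), ‖t‖ ≤ 1 ∧
        t * logSeries ((γ : ℤ_[p]) : ℚ_[p]) = logSeries ((a : ℤ_[p]) : ℚ_[p]) ∧
        Tendsto (fun i => (n i : ℚ_[p])) atTop (𝓝 t) ∧ Tendsto (fun i => γ ^ n i) atTop (𝓝 a) := by
  obtain ⟨r, hr⟩ := exists_isExpLogRadius ℚ_[p] p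
  have hnear : ∀ ε > 0, ∀ᶠ a : ℤ_[p]ˣ in 𝓝 1, ‖((a : ℤ_[p]) : ℚ_[p]) - 1‖ < ε := fun ε hε => by
    have := (continuous_unitVal (p := p)).tendsto 1
    have h := this.eventually (Metric.ball_mem_nhds _ hε)
    filter_upwards [h] with a ha
    simpa [dist_eq_norm] using ha
  obtain ⟨γ, ⟨hγU, hγr⟩, hγ⟩ := exists_unit_ne_one (inter_mem hU (hnear r hr.pos))
  have hγ1 : ((γ : ℤ_[p]) : ℚ_[p]) - 1 ≠ 0 := fun h => hγ (by
    refine Units.ext (PadicInt.ext ?_)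
    simpa [sub_eq_zero] using h)
  have hlog : logSeries ((γ : ℤ_[p]) : ℚ_[p]) ≠ 0 := by
    rw [← norm_ne_zero_iff, hr.norm_log _ hγr]
    exact norm_ne_zero_iff.2 hγ1
  refine ⟨γ, hγU, hlog, ?_⟩
  -- On this ball the quotient of logarithms `t = log a / log γ` has norm at most one, so it lies in
  -- `ℤ_p` and is a limit of natural numbers.
  filter_upwards [hnear _ (norm_pos_iff.2 hγ1)] with a ha
  have har := lt_trans ha hγr
  set t := logSeries ((a : ℤ_[p]) : ℚ_[p]) / logSeries ((γ : ℤ_[p]) : ℚ_[p]) with ht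
  have ht1 : ‖t‖ ≤ 1 := by
    rw [ht, norm_div, hr.norm_log _ hγr, hr.norm_log _ har]
    exact div_le_one_of_le₀ ha.le (norm_nonneg _)
  have hta : t * logSeries ((γ : ℤ_[p]) : ℚ_[p]) = logSeries ((a : ℤ_[p]) : ℚ_[p]) :=
    div_mul_cancel₀ _ hlog
  obtain ⟨n, hn⟩ : ∃ n : ℕ → ℕ, Tendsto (fun i => (n i : ℚ_[p])) atTop (𝓝 t) := by
    obtain ⟨T, hT⟩ : ∃ T : ℤ_[p], (T : ℚ_[p]) = t := ⟨⟨t, ht1⟩, rfl⟩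
    have hmem : ∀ i : ℕ, ∃ n : ℕ, dist T (n : ℤ_[p]) < 1 / ((i : ℝ) + 1) := fun i =>
      PadicInt.denseRange_natCast.exists_dist_lt _ Nat.one_div_pos_of_nat
    choose n hn using hmem
    refine ⟨n, tendsto_iff_dist_tendsto_zero.2 (squeeze_zero (fun _ => dist_nonneg) (fun i => ?_)
      tendsto_one_div_add_atTop_nhds_zero_nat)⟩
    have := (hn i).le
    rw [dist_comm] at this
    rw [← hT]
    exact this
  refine ⟨t, n, ht1, hta, hn, ?_⟩
  have h1 := hr.tendsto_pow p hγr ht1 hn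
  rw [Algebra.algebraMap_self_apply, hta, hr.exp_log _ har] at h1
  rw [Units.isOpenEmbedding_val.isEmbedding.tendsto_nhds_iff, tendsto_iff_dist_tendsto_zero]
  rw [tendsto_iff_dist_tendsto_zero] at h1
  refine h1.congr fun i => ?_
  rw [Function.comp, Units.val_pow_eq_pow_val, ← PadicInt.coe_pow]
  rfl

variable {K : Type*} [NontriviallyNormedField K] [IsUltrametricDist K] [CompleteSpace K]
  [NormedAlgebra ℚ_[p] K]

variable (K) in
lemma tendsto_algebraMap_unit :
    Tendsto (fun a : ℤ_[p]ˣ => algebraMap ℚ_[p] K ((a : ℤ_[p]) : ℚ_[p])) (𝓝 1) (𝓝 1) := by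
  have := ((continuous_algebraMap ℚ_[p] K).comp (continuous_unitVal (p := p))).tendsto 1
  simpa [Function.comp_def] using this

/-- A continuous character of `ℤ_pˣ` is locally a power function. -/
lemma existsUnique_exponent (ψ : ℤ_[p]ˣ →* K) (hψ : Continuous ψ) :
    ∃! c : K, ∀ᶠ a : ℤ_[p]ˣ in 𝓝 1,
      ψ a = NormedSpace.exp (c * logSeries (algebraMap ℚ_[p] K ((a : ℤ_[p]) : ℚ_[p]))) := by
  obtain ⟨r, hr⟩ := exists_isExpLogRadius K p
  have hU : ∀ᶠ a : ℤ_[p]ˣ in 𝓝 1, ‖ψ a - 1‖ < r := by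
    have := hψ.tendsto 1
    rw [map_one] at this
    filter_upwards [this.eventually (Metric.ball_mem_nhds _ hr.pos)] with a ha
    simpa [dist_eq_norm] using ha
  obtain ⟨γ, hγ, hlog, hev⟩ := exists_tendsto_pow hU
  have hlogK : algebraMap ℚ_[p] K (logSeries ((γ : ℤ_[p]) : ℚ_[p])) ≠ 0 :=
    (map_ne_zero _).2 hlog
  obtain ⟨c₀, hc₀⟩ : ∃ c : K, ∀ᶠ a : ℤ_[p]ˣ in 𝓝 1,
      ψ a = NormedSpace.exp (c * logSeries (algebraMap ℚ_[p] K ((a : ℤ_[p]) : ℚ_[p]))) := by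
    -- This is the only possible exponent, forced by the value at `γ`; the powers of `γ` and
    -- continuity then determine `ψ` near `1`.
    refine ⟨logSeries (ψ γ) / algebraMap ℚ_[p] K (logSeries ((γ : ℤ_[p]) : ℚ_[p])), ?_⟩
    filter_upwards [hev] with a ⟨t, n, ht1, hta, hn, hna⟩
    have h1 := (hψ.tendsto a).comp hna
    have h2 := hr.tendsto_pow p hγ ht1 hn
    have h3 := tendsto_nhds_unique (h1.congr fun i => by rw [Function.comp, map_pow]) h2
    rw [h3, logSeries_algebraMap, ← hta, map_mul]
    congr 1
    field_simp
  refine ⟨c₀, hc₀, fun c hc => ?_⟩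
  have hnear : ∀ᶠ x in 𝓝 (1 : K), ‖x - 1‖ < r := by
    filter_upwards [Metric.ball_mem_nhds (1 : K) hr.pos] with x hx
    simpa [dist_eq_norm] using hx
  have hlog0 : ContinuousAt (logSeries : K → K) 1 := by
    rw [ContinuousAt, logSeries_one, tendsto_zero_iff_norm_tendsto_zero]
    have h1 : Tendsto (fun x : K => ‖x - 1‖) (𝓝 1) (𝓝 0) := by
      have : ContinuousAt (fun x : K => ‖x - 1‖) 1 := by fun_prop
      simpa [ContinuousAt] using this
    exact h1.congr' (hnear.mono fun x hx => (hr.norm_log x hx).symm)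
  have hsmall : ∀ c : K, ∀ᶠ a : ℤ_[p]ˣ in 𝓝 1,
      ‖c * logSeries (algebraMap ℚ_[p] K ((a : ℤ_[p]) : ℚ_[p]))‖ < r := fun c => by
    have h1 := (hlog0.tendsto.comp (tendsto_algebraMap_unit K (p := p))).const_mul c
    rw [logSeries_one, mul_zero] at h1
    have h2 := h1.norm
    rw [norm_zero] at h2
    exact h2.eventually (gt_mem_nhds hr.pos)
  -- A unit `a ≠ 1` so close to `1` that both exponents `c log a` and `c₀ log a` lie where `exp` is
  -- injective, and `log a ≠ 0` can be cancelled.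
  obtain ⟨a, ⟨⟨⟨⟨h1, h2⟩, h3⟩, h4⟩, h5⟩, ha⟩ :=
    exists_unit_ne_one (inter_mem (inter_mem (inter_mem (inter_mem hc hc₀) (hsmall c))
      (hsmall c₀)) ((tendsto_algebraMap_unit K (p := p)).eventually hnear))
  have h6 := hr.exp_injective h3 h4 ((h1 : ψ a = _).symm.trans h2)
  refine mul_right_cancel₀ ?_ h6
  rw [← norm_ne_zero_iff, hr.norm_log _ h5, norm_ne_zero_iff]
  refine fun h => ha (Units.ext (PadicInt.ext ?_))
  have h7 := sub_eq_zero.1 h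
  rw [← map_one (algebraMap ℚ_[p] K)] at h7
  simpa using (algebraMap ℚ_[p] K).injective h7

/-- If `ψ(a) = exp(c log a)` near `1` then `ψ` has derivative `c` at `1`. -/
lemma norm_character_sub_le {ψ : ℤ_[p]ˣ → K} {c : K} (hc : ∀ᶠ a : ℤ_[p]ˣ in 𝓝 1,
      ψ a = NormedSpace.exp (c * logSeries (algebraMap ℚ_[p] K ((a : ℤ_[p]) : ℚ_[p]))))
    {ε : ℝ} (hε : 0 < ε) : ∀ᶠ a : ℤ_[p]ˣ in 𝓝 1,
      ‖ψ a - 1 - c * (algebraMap ℚ_[p] K ((a : ℤ_[p]) : ℚ_[p]) - 1)‖ ≤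
        ε * ‖algebraMap ℚ_[p] K ((a : ℤ_[p]) : ℚ_[p]) - 1‖ := by
  have := charZero_of_padicAlgebra K p
  have h1 : HasDerivAt (fun z : K => c * logSeries (1 + z)) (c * 1) 0 :=
    (hasDerivAt_log_zero K p).const_mul c
  have h2 : HasDerivAt (NormedSpace.exp : K → K) 1 ((fun z : K => c * logSeries (1 + z)) 0) := by
    simp only [add_zero, logSeries_one, mul_zero]
    exact hasDerivAt_exp_zero_of_radius_pos (expSeries_radius_pos' K p)
  have h3 := (h2.comp (0 : K) h1).isLittleO.def hε
  have ht : Tendsto (fun x : K => x - 1) (𝓝 1) (𝓝 0) := by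
    have : ContinuousAt (fun x : K => x - 1) 1 := by fun_prop
    simpa [ContinuousAt] using this
  filter_upwards [hc, (ht.comp (tendsto_algebraMap_unit K (p := p))).eventually h3] with a ha h4
  rw [ha]
  simpa [logSeries_one, NormedSpace.exp_zero, mul_comm] using h4

end UnitsPadic
end IwasawaRep

namespace IwasawaRep

open TensorProduct

/-! ### Measures as the unit ball of the dual of `C(G, K)` -/

section Measures

variable {K : Type*} [NontriviallyNormedField K] [IsUltrametricDist K]
variable {G : Type*} [Group G] [TopologicalSpace G]

open Classical in
lemma linExt_pi_single {Q : Type*} (q : Q) (a : MonoidAlgebra (IntegerRing K) Q) :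
    linExt (Pi.single q (1 : K)) a = ((a.coeff q : IntegerRing K) : K) := by
  induction a using MonoidAlgebra.induction_linear with
  | zero => simp
  | add x y hx hy => simp [hx, hy]
  | single r c =>
    rw [linExt_single]
    by_cases h : r = q
    · subst h; simp
    · simp [h]

lemma ext_linExt {Q : Type*} {a b : MonoidAlgebra (IntegerRing K) Q}
    (h : ∀ u : Q → K, linExt u a = linExt u b) : a = b := by
  classical
  ext q
  have := h (Pi.single q 1)
  rwa [linExt_pi_single, linExt_pi_single] at this

variable (K) in
/-- The Dirac measure at `g`. -/
noncomputable def dirac (g : G) : IntCompletedGroupRing K G :=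
  ⟨fun H => MonoidAlgebra.single (g : G ⧸ H.toSubgroup) 1, fun H H' h => by
    simp [transition]
    rfl⟩

lemma mapInt_dirac {G₂ : Type*} [Group G₂] [TopologicalSpace G₂] (φ : G →ₜ* G₂) (g : G) :
    mapInt K φ (dirac K g) = dirac K (φ g) := by
  refine Subtype.ext (funext fun H => ?_)
  change levelMap K φ H (MonoidAlgebra.single _ 1) = MonoidAlgebra.single _ 1
  simp [levelMap]

/-- Of two scalars in `K` one is an `o`-multiple of the other, so in a sum of two pure tensors the
larger scalar can be factored out. -/
lemma exists_eq_tmul (a : CompletedGroupRing K G) :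
    ∃ (k : K) (μ : IntCompletedGroupRing K G), a = k ⊗ₜ[IntegerRing K] μ := by
  induction a using TensorProduct.induction_on with
  | zero => exact ⟨0, 0, by simp⟩
  | tmul k μ => exact ⟨k, μ, rfl⟩
  | add x y hx hy =>
    obtain ⟨k, μ, rfl⟩ := hx
    obtain ⟨l, ν, rfl⟩ := hy
    have key : ∀ (k l : K) (μ ν : IntCompletedGroupRing K G), ‖k‖ ≤ ‖l‖ →
        ∃ (m : K) (κ : IntCompletedGroupRing K G),
          k ⊗ₜ[IntegerRing K] μ + l ⊗ₜ[IntegerRing K] ν = m ⊗ₜ[IntegerRing K] κ := by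
      intro k l μ ν h
      rcases eq_or_ne l 0 with rfl | hl
      · have : k = 0 := by simpa using h
        exact ⟨0, 0, by simp [this]⟩
      have hc : ‖k / l‖ ≤ 1 := by
        rw [norm_div]; exact div_le_one_of_le₀ h (norm_nonneg _)
      refine ⟨l, (⟨k / l, hc⟩ : IntegerRing K) • μ + ν, ?_⟩
      rw [TensorProduct.tmul_add, ← TensorProduct.smul_tmul]
      congr 2
      rw [Subring.smul_def, smul_eq_mul, div_mul_cancel₀ _ hl]
    rcases le_total ‖k‖ ‖l‖ with h | h
    · exact key k l μ ν h
    · obtain ⟨m, κ, e⟩ := key l k ν μ h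
      exact ⟨m, κ, by rw [add_comm, e]⟩

variable [IsTopologicalGroup G]

/-- The locally constant function on `G` induced by a function on `G/H`. -/
noncomputable def cosetFunction (H : OpenNormalSubgroup G) (u : G ⧸ H.toSubgroup → K) : C(G, K) where
  toFun g := u g
  continuous_toFun := by
    have : DiscreteTopology (G ⧸ H.toSubgroup) :=
      QuotientGroup.discreteTopology H.isOpen'
    exact (continuous_of_discreteTopology (f := u)).comp QuotientGroup.continuous_mk

lemma cosetFunction_apply (H : OpenNormalSubgroup G) (u : G ⧸ H.toSubgroup → K) (g : G) :
    cosetFunction H u g = u g := rfl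

lemma smallOn_cosetFunction (H : OpenNormalSubgroup G) (u : G ⧸ H.toSubgroup → K) :
    SmallOn (cosetFunction H u) H 0 := fun g h hh => by
  have : ((g * h : G) : G ⧸ H.toSubgroup) = g := by
    rw [QuotientGroup.eq]
    simpa using H.toSubgroup.inv_mem hh
  simp [cosetFunction_apply, this]

variable [CompactSpace G]

lemma finite_quotient (H : OpenNormalSubgroup G) : Finite (G ⧸ H.toSubgroup) :=
  Subgroup.quotient_finite_of_isOpen _ H.isOpen'

variable [TotallyDisconnectedSpace G]

lemma exists_norm_sub_cosetFunction_le (f : C(G, K)) {ε : ℝ} (hε : 0 < ε) :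
    ∃ (H : OpenNormalSubgroup G) (u : G ⧸ H.toSubgroup → K), ‖f - cosetFunction H u‖ ≤ ε := by
  obtain ⟨H, hH⟩ := exists_smallOn f hε
  refine ⟨H, fun x => f x.out, (ContinuousMap.norm_le _ hε.le).2 fun g => ?_⟩
  exact hH.of_mk_eq (QuotientGroup.out_eq' _).symm

/-- Functions constant on the cosets of some open normal subgroup are dense in `C(G, K)`. -/
lemma clm_ext_cosetFunction {E : Type*} [NormedAddCommGroup E] [NormedSpace K E]
    {ℓ ℓ' : C(G, K) →L[K] E}
    (h : ∀ (H : OpenNormalSubgroup G) (u : G ⧸ H.toSubgroup → K),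
      ℓ (cosetFunction H u) = ℓ' (cosetFunction H u)) : ℓ = ℓ' := by
  have hd : Dense {f : C(G, K) | ℓ f = ℓ' f} := by
    refine Metric.dense_iff.2 fun f r hr => ?_
    obtain ⟨H, u, hu⟩ := exists_norm_sub_cosetFunction_le f (half_pos hr)
    refine ⟨cosetFunction H u, ?_, h H u⟩
    rw [Metric.mem_ball, dist_comm, dist_eq_norm]
    exact hu.trans_lt (half_lt_self hr)
  have hc : IsClosed {f : C(G, K) | ℓ f = ℓ' f} := isClosed_eq ℓ.continuous ℓ'.continuous
  ext f
  have := hc.closure_eq ▸ hd f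
  exact this

variable [CompleteSpace K]

lemma integralCLM_cosetFunction (H : OpenNormalSubgroup G) (u : G ⧸ H.toSubgroup → K)
    (μ : IntCompletedGroupRing K G) :
    integralCLM μ (cosetFunction H u) = linExt u (μ.1 H) := by
  have h := norm_integral_sub_le (cosetFunction H u) le_rfl (smallOn_cosetFunction H u) μ
  rw [norm_le_zero_iff, sub_eq_zero] at h
  rw [integralCLM_apply, h, riemannSum]
  congr 2
  ext x
  rw [cosetFunction_apply, QuotientGroup.out_eq']

lemma integralCLM_injective :
    Function.Injective (integralCLM : IntCompletedGroupRing K G → C(G, K) →L[K] K) := by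
  intro μ ν h
  refine Subtype.ext (funext fun H => ext_linExt fun u => ?_)
  rw [← integralCLM_cosetFunction, ← integralCLM_cosetFunction, h]

lemma integralCLM_dirac (g : G) (f : C(G, K)) : integralCLM (dirac K g) f = f g := by
  have : integralCLM (dirac K g) =
      (ContinuousMap.evalCLM K g : C(G, K) →L[K] K) := by
    refine clm_ext_cosetFunction fun H u => ?_
    rw [integralCLM_cosetFunction]
    simp [dirac, linExt_single, cosetFunction_apply]
  rw [this]
  rfl

lemma integralCLM_mul_dirac (μ : IntCompletedGroupRing K G) (b : G) (f : C(G, K)) :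
    integralCLM (μ * dirac K b) f = integralCLM μ ⟨fun g => f (g * b), by fun_prop⟩ := by
  rw [integralCLM_mul]
  congr 1
  ext g
  rw [partialIntegral_apply, integralCLM_dirac]
  rfl

/-- Every linear form of norm at most one on `C(G, K)` is the integral against an element of
`o[[G]]`. -/
lemma exists_integralCLM_eq (ℓ : C(G, K) →L[K] K) (hℓ : ∀ f, ‖ℓ f‖ ≤ ‖f‖) :
    ∃ μ : IntCompletedGroupRing K G, integralCLM μ = ℓ := by
  classical
  have hfin : ∀ H : OpenNormalSubgroup G, Finite (G ⧸ H.toSubgroup) := finite_quotient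
  have := fun H : OpenNormalSubgroup G => Fintype.ofFinite (G ⧸ H.toSubgroup)
  have hb (H : OpenNormalSubgroup G) (q : G ⧸ H.toSubgroup) :
      ‖ℓ (cosetFunction H (Pi.single q 1))‖ ≤ 1 := by
    refine (hℓ _).trans ((ContinuousMap.norm_le _ zero_le_one).2 fun g => ?_)
    rw [cosetFunction_apply, Pi.single_apply]
    split_ifs <;> simp
  -- The mass of a coset is the value of the form on its indicator function; the norm bound on `ℓ`
  -- puts it in `o`.
  let m (H : OpenNormalSubgroup G) : MonoidAlgebra (IntegerRing K) (G ⧸ H.toSubgroup) :=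
    ∑ q, MonoidAlgebra.single q ⟨ℓ (cosetFunction H (Pi.single q 1)), hb H q⟩
  have hm (H : OpenNormalSubgroup G) (u : G ⧸ H.toSubgroup → K) :
      linExt u (m H) = ℓ (cosetFunction H u) := by
    have : cosetFunction H u = ∑ q, u q • cosetFunction H (Pi.single q 1) := by
      ext g
      simp [cosetFunction_apply, Pi.single_apply]
    rw [this, map_sum, map_sum]
    refine Finset.sum_congr rfl fun q _ => ?_
    rw [linExt_single, map_smul, smul_eq_mul, mul_comm]
  refine ⟨⟨m, fun H H' h => ext_linExt fun u => ?_⟩, clm_ext_cosetFunction fun H u => ?_⟩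
  · rw [transition, linExt_mapDomain, hm, hm]
    rfl
  · rw [integralCLM_cosetFunction, hm]

lemma integralK_tmul (f : C(G, K)) (k : K) (μ : IntCompletedGroupRing K G) :
    integralK f (k ⊗ₜ[IntegerRing K] μ) = k * integralCLM μ f := by
  simp [integralK]

end Measures

end IwasawaRep

namespace IwasawaRep

/-! ### Forms vanishing on right `P`-invariant functions -/

section Coinvariants

variable {K : Type*} [NontriviallyNormedField K] [IsUltrametricDist K]
variable {G : Type*} [Group G] [TopologicalSpace G] [IsTopologicalGroup G] [CompactSpace G]

/-- Right translation `(rightTranslate b f)(g) = f(gb)` on `C(G, K)`. -/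
noncomputable def rightTranslate (b : G) : C(G, K) →L[K] C(G, K) where
  toFun f := f.comp ⟨fun g => g * b, by fun_prop⟩
  map_add' _ _ := rfl
  map_smul' _ _ := rfl
  cont := ContinuousMap.continuous_precomp _

variable {J : Type*} [Fintype J]

/-- The map `f ↦ (f(· b_j) - f)_j`. -/
noncomputable def differences (b : J → G) : C(G, K) →L[K] (J → C(G, K)) :=
  ContinuousLinearMap.pi fun j => rightTranslate (b j) - ContinuousLinearMap.id K _

lemma differences_apply (b : J → G) (f : C(G, K)) (j : J) (g : G) :
    differences b f j g = f (g * b j) - f g := rfl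

/-- Telescoping along a word in the `b_j`: `f(gxy) - f(g) = (f(gx) - f(g)) + (f(gxy) - f(gx))`. By
the ultrametric inequality the norm stays at most one however long the word is. -/
lemma exists_form_eq_sub {b : J → G} {x : G} (hx : x ∈ Subgroup.closure (Set.range b)) (g : G) :
    ∃ ν : (J → C(G, K)) →L[K] K, (∀ F, ‖ν F‖ ≤ ‖F‖) ∧
      ∀ f, ν (differences b f) = f (g * x) - f g := by
  induction hx using Subgroup.closure_induction generalizing g with
  | mem x hx =>
    obtain ⟨j, rfl⟩ := hx
    refine ⟨(ContinuousMap.evalCLM K g).comp (ContinuousLinearMap.proj j), fun F => ?_,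
      fun f => rfl⟩
    exact ((F j).norm_coe_le_norm g).trans (norm_le_pi_norm F j)
  | one => exact ⟨0, fun F => by simp, fun f => by simp⟩
  | mul x y _ _ hx hy =>
    obtain ⟨ν, h1, h2⟩ := hx g
    obtain ⟨ν', h1', h2'⟩ := hy (g * x)
    refine ⟨ν + ν', fun F => ?_, fun f => ?_⟩
    · exact (IsUltrametricDist.norm_add_le_max _ _).trans (max_le (h1 F) (h1' F))
    · rw [add_apply, h2, h2', mul_assoc]
      ring
  | inv x _ hx =>
    obtain ⟨ν, h1, h2⟩ := hx (g * x⁻¹)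
    refine ⟨-ν, fun F => by rw [neg_apply, norm_neg]; exact h1 F, fun f => ?_⟩
    rw [neg_apply, h2, inv_mul_cancel_right, neg_sub]

variable [TotallyDisconnectedSpace G]

/-- The case of finite level. In each coset of `N = PH` fix a base point `y`; modulo `H`, every
point `x` of that coset is reached from `y` by a word in the `b_j`. As `μ` kills the `P`-invariant
function `x ↦ u(y x)`, one may replace `u(x)` by `u(x) - u(y x)`, which telescopes. -/
lemma exists_form_on_cosetFunctions (P : Subgroup G) (b : J → G)
    (hP : (P : Set G) ⊆ closure (Subgroup.closure (Set.range b) : Set G))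
    (μ : C(G, K) →L[K] K) (hμ : ∀ f, ‖μ f‖ ≤ ‖f‖)
    (h0 : ∀ f : C(G, K), (∀ g, ∀ x ∈ P, f (g * x) = f g) → μ f = 0) (H : OpenNormalSubgroup G) :
    ∃ ν : (J → C(G, K)) →L[K] K, (∀ F, ‖ν F‖ ≤ ‖F‖) ∧
      ∀ u, ν (differences b (cosetFunction H u)) = μ (cosetFunction H u) := by
  classical
  have hfin : Finite (G ⧸ H.toSubgroup) := finite_quotient H
  have := Fintype.ofFinite (G ⧸ H.toSubgroup)
  let N : Subgroup G := P ⊔ H.toSubgroup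
  let y (x : G ⧸ H.toSubgroup) : G := (x.out : G ⧸ N).out
  have hy (x : G ⧸ H.toSubgroup) :
      ∃ c ∈ Subgroup.closure (Set.range b), ((y x * c : G) : G ⧸ H.toSubgroup) = x := by
    have hk : (y x)⁻¹ * x.out ∈ N := by
      rw [← QuotientGroup.eq]
      exact QuotientGroup.out_eq' _
    obtain ⟨z, hz, h, hh, hzh⟩ := Subgroup.mem_sup_of_normal_right.1 hk
    have hU : {c : G | z⁻¹ * c ∈ H.toSubgroup} ∈ 𝓝 z := by
      have : Continuous fun c : G => z⁻¹ * c := by fun_prop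
      exact (H.isOpen'.preimage this).mem_nhds (by simp)
    obtain ⟨c, hc1, hc2⟩ := mem_closure_iff_nhds.1 (hP hz) _ hU
    refine ⟨c, hc2, ?_⟩
    conv_rhs => rw [← QuotientGroup.out_eq' x]
    rw [QuotientGroup.eq, mul_inv_rev, mul_assoc, ← hzh, ← mul_assoc]
    refine H.toSubgroup.mul_mem ?_ hh
    have := H.toSubgroup.inv_mem hc1
    simpa using this
  choose c hc hyc using hy
  choose ν hν1 hν2 using fun x => exists_form_eq_sub (K := K) (hc x) (y x)
  let m (x : G ⧸ H.toSubgroup) : K := μ (cosetFunction H (Pi.single x 1))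
  have hm1 (x : G ⧸ H.toSubgroup) : ‖m x‖ ≤ 1 := by
    refine (hμ _).trans ((ContinuousMap.norm_le _ zero_le_one).2 fun g => ?_)
    rw [cosetFunction_apply, Pi.single_apply]
    split_ifs <;> simp
  have hm (u : G ⧸ H.toSubgroup → K) : μ (cosetFunction H u) = ∑ x, m x * u x := by
    have : cosetFunction H u = ∑ q, u q • cosetFunction H (Pi.single q 1) := by
      ext g
      simp [cosetFunction_apply, Pi.single_apply]
    rw [this, map_sum]
    exact Finset.sum_congr rfl fun q _ => by rw [map_smul, smul_eq_mul, mul_comm]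
  refine ⟨∑ x, m x • ν x, fun F => ?_, fun u => ?_⟩
  · rw [sum_apply]
    refine IsUltrametricDist.norm_sum_le_of_forall_le_of_nonneg (norm_nonneg _) fun x _ => ?_
    rw [smul_apply, smul_eq_mul, norm_mul]
    exact (mul_le_of_le_one_left (norm_nonneg _) (hm1 x)).trans (hν1 x F)
  -- The base point depends only on the coset modulo `N`, so this function is right `P`-invariant.
  · have h1 : ∑ x, m x * u (y x : G) = 0 := by
      rw [← hm fun x => u (y x : G)]
      refine h0 _ fun g z hz => ?_
      have hq (g : G) : (((g : G ⧸ H.toSubgroup).out : G) : G ⧸ N) = g := by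
        rw [QuotientGroup.eq]
        refine (le_sup_right : H.toSubgroup ≤ N) ?_
        rw [← QuotientGroup.eq, QuotientGroup.out_eq']
      have hz' : ((g * z : G) : G ⧸ N) = g := by
        rw [eq_comm, QuotientGroup.eq]
        simpa using (le_sup_left : P ≤ N) hz
      simp only [cosetFunction_apply, y, hq, hz']
    rw [sum_apply, hm, ← sub_zero (∑ x, m x * u x), ← h1, ← Finset.sum_sub_distrib]
    refine Finset.sum_congr rfl fun x _ => ?_
    rw [smul_apply, hν2, cosetFunction_apply, cosetFunction_apply, hyc, smul_eq_mul, mul_sub]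

/-- A linear form of norm at most one which vanishes on the right `P`-invariant functions is a sum
of forms `ν_j(f(· b_j) - f)` when the finitely many `b_j` topologically generate `P`. -/
lemma exists_form_of_vanishing [ProperSpace K] (P : Subgroup G) (b : J → G)
    (hP : (P : Set G) ⊆ closure (Subgroup.closure (Set.range b) : Set G))
    (μ : C(G, K) →L[K] K) (hμ : ∀ f, ‖μ f‖ ≤ ‖f‖)
    (h0 : ∀ f : C(G, K), (∀ g, ∀ x ∈ P, f (g * x) = f g) → μ f = 0) :
    ∃ ν : (J → C(G, K)) →L[K] K, (∀ F, ‖ν F‖ ≤ ‖F‖) ∧ ν.comp (differences b) = μ := by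
  -- The solutions at level `H` form a weak-* closed subset of the unit ball, which is compact since
  -- `K` is locally compact. These nonempty sets shrink as `H` does, so they have a common point.
  let B : Set (WeakDual K (J → C(G, K))) := WeakDual.toStrongDual ⁻¹' Metric.closedBall 0 1
  let t (H : OpenNormalSubgroup G) : Set (WeakDual K (J → C(G, K))) :=
    B ∩ {ν | ∀ u, ν (differences b (cosetFunction H u)) = μ (cosetFunction H u)}
  have hB : IsCompact B := WeakDual.isCompact_closedBall 0 1
  have hclosed (H : OpenNormalSubgroup G) : IsClosed (t H) := by
    refine (WeakDual.isClosed_closedBall 0 1).inter ?_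
    simp only [Set.ofPred_forall]
    exact isClosed_iInter fun u => isClosed_eq (WeakDual.eval_continuous _) continuous_const
  obtain ⟨ν, hν⟩ := IsCompact.nonempty_iInter_of_directed_nonempty_isCompact_isClosed t
    (fun H₁ H₂ => by
      have key : ∀ H H' : OpenNormalSubgroup G, H ≤ H' → t H ⊆ t H' := fun H H' h ν hν =>
        ⟨hν.1, fun u => hν.2 fun x => u (QuotientGroup.map H.toSubgroup H'.toSubgroup
          (MonoidHom.id G) h x)⟩
      exact ⟨H₁ ⊓ H₂, key _ _ inf_le_left, key _ _ inf_le_right⟩)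
    (fun H => by
      obtain ⟨ν, h1, h2⟩ := exists_form_on_cosetFunctions P b hP μ hμ h0 H
      refine ⟨StrongDual.toWeakDual ν, ?_, h2⟩
      rw [Set.mem_preimage, mem_closedBall_zero_iff]
      exact ContinuousLinearMap.opNorm_le_bound _ zero_le_one fun F => by simpa using h1 F)
    (fun H => hB.of_isClosed_subset (hclosed H) Set.inter_subset_left) hclosed
  rw [Set.mem_iInter] at hν
  refine ⟨WeakDual.toStrongDual ν, fun F => ?_, clm_ext_cosetFunction fun H u => (hν H).2 u⟩
  obtain ⟨H⟩ : Nonempty (OpenNormalSubgroup G) := inferInstance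
  have := (hν H).1
  rw [Set.mem_preimage, mem_closedBall_zero_iff] at this
  exact ((WeakDual.toStrongDual ν).le_of_opNorm_le this F).trans_eq (one_mul _)

end Coinvariants

end IwasawaRep

noncomputable section

namespace IwasawaRep

/-! ### Explicit elements of `GL₂(ℤ_p)` -/

section Matrices

variable {p : ℕ} [Fact p.Prime]

/-- The upper unipotent matrix with entry `t`. -/
def upper (t : ℤ_[p]) : GLTwo p :=
  ⟨!![1, t; 0, 1], !![1, -t; 0, 1], by simp [Matrix.one_fin_two], by simp [Matrix.one_fin_two]⟩

/-- The lower unipotent matrix with entry `c`. -/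
def lower (c : ℤ_[p]) : GLTwo p :=
  ⟨!![1, 0; c, 1], !![1, 0; -c, 1], by simp [Matrix.one_fin_two], by simp [Matrix.one_fin_two]⟩

variable (p) in
/-- The permutation matrix exchanging the two coordinates. -/
def swap : GLTwo p :=
  ⟨!![0, 1; 1, 0], !![0, 1; 1, 0], by simp [Matrix.one_fin_two], by simp [Matrix.one_fin_two]⟩

lemma upper_val (t : ℤ_[p]) : (upper t).1 = !![1, t; 0, 1] := rfl

lemma lower_val (t : ℤ_[p]) : (lower t).1 = !![1, 0; t, 1] := rfl

lemma swap_val : (swap p).1 = !![0, 1; 1, 0] := rfl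

lemma upper_inv (t : ℤ_[p]) : (upper t)⁻¹ = upper (-t) := by
  refine Units.ext ?_
  rfl

lemma swap_inv : (swap p)⁻¹ = swap p := rfl

lemma upper_add (s t : ℤ_[p]) : upper (s + t) = upper s * upper t := by
  refine Units.ext ?_
  simp [upper_val, add_comm]

lemma lower_add (s t : ℤ_[p]) : lower (s + t) = lower s * lower t := by
  refine Units.ext ?_
  simp [lower_val]

lemma upper_zero : upper (0 : ℤ_[p]) = 1 := by
  refine Units.ext ?_
  simp [upper_val, Matrix.one_fin_two]

lemma lower_zero : lower (0 : ℤ_[p]) = 1 := by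
  refine Units.ext ?_
  simp [lower_val, Matrix.one_fin_two]

lemma lower_natCast (n : ℕ) : lower (n : ℤ_[p]) = lower 1 ^ n := by
  induction n with
  | zero => simp [lower_zero]
  | succ n ih => rw [Nat.cast_succ, lower_add, ih, pow_succ]

lemma continuous_upper : Continuous (upper : ℤ_[p] → GLTwo p) := by
  refine Units.continuous_iff.2 ⟨continuous_matrix fun i j => ?_, continuous_matrix fun i j => ?_⟩
  · fin_cases i <;> fin_cases j <;> simp [upper_val] <;> fun_prop
  · simp only [upper_inv]
    fin_cases i <;> fin_cases j <;> simp [upper_val] <;> fun_prop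

lemma continuous_lower : Continuous (lower : ℤ_[p] → GLTwo p) := by
  refine Units.continuous_iff.2 ⟨continuous_matrix fun i j => ?_, continuous_matrix fun i j => ?_⟩
  · fin_cases i <;> fin_cases j <;> simp [lower_val] <;> fun_prop
  · change Continuous fun c : ℤ_[p] => !![1, 0; -c, 1] i j
    fin_cases i <;> fin_cases j <;> simp <;> fun_prop

lemma lower_mem (c : ℤ_[p]) : lower c ∈ lowerTriangular p := by
  change (lower c).1 0 1 = 0
  simp [lower_val]

lemma diagonalElement_mem (a d : ℤ_[p]ˣ) : (diagonalElement p a d : GLTwo p) ∈ lowerTriangular p :=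
  (diagonalElement p a d).2.1

lemma continuous_diagonalElement :
    Continuous fun x : ℤ_[p]ˣ × ℤ_[p]ˣ => diagonalElement p x.1 x.2 := by
  refine Continuous.subtype_mk (Units.continuous_iff.2
    ⟨continuous_matrix fun i j => ?_, continuous_matrix fun i j => ?_⟩) _
  · fin_cases i <;> fin_cases j
    · exact Units.continuous_val.comp continuous_fst
    · exact continuous_const
    · exact continuous_const
    · exact Units.continuous_val.comp continuous_snd
  · fin_cases i <;> fin_cases j
    · exact Units.continuous_val.comp continuous_fst.inv
    · exact continuous_const
    · exact continuous_const
    · exact Units.continuous_val.comp continuous_snd.inv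

lemma diagonalElement_mul (a d a' d' : ℤ_[p]ˣ) :
    diagonalElement p (a * a') (d * d') = diagonalElement p a d * diagonalElement p a' d' := by
  ext i j
  fin_cases i <;> fin_cases j <;> simp [diagonalElement]

lemma diagonalElement_one : diagonalElement p 1 1 = 1 := by
  ext i j
  fin_cases i <;> fin_cases j <;> simp [diagonalElement]

/-- The homomorphism `(a, d) ↦ diag(a, d)`. -/
def diagonalHom : ℤ_[p]ˣ × ℤ_[p]ˣ →* GLTwo p where
  toFun x := diagonalElement p x.1 x.2
  map_one' := by
    change ((diagonalElement p 1 1 : torus p) : GLTwo p) = 1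
    rw [diagonalElement_one]; rfl
  map_mul' x y := by
    change ((diagonalElement p (x.1 * y.1) (x.2 * y.2) : torus p) : GLTwo p) = _
    rw [diagonalElement_mul]; rfl

lemma continuous_diagonalHom : Continuous (diagonalHom (p := p)) :=
  continuous_subtype_val.comp continuous_diagonalElement

lemma projectionToTorus_eq (b : lowerTriangular p) {a d : ℤ_[p]ˣ} (ha : b.1.1 0 0 = a)
    (hd : b.1.1 1 1 = d) : projectionToTorus p b = diagonalElement p a d := by
  have h0 : diagonalEntry p 0 b = a := Units.ext ha
  have h1 : diagonalEntry p 1 b = d := Units.ext hd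
  change diagonalElement p (diagonalEntry p 0 b) (diagonalEntry p 1 b) = _
  rw [h0, h1]

lemma eq_lower_mul_diagonal (b : lowerTriangular p) :
    (b : GLTwo p) = lower (b.1.1 1 0 * (((diagonalEntry p 0 b)⁻¹ : ℤ_[p]ˣ) : ℤ_[p])) *
      diagonalHom (diagonalEntry p 0 b, diagonalEntry p 1 b) := by
  have h0 : b.1.1 0 1 = 0 := b.2
  have h00 : b.1.1 0 0 = diagonalEntry p 0 b := rfl
  have h11 : b.1.1 1 1 = diagonalEntry p 1 b := rfl
  refine Units.ext ?_
  ext i j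
  fin_cases i <;> fin_cases j <;>
    simp [lower_val, diagonalHom, diagonalElement, h0, h00, h11, Matrix.mul_apply,
      Fin.sum_univ_two]

end Matrices

/-! ### Topological generators of `P` -/

section Generators

variable {p : ℕ} [Fact p.Prime]

/-- The closure of the powers of a suitable `γ` contains a neighbourhood of `1`, so it has finite
index; coset representatives supply the remaining generators. -/
lemma exists_finite_generators_units :
    ∃ J : Set ℤ_[p]ˣ, J.Finite ∧ (Subgroup.closure J).topologicalClosure = ⊤ := by
  obtain ⟨γ, -, -, hγ⟩ := exists_tendsto_pow (p := p) (U := Set.univ) univ_mem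
  let Z : Subgroup ℤ_[p]ˣ := (Subgroup.zpowers γ).topologicalClosure
  have hZ : IsOpen (Z : Set ℤ_[p]ˣ) := by
    refine Subgroup.isOpen_of_mem_nhds Z (g := 1) ?_
    filter_upwards [hγ] with a ⟨t, n, _, _, _, hn⟩
    exact mem_closure_of_tendsto hn (Eventually.of_forall fun i =>
      (Subgroup.zpowers γ).pow_mem (Subgroup.mem_zpowers γ) _)
  have hfin : Finite (ℤ_[p]ˣ ⧸ Z) := Subgroup.quotient_finite_of_isOpen _ hZ
  let J : Set ℤ_[p]ˣ := {γ} ∪ Set.range (Quotient.out : ℤ_[p]ˣ ⧸ Z → ℤ_[p]ˣ)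
  refine ⟨J, (Set.finite_singleton γ).union (Set.finite_range _), eq_top_iff.2 fun a _ => ?_⟩
  have h1 : Z ≤ (Subgroup.closure J).topologicalClosure := by
    refine Subgroup.topologicalClosure_minimal _ ?_ (Subgroup.isClosed_topologicalClosure _)
    rw [Subgroup.zpowers_le]
    exact Subgroup.le_topologicalClosure _ (Subgroup.subset_closure (Or.inl rfl))
  have h2 : (a : ℤ_[p]ˣ ⧸ Z).out ∈ (Subgroup.closure J).topologicalClosure :=
    Subgroup.le_topologicalClosure _ (Subgroup.subset_closure (Or.inr ⟨_, rfl⟩))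
  have h3 : (a : ℤ_[p]ˣ ⧸ Z).out⁻¹ * a ∈ Z := by
    rw [← QuotientGroup.eq, QuotientGroup.out_eq']
  simpa using mul_mem h2 (h1 h3)

variable (p) in
/-- The group of lower triangular matrices is topologically finitely generated. -/
lemma exists_finite_generators_lowerTriangular :
    ∃ S : Set (GLTwo p), S.Finite ∧ S ⊆ lowerTriangular p ∧
      (lowerTriangular p : Set (GLTwo p)) ⊆ closure (Subgroup.closure S : Set (GLTwo p)) := by
  obtain ⟨J, hJ, hJt⟩ := exists_finite_generators_units (p := p)
  -- Every element of `P` is a lower unipotent times a diagonal matrix. As `ℕ` is dense in `ℤ_p`,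
  -- the single element `lower 1` topologically generates the unipotents.
  let S : Set (GLTwo p) := {lower 1} ∪ diagonalHom '' ((J ×ˢ {1}) ∪ ({1} ×ˢ J))
  refine ⟨S, (Set.finite_singleton _).union (Set.Finite.image _
    ((hJ.prod (Set.finite_singleton 1)).union ((Set.finite_singleton 1).prod hJ))), ?_, ?_⟩
  · rintro _ (rfl | ⟨x, -, rfl⟩)
    · exact lower_mem 1
    · exact diagonalElement_mem _ _
  let C : Subgroup (GLTwo p) := (Subgroup.closure S).topologicalClosure
  have hC : IsClosed (C : Set (GLTwo p)) := Subgroup.isClosed_topologicalClosure _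
  have hSC : S ⊆ C := Subgroup.subset_closure.trans (Subgroup.le_topologicalClosure _)
  have key (φ : ℤ_[p]ˣ →* GLTwo p) (hφ : Continuous φ) (h : ∀ j ∈ J, φ j ∈ C) (a : ℤ_[p]ˣ) :
      φ a ∈ C := by
    have h1 : (Subgroup.closure J).topologicalClosure ≤ C.comap φ :=
      Subgroup.topologicalClosure_minimal _ ((Subgroup.closure_le _).2 h) (hC.preimage hφ)
    rw [hJt] at h1
    exact h1 (Subgroup.mem_top a)
  have hd (x : ℤ_[p]ˣ × ℤ_[p]ˣ) : diagonalHom x ∈ C := by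
    have h1 := key (diagonalHom.comp (MonoidHom.inl _ _))
      (continuous_diagonalHom.comp (Continuous.prodMk_left 1)) (fun j hj =>
        hSC (Or.inr ⟨(j, 1), Or.inl ⟨hj, rfl⟩, rfl⟩)) x.1
    have h2 := key (diagonalHom.comp (MonoidHom.inr _ _))
      (continuous_diagonalHom.comp (Continuous.prodMk_right 1)) (fun j hj =>
        hSC (Or.inr ⟨(1, j), Or.inr ⟨rfl, hj⟩, rfl⟩)) x.2
    have h3 := C.mul_mem h1 h2
    rw [MonoidHom.comp_apply, MonoidHom.comp_apply, ← map_mul] at h3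
    simpa using h3
  have hl (c : ℤ_[p]) : lower c ∈ C := by
    have h1 : Set.range (Nat.cast : ℕ → ℤ_[p]) ⊆ lower ⁻¹' (C : Set (GLTwo p)) := by
      rintro _ ⟨n, rfl⟩
      rw [Set.mem_preimage, lower_natCast]
      exact C.pow_mem (hSC (Or.inl rfl)) n
    exact closure_minimal h1 (hC.preimage continuous_lower) (PadicInt.denseRange_natCast c)
  intro b hb
  change b ∈ C
  rw [show b = _ from eq_lower_mul_diagonal ⟨b, hb⟩]
  exact C.mul_mem (hl _) (hd _)

end Generators

/-! ### A continuous section of `G → G/P` -/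

section Section

variable {p : ℕ} [Fact p.Prime]

/-- The default value `0` on non-units does no harm: the non-units form the open set `‖x‖ < 1`. -/
lemma continuous_ringInverse : Continuous (Ring.inverse : ℤ_[p] → ℤ_[p]) := by
  refine continuous_iff_continuousAt.2 fun x => ?_
  by_cases hx : IsUnit x
  · obtain ⟨u, rfl⟩ := hx
    exact NormedRing.inverse_continuousAt u
  · have hopen : IsOpen {y : ℤ_[p] | ¬ IsUnit y} := by
      simp only [PadicInt.isUnit_iff]
      have : {y : ℤ_[p] | ¬ ‖y‖ = 1} = {y | ‖y‖ < 1} := by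
        ext y
        exact ⟨fun h => lt_of_le_of_ne (PadicInt.norm_le_one y) h, fun h => ne_of_lt h⟩
      rw [this]
      exact isOpen_lt continuous_norm continuous_const
    refine (continuousAt_const (y := (0 : ℤ_[p]))).congr ?_
    filter_upwards [hopen.mem_nhds hx] with y hy
    exact (Ring.inverse_non_unit y hy).symm

lemma isClopen_isUnit : IsClopen {x : ℤ_[p] | IsUnit x} := by
  have h : {x : ℤ_[p] | IsUnit x} = {x | Ring.inverse x ≠ 0} := by
    ext x
    constructor
    · rintro ⟨u, rfl⟩
      simp
    · intro h
      by_contra hx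
      exact h (Ring.inverse_non_unit x hx)
  refine ⟨?_, ?_⟩
  · simp only [PadicInt.isUnit_iff]
    exact isClosed_eq continuous_norm continuous_const
  · rw [h]
    exact isOpen_ne_fun continuous_ringInverse continuous_const

open Classical in
/-- A continuous section of `G → G/P`, composed with the projection. -/
def cosetSection (g : GLTwo p) : GLTwo p :=
  -- The coset `gP` is the second column of `g` up to units, a point of the projective line over
  -- `ℤ_p`. The two branches are its two affine charts, according to which coordinate is inverted.
  if IsUnit (g.1 1 1) then upper (g.1 0 1 * Ring.inverse (g.1 1 1))
  else swap p * upper (g.1 1 1 * Ring.inverse (g.1 0 1))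

lemma continuous_cosetSection : Continuous (cosetSection (p := p)) := by
  have h11 := continuous_entry p 1 1
  have h01 := continuous_entry p 0 1
  classical
  unfold cosetSection
  refine Continuous.if (fun g hg => ?_) ?_ ?_
  · have : IsClopen {g : GLTwo p | IsUnit (g.1 1 1)} := isClopen_isUnit.preimage h11
    rw [this.frontier_eq] at hg
    exact hg.elim
  · exact continuous_upper.comp (h01.mul (continuous_ringInverse.comp h11))
  · exact continuous_const.mul (continuous_upper.comp (h11.mul (continuous_ringInverse.comp h01)))

lemma isUnit_entry {g : GLTwo p} (h : ¬ IsUnit (g.1 1 1)) : IsUnit (g.1 0 1) := by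
  have hdet : IsUnit g.1.det := (Matrix.isUnit_iff_isUnit_det _).1 g.isUnit
  rw [Matrix.det_fin_two] at hdet
  by_contra h'
  have h1 : g.1 0 0 * g.1 1 1 ∈ nonunits ℤ_[p] := mul_mem_nonunits_right h
  have h2 : g.1 0 1 * g.1 1 0 ∈ nonunits ℤ_[p] := mul_mem_nonunits_left h'
  exact IsLocalRing.nonunits_add h1 (by
    rw [← IsLocalRing.mem_maximalIdeal] at h2 ⊢
    exact neg_mem h2) (by rwa [← sub_eq_add_neg])

lemma cosetSection_inv_mul_mem (g : GLTwo p) : (cosetSection g)⁻¹ * g ∈ lowerTriangular p := by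
  change ((cosetSection g)⁻¹ * g).1 0 1 = 0
  unfold cosetSection
  split_ifs with h
  · rw [upper_inv, Units.val_mul, upper_val]
    simp [Matrix.mul_apply, Fin.sum_univ_two, mul_assoc, Ring.inverse_mul_cancel _ h]
  · have h' := isUnit_entry h
    rw [mul_inv_rev, upper_inv, swap_inv, Units.val_mul, Units.val_mul, upper_val, swap_val]
    simp [Matrix.mul_apply, Fin.sum_univ_two, mul_assoc, Ring.inverse_mul_cancel _ h']

lemma cosetSection_mul (g : GLTwo p) (b : lowerTriangular p) :
    cosetSection (g * b : GLTwo p) = cosetSection g := by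
  have h0 : b.1.1 0 1 = 0 := b.2
  obtain ⟨u, hu⟩ : IsUnit (b.1.1 1 1) := ⟨diagonalEntry p 1 b, rfl⟩
  have e1 : (g * b : GLTwo p).1 1 1 = g.1 1 1 * u := by
    simp [Matrix.mul_apply, Fin.sum_univ_two, h0, hu]
  have e0 : (g * b : GLTwo p).1 0 1 = g.1 0 1 * u := by
    simp [Matrix.mul_apply, Fin.sum_univ_two, h0, hu]
  have key (x y : ℤ_[p]) : x * u * Ring.inverse (y * u) = x * Ring.inverse y := by
    rw [Ring.mul_inverse_rev, Ring.inverse_unit, mul_assoc, Units.mul_inv_cancel_left]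
  have hiff : IsUnit ((g * b : GLTwo p).1 1 1) ↔ IsUnit (g.1 1 1) := by
    rw [e1, Units.isUnit_mul_units]
  classical
  unfold cosetSection
  rw [if_congr hiff rfl rfl, e0, e1, key, key]

/-- The factor in `P` of the decomposition of `G` given by `cosetSection`. -/
def lowerFactor (g : GLTwo p) : lowerTriangular p :=
  ⟨(cosetSection g)⁻¹ * g, cosetSection_inv_mul_mem g⟩

lemma continuous_lowerFactor : Continuous (lowerFactor (p := p)) :=
  Continuous.subtype_mk (continuous_cosetSection.inv.mul continuous_id) _

lemma lowerFactor_mul (g : GLTwo p) (b : lowerTriangular p) :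
    lowerFactor (g * b : GLTwo p) = lowerFactor g * b := by
  refine Subtype.ext ?_
  simp only [lowerFactor, cosetSection_mul, Subgroup.coe_mul, mul_assoc]

lemma cosetSection_mul_lowerFactor (g : GLTwo p) : cosetSection g * lowerFactor g = g := by
  simp [lowerFactor]

end Section

end IwasawaRep

end

noncomputable section

namespace IwasawaRep

open TensorProduct

/-! ### Splitting `Ind_P^G(χ)` off `C(G, K)` -/

section Retraction

variable {p : ℕ} [Fact p.Prime] {K : Type*} [NontriviallyNormedField K] [IsUltrametricDist K]
variable (χ : torus p →ₜ* (IntegerRing K)ˣ)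

lemma norm_unit_eq_one (u : (IntegerRing K)ˣ) : ‖((u : IntegerRing K) : K)‖ = 1 := by
  have h1 : ‖((u : IntegerRing K) : K)‖ ≤ 1 := (u : IntegerRing K).2
  have h2 : ‖(((u⁻¹ : (IntegerRing K)ˣ) : IntegerRing K) : K)‖ ≤ 1 := ((u⁻¹ : _ˣ) : IntegerRing K).2
  have h3 : ((u : IntegerRing K) : K) * (((u⁻¹ : (IntegerRing K)ˣ) : IntegerRing K) : K) = 1 := by
    rw [← Subring.coe_mul, Units.mul_inv, Subring.coe_one]
  have h4 := congrArg norm h3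
  rw [norm_mul, norm_one] at h4
  nlinarith [norm_nonneg ((u : IntegerRing K) : K)]

/-- The `K`-valued function underlying a character of `P`. -/
def charP (b : lowerTriangular p) : K := ((χ (projectionToTorus p b) : IntegerRing K) : K)

lemma charP_mul (b b' : lowerTriangular p) : charP χ (b * b') = charP χ b * charP χ b' := by
  simp [charP]

lemma charP_one : charP χ 1 = 1 := by simp [charP]

lemma norm_charP (b : lowerTriangular p) : ‖charP χ b‖ = 1 := norm_unit_eq_one _

lemma charP_ne_zero (b : lowerTriangular p) : charP χ b ≠ 0 := by
  rw [← norm_ne_zero_iff, norm_charP]; exact one_ne_zero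

lemma charP_inv (b : lowerTriangular p) : charP χ b⁻¹ = (charP χ b)⁻¹ := by
  refine eq_inv_of_mul_eq_one_left ?_
  rw [← charP_mul, inv_mul_cancel, charP_one]

lemma continuous_charP : Continuous (charP χ) :=
  continuous_subtype_val.comp (Units.continuous_val.comp
    (χ.continuous_toFun.comp (projectionToTorus p).continuous_toFun))

variable {χ} in
lemma Ind.apply_mul (f : Ind χ) (g : GLTwo p) (b : lowerTriangular p) :
    f.1 (g * b) = (charP χ b)⁻¹ * f.1 g := by
  rw [f.2 g b, ← charP_inv]; rfl

/-- The nowhere vanishing element of `Ind_P^G(χ)` given by the section of `G → G/P`. -/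
def unitFunction : C(GLTwo p, K) where
  toFun g := charP χ (lowerFactor g)⁻¹
  continuous_toFun := (continuous_charP χ).comp continuous_lowerFactor.inv

lemma unitFunction_apply (g : GLTwo p) : unitFunction χ g = (charP χ (lowerFactor g))⁻¹ :=
  charP_inv χ _

lemma norm_unitFunction (g : GLTwo p) : ‖unitFunction χ g‖ = 1 := norm_charP χ _

lemma unitFunction_mul (g : GLTwo p) (b : lowerTriangular p) :
    unitFunction χ (g * b) = (charP χ b)⁻¹ * unitFunction χ g := by
  rw [unitFunction_apply, unitFunction_apply, lowerFactor_mul, charP_mul, mul_inv, mul_comm]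

/-- The projection of `C(G, K)` onto `Ind_P^G(χ)` given by the section of `G → G/P`. -/
def retraction : C(GLTwo p, K) →L[K] Ind χ where
  toFun f := ⟨unitFunction χ * f.comp ⟨cosetSection, continuous_cosetSection⟩, fun g b => by
    change unitFunction χ (g * b) * f (cosetSection (g * b)) =
      charP χ b⁻¹ * (unitFunction χ g * f (cosetSection g))
    rw [unitFunction_mul, cosetSection_mul, charP_inv, mul_assoc]⟩
  map_add' f f' := by ext g; simp [mul_add]
  map_smul' c f := by ext g; simp
  cont := Continuous.subtype_mk (continuous_const.mul (ContinuousMap.continuous_precomp _)) _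

lemma retraction_apply (f : C(GLTwo p, K)) (g : GLTwo p) :
    (retraction χ f).1 g = unitFunction χ g * f (cosetSection g) := rfl

lemma retraction_coe (f : Ind χ) : retraction χ f.1 = f := by
  ext g
  rw [retraction_apply, unitFunction_apply, ← Ind.apply_mul, cosetSection_mul_lowerFactor]

end Retraction

/-! ### Maps out of the induced module -/

section InducedModule

variable {R A K : Type*} [Ring R] [Ring A] [Field K] {M : Type*} [AddCommGroup M] [Module A M]

/-- The `A`-linear map `A ⊗_ℤ K → M` extending an additive map `K → M`. -/
def tensorLift (A : Type*) [Ring A] [Module A M] (θ : K →+ M) : A ⊗[ℤ] K →ₗ[A] M where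
  toFun := TensorProduct.liftAddHom
    { toFun := fun a => (DistribSMul.toAddMonoidHom M a).comp θ
      map_zero' := by ext v; exact zero_smul _ _
      map_add' := fun a b => by ext v; exact add_smul _ _ _ }
    (fun n a v => by
      change (n • a) • θ v = a • θ (n • v)
      rw [map_zsmul, smul_comm, smul_assoc])
  map_add' := map_add _
  map_smul' a x := by
    induction x using TensorProduct.induction_on with
    | zero => simp
    | add x y hx hy => rw [smul_add, map_add, hx, hy, map_add, smul_add]
    | tmul b v =>
      rw [TensorProduct.smul_tmul']
      exact mul_smul a b (θ v)

lemma tensorLift_tmul (θ : K →+ M) (a : A) (v : K) : tensorLift A θ (a ⊗ₜ v) = a • θ v := rfl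

/-- The `A`-linear map `A ⊗_R K^{(χ)} → M` extending a semilinear map `K → M`. -/
def inducedLift (i : R →+* A) (χ : R →+* K) (θ : K →+ M)
    (h : ∀ r v, i r • θ v = θ (χ r * v)) : InducedModule i χ →ₗ[A] M :=
  (balancedRelations i χ).liftQ (tensorLift A θ) (by
    refine Submodule.span_le.2 ?_
    rintro _ ⟨a, r, v, rfl⟩
    rw [SetLike.mem_coe, LinearMap.mem_ker, map_sub, tensorLift_tmul, tensorLift_tmul,
      sub_eq_zero, mul_smul, h])

lemma InducedModule.tmul_mul (i : R →+* A) (χ : R →+* K) (a : A) (r : R) (v : K) :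
    InducedModule.tmul i χ (a * i r) v = InducedModule.tmul i χ a (χ r * v) :=
  (Submodule.Quotient.eq _).2 (Submodule.subset_span ⟨a, r, v, rfl⟩)

lemma InducedModule.tmul_add_left (i : R →+* A) (χ : R →+* K) (a b : A) (v : K) :
    InducedModule.tmul i χ (a + b) v = InducedModule.tmul i χ a v + InducedModule.tmul i χ b v := by
  simp only [InducedModule.tmul, TensorProduct.add_tmul, Submodule.Quotient.mk_add]

lemma InducedModule.tmul_zero_left (i : R →+* A) (χ : R →+* K) (v : K) :
    InducedModule.tmul i χ 0 v = 0 := by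
  rw [InducedModule.tmul, TensorProduct.zero_tmul, Submodule.Quotient.mk_zero]

lemma InducedModule.tmul_zero_right (i : R →+* A) (χ : R →+* K) (a : A) :
    InducedModule.tmul i χ a 0 = 0 := by
  rw [InducedModule.tmul, TensorProduct.tmul_zero, Submodule.Quotient.mk_zero]

/-- A scalar `v = χ(r)` on the right moves across the tensor sign as right multiplication by `i r`.
-/
lemma InducedModule.exists_tmul_one (i : R →+* A) (χ : R →+* K)
    (hχ : Function.Surjective χ) (x : InducedModule i χ) :
    ∃ a : A, x = InducedModule.tmul i χ a 1 := by
  obtain ⟨z, rfl⟩ := Submodule.Quotient.mk_surjective _ x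
  induction z using TensorProduct.induction_on with
  | zero => exact ⟨0, by simp [InducedModule.tmul]⟩
  | add y z hy hz =>
    obtain ⟨a, ha⟩ := hy
    obtain ⟨b, hb⟩ := hz
    exact ⟨a + b, by rw [Submodule.Quotient.mk_add, ha, hb, InducedModule.tmul_add_left]⟩
  | tmul a v =>
    obtain ⟨r, rfl⟩ := hχ v
    exact ⟨a * i r, by rw [InducedModule.tmul_mul, mul_one]; rfl⟩

end InducedModule

/-! ### The map `M_{χ⁻¹} → Ind_P^G(χ)'` -/

section Dual

variable {p : ℕ} [Fact p.Prime] {K : Type*} [NontriviallyNormedField K] [IsUltrametricDist K]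
  [CompleteSpace K]

lemma integralCLM_mapInt {G₁ G₂ : Type*} [Group G₁] [TopologicalSpace G₁] [IsTopologicalGroup G₁]
    [CompactSpace G₁] [TotallyDisconnectedSpace G₁] [Group G₂] [TopologicalSpace G₂]
    [IsTopologicalGroup G₂] [CompactSpace G₂] [TotallyDisconnectedSpace G₂] (φ : G₁ →ₜ* G₂)
    (μ : IntCompletedGroupRing K G₁) (f : C(G₂, K)) :
    integralCLM (mapInt K φ μ) f = integralCLM μ (f.comp ⟨φ, φ.continuous_toFun⟩) := by
  have : integralCLM (mapInt K φ μ) = (integralCLM μ).comp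
      ({ toFun := fun f => f.comp ⟨φ, φ.continuous_toFun⟩
         map_add' := fun _ _ => rfl
         map_smul' := fun _ _ => rfl
         cont := ContinuousMap.continuous_precomp _ } : C(G₂, K) →L[K] C(G₁, K)) := by
    refine clm_ext_cosetFunction fun H u => ?_
    rw [integralCLM_cosetFunction]
    change linExt u (levelMap K φ H (μ.1 (comapOpenNormal φ H))) = integralCLM μ
      (cosetFunction (comapOpenNormal φ H) fun x => u (QuotientGroup.map
        (comapOpenNormal φ H).toSubgroup H.toSubgroup φ.toMonoidHom le_rfl x))
    rw [integralCLM_cosetFunction, levelMap, linExt_mapDomain]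
  rw [this]
  rfl

variable {E : Type*} [NormedAddCommGroup E] [NormedSpace K E] [CompleteSpace E]
  {G : Type*} [Group G] [TopologicalSpace G] [IsTopologicalGroup G] [CompactSpace G]
  [TotallyDisconnectedSpace G]

lemma dual_smul_form (ρ : BanachRep K G E) (a : CompletedGroupRing K G) (ℓ : ρ.Dual) (v : E) :
    (a • ℓ).form v = integralK (ρ.coefficient ℓ.form v) a := by
  obtain ⟨k, μ, rfl⟩ := exists_eq_tmul a
  rw [integralK_tmul]
  have h : ρ.dualAction (k ⊗ₜ μ) = algebraMap K _ k * ρ.intDualAction μ :=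
    Algebra.TensorProduct.lift_tmul _ _ _ _ _
  change ρ.dualAction (k ⊗ₜ μ) ℓ.form v = _
  rw [h]
  rfl

variable (χ : torus p →ₜ* (IntegerRing K)ˣ)

/-- Evaluation at `1`, as an element of the dual of `Ind_P^G(χ)`. -/
def evalOne (v : K) : (principalSeries χ).Dual :=
  (v • (ContinuousMap.evalCLM K (1 : GLTwo p) : C(GLTwo p, K) →L[K] K).comp (Ind χ).subtypeL :
    Ind χ →L[K] K)

/-- The coefficient function `g ↦ (g⁻¹ f)(1)` of evaluation at `1` is `f` itself, so acting on this
form by a measure is integrating `f`. -/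
lemma smul_evalOne_form (a : CompletedGroupRing K (GLTwo p)) (v : K) (f : Ind χ) :
    (a • evalOne χ v).form f = v * integralK f.1 a := by
  rw [dual_smul_form]
  have : (principalSeries χ).coefficient (evalOne χ v).form f = v • f.1 := by
    ext g
    change v * f.1 (g⁻¹⁻¹ * 1) = v * f.1 g
    simp
  rw [this]
  obtain ⟨k, μ, rfl⟩ := exists_eq_tmul a
  rw [integralK_tmul, integralK_tmul, map_smul, smul_eq_mul]
  ring

lemma evalOne_add (v w : K) : evalOne χ (v + w) = evalOne χ v + evalOne χ w :=
  add_smul v w _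

lemma dual_ext {ρ : BanachRep K G E} {ℓ ℓ' : ρ.Dual} (h : ∀ v, ℓ.form v = ℓ'.form v) : ℓ = ℓ' :=
  ContinuousLinearMap.ext (f := ℓ.form) (g := ℓ'.form) h

/-- On `P` one has `f(b) = χ(b)⁻¹ f(1)`, so `K[[P]]` acts on evaluation at `1` through `χ⁻¹`. This
is the compatibility required by the relations of the tensor product. -/
lemma mapCompleted_smul_evalOne (r : CompletedGroupRing K (lowerTriangular p)) (v : K) :
    mapCompleted K (inclusionLower p) r • evalOne χ v =
      evalOne χ (character χ⁻¹ (mapCompleted K (projectionToTorus p) r) * v) := by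
  refine dual_ext fun f => ?_
  rw [smul_evalOne_form]
  obtain ⟨k, μ, rfl⟩ := exists_eq_tmul r
  have h1 : mapCompleted K (inclusionLower p) (k ⊗ₜ μ) = k ⊗ₜ mapInt K (inclusionLower p) μ :=
    Algebra.TensorProduct.map_tmul _ _ _ _
  have h2 : mapCompleted K (projectionToTorus p) (k ⊗ₜ μ) = k ⊗ₜ mapInt K (projectionToTorus p) μ :=
    Algebra.TensorProduct.map_tmul _ _ _ _
  have h3 : character χ⁻¹ (k ⊗ₜ mapInt K (projectionToTorus p) μ) =
      k * intCharacter χ⁻¹ (mapInt K (projectionToTorus p) μ) :=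
    Algebra.TensorProduct.lift_tmul _ _ _ _ _
  rw [h1, h2, h3, integralK_tmul, integralCLM_mapInt]
  change _ = (k * integralCLM (mapInt K (projectionToTorus p) μ) _ * v) * f.1 1
  rw [integralCLM_mapInt]
  have : f.1.comp ⟨inclusionLower p, (inclusionLower p).continuous_toFun⟩ = f.1 1 •
      ContinuousMap.comp ⟨fun g => (((χ⁻¹ : torus p →ₜ* (IntegerRing K)ˣ) g : IntegerRing K) : K),
        continuous_subtype_val.comp (Units.continuous_val.comp (χ⁻¹).continuous_toFun)⟩
        ⟨projectionToTorus p, (projectionToTorus p).continuous_toFun⟩ := by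
    ext b
    have h := f.2 1 b
    rw [one_mul] at h
    change f.1 b = f.1 1 * (((χ (projectionToTorus p b))⁻¹ : (IntegerRing K)ˣ) : IntegerRing K)
    rw [h, map_inv, map_inv, mul_comm]
  rw [this, map_smul, smul_eq_mul]
  ring

/-- The map `M_{χ⁻¹} → Ind_P^G(χ)'` sending `μ ⊗ v` to `f ↦ v ∫ f dμ`. -/
def toDual : InducedIwasawaModule χ⁻¹ →ₗ[CompletedGroupRing K (GLTwo p)]
    (principalSeries χ).Dual :=
  inducedLift _ _
    { toFun := evalOne χ
      map_zero' := zero_smul K _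
      map_add' := evalOne_add χ } (mapCompleted_smul_evalOne χ)

lemma toDual_tmul_form (a : CompletedGroupRing K (GLTwo p)) (v : K) (f : Ind χ) :
    (toDual χ (InducedIwasawaModule.tmul χ⁻¹ a v)).form f = v * integralK f.1 a := by
  rw [← smul_evalOne_form]
  rfl

end Dual

end IwasawaRep
end

noncomputable section

namespace IwasawaRep

open TensorProduct

/-! ### Bijectivity of `M_{χ⁻¹} → Ind_P^G(χ)'` -/

section Additivity

variable {K : Type*} [NontriviallyNormedField K] [IsUltrametricDist K] [CompleteSpace K]
  {G : Type*} [Group G] [TopologicalSpace G] [IsTopologicalGroup G] [CompactSpace G]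
  [TotallyDisconnectedSpace G]

lemma integralCLM_sub (μ ν : IntCompletedGroupRing K G) :
    integralCLM (μ - ν) = integralCLM μ - integralCLM ν :=
  eq_sub_of_add_eq ((integralCLM_add _ _).symm.trans (congrArg integralCLM (sub_add_cancel μ ν)))

lemma integralCLM_sum {J : Type*} (s : Finset J) (μ : J → IntCompletedGroupRing K G) :
    integralCLM (∑ j ∈ s, μ j) = ∑ j ∈ s, integralCLM (μ j) :=
  map_sum (AddMonoidHom.mk' (integralCLM : _ → C(G, K) →L[K] K) integralCLM_add) μ s

end Additivity

section DualIso

variable {p : ℕ} [Fact p.Prime] {K : Type*} [NontriviallyNormedField K] [IsUltrametricDist K]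
  [CompleteSpace K] (χ : torus p →ₜ* (IntegerRing K)ˣ)

/-- Composition with `retraction` extends a form on `Ind_P^G(χ)` to `C(G, K)`; after rescaling into
the unit ball it is given by an element of `o[[G]]`. -/
lemma toDual_surjective : Function.Surjective (toDual χ) := by
  intro ℓ
  let L : C(GLTwo p, K) →L[K] K := ℓ.form.comp (retraction χ)
  obtain ⟨k, hk⟩ := NormedField.exists_lt_norm K ‖L‖
  have hk0 : k ≠ 0 := norm_pos_iff.1 ((norm_nonneg L).trans_lt hk)
  obtain ⟨μ, hμ⟩ := exists_integralCLM_eq (k⁻¹ • L) fun f => by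
    rw [smul_apply, norm_smul, norm_inv, inv_mul_le_iff₀ (norm_pos_iff.2 hk0)]
    exact (L.le_opNorm f).trans (mul_le_mul_of_nonneg_right hk.le (norm_nonneg f))
  refine ⟨InducedIwasawaModule.tmul χ⁻¹ (k ⊗ₜ μ) 1, dual_ext fun f => ?_⟩
  rw [toDual_tmul_form, integralK_tmul, hμ, smul_apply, smul_eq_mul, mul_inv_cancel_left₀ hk0,
    one_mul]
  change ℓ.form (retraction χ f.1) = _
  rw [retraction_coe]

/-- The inverse of `unitFunction`. -/
def unitFunctionInv : C(GLTwo p, K) where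
  toFun g := charP χ (lowerFactor g)
  continuous_toFun := (continuous_charP χ).comp continuous_lowerFactor

lemma unitFunctionInv_apply (g : GLTwo p) : unitFunctionInv χ g = charP χ (lowerFactor g) := rfl

lemma unitFunctionInv_mul (g : GLTwo p) (b : lowerTriangular p) :
    unitFunctionInv χ (g * b) = charP χ b * unitFunctionInv χ g := by
  rw [unitFunctionInv_apply, unitFunctionInv_apply, lowerFactor_mul, charP_mul, mul_comm]

lemma unitFunction_mul_inv : unitFunction χ * unitFunctionInv χ = 1 := by
  ext g
  rw [ContinuousMap.mul_apply, unitFunction_apply, unitFunctionInv_apply,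
    inv_mul_cancel₀ (charP_ne_zero χ _), ContinuousMap.one_apply]

lemma norm_mul_unitFunction_le (f : C(GLTwo p, K)) : ‖unitFunction χ * f‖ ≤ ‖f‖ := by
  refine (ContinuousMap.norm_le _ (norm_nonneg _)).2 fun g => ?_
  rw [ContinuousMap.mul_apply, norm_mul, norm_unitFunction, one_mul]
  exact f.norm_coe_le_norm g

lemma norm_mul_unitFunctionInv_le (f : C(GLTwo p, K)) : ‖unitFunctionInv χ * f‖ ≤ ‖f‖ := by
  refine (ContinuousMap.norm_le _ (norm_nonneg _)).2 fun g => ?_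
  rw [ContinuousMap.mul_apply, norm_mul, unitFunctionInv_apply, norm_charP, one_mul]
  exact f.norm_coe_le_norm g

/-- A measure which vanishes on `Ind_P^G(χ)` is a finite sum of measures
`κ_j (δ_{b_j} - χ⁻¹(b_j))` with `b_j ∈ P`. -/
lemma exists_measures_of_vanishing [ProperSpace K] (μ : IntCompletedGroupRing K (GLTwo p))
    (hμ : ∀ f : Ind χ, integralCLM μ f.1 = 0) :
    ∃ (J : Type) (_ : Fintype J) (b : J → lowerTriangular p)
      (κ : J → IntCompletedGroupRing K (GLTwo p)),
      μ = ∑ j, (κ j * dirac K (b j : GLTwo p) -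
        ((χ (projectionToTorus p (b j)))⁻¹ : (IntegerRing K)ˣ).1 • κ j) := by
  classical
  obtain ⟨S, hS, hSP, hcl⟩ := exists_finite_generators_lowerTriangular p
  have := hS.fintype
  let b (j : S) : lowerTriangular p := ⟨j, hSP j.2⟩
  -- Multiplication by `unitFunction` carries right `P`-invariant functions into `Ind_P^G(χ)`, so
  -- the twisted form kills all of them.
  obtain ⟨ν, hν1, hν2⟩ := exists_form_of_vanishing (K := K) (lowerTriangular p)
    (fun j : S => (j : GLTwo p)) (by rwa [Subtype.range_coe])
    ((integralCLM μ).comp (ContinuousLinearMap.mul K C(GLTwo p, K) (unitFunction χ)))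
    (fun f => (norm_integral_le _ μ).trans (norm_mul_unitFunction_le χ f))
    (fun f hf => hμ ⟨unitFunction χ * f, fun g x => by
      change unitFunction χ (g * x) * f (g * x) = charP χ x⁻¹ * (unitFunction χ g * f g)
      rw [unitFunction_mul, hf g x x.2, charP_inv, mul_assoc]⟩)
  -- Untwisting turns `F(gb) - F(g)` into `χ(b) f(gb) - f(g)`, up to the common factor
  -- `unitFunctionInv χ g`. The scalar `χ(b_j)` is absorbed into `κ_j`, leaving `δ_{b_j} -
  -- χ(b_j)⁻¹`.
  have hκ (j : S) : ∃ κ : IntCompletedGroupRing K (GLTwo p), integralCLM κ =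
      charP χ (b j) • (ν.comp (ContinuousLinearMap.single K (fun _ : S => C(GLTwo p, K)) j)).comp
        (ContinuousLinearMap.mul K C(GLTwo p, K) (unitFunctionInv χ)) := by
    refine exists_integralCLM_eq _ fun f => ?_
    rw [smul_apply, norm_smul, norm_charP, one_mul]
    refine (hν1 _).trans ?_
    change ‖(Pi.single j (unitFunctionInv χ * f) : S → C(GLTwo p, K))‖ ≤ _
    rw [Pi.norm_single]
    exact norm_mul_unitFunctionInv_le χ f
  choose κ hκ using hκ
  refine ⟨S, inferInstance, b, κ, integralCLM_injective ?_⟩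
  ext f
  have h1 : integralCLM μ f = ν (differences (fun j : S => (j : GLTwo p)) (unitFunctionInv χ * f)) := by
    have := congrArg (fun ℓ => ℓ (unitFunctionInv χ * f)) hν2
    simp only [ContinuousLinearMap.comp_apply, ContinuousLinearMap.mul_apply', ← mul_assoc,
      unitFunction_mul_inv, one_mul] at this
    exact this.symm
  rw [h1, integralCLM_sum, sum_apply, ← Finset.univ_sum_single (differences _ _), map_sum]
  refine Finset.sum_congr rfl fun j _ => ?_
  have hκ' (f : C(GLTwo p, K)) : integralCLM (κ j) f =
      charP χ (b j) * ν (Pi.single j (unitFunctionInv χ * f)) := by rw [hκ]; rfl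
  have hb : (((χ (projectionToTorus p (b j)))⁻¹ : (IntegerRing K)ˣ).1 : K) =
      (charP χ (b j))⁻¹ := by
    rw [← charP_inv, charP, map_inv, map_inv]
  have hD : (Pi.single j (differences (K := K) (fun j : S => (j : GLTwo p))
      (unitFunctionInv χ * f) j) : S → C(GLTwo p, K)) =
      charP χ (b j) • (Pi.single j (unitFunctionInv χ * rightTranslate (b j : GLTwo p) f) :
        S → C(GLTwo p, K)) - (Pi.single j (unitFunctionInv χ * f) : S → C(GLTwo p, K)) := by
    rw [← Pi.single_smul, ← Pi.single_sub]
    congr 1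
    ext g
    rw [differences_apply]
    change unitFunctionInv χ (g * b j) * f (g * b j) - unitFunctionInv χ g * f g =
      charP χ (b j) * (unitFunctionInv χ g * f (g * b j)) - unitFunctionInv χ g * f g
    rw [unitFunctionInv_mul, mul_assoc]
  rw [hD, map_sub, map_smul, smul_eq_mul, integralCLM_sub, sub_apply, integralCLM_mul_dirac,
    integralCLM_smul, smul_apply, hκ', hκ', hb, smul_eq_mul,
    inv_mul_cancel_left₀ (charP_ne_zero χ _)]
  rfl

lemma InducedIwasawaModule.tmul_mul (a : CompletedGroupRing K (GLTwo p))
    (r : CompletedGroupRing K (lowerTriangular p)) (v : K) :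
    InducedIwasawaModule.tmul χ (a * mapCompleted K (inclusionLower p) r) v =
      InducedIwasawaModule.tmul χ a
        (character χ (mapCompleted K (projectionToTorus p) r) * v) :=
  InducedModule.tmul_mul (mapCompleted K (inclusionLower p)).toRingHom
    ((character χ).comp (mapCompleted K (projectionToTorus p))).toRingHom a r v

lemma InducedIwasawaModule.tmul_zero_right (a : CompletedGroupRing K (GLTwo p)) :
    InducedIwasawaModule.tmul χ a 0 = 0 :=
  InducedModule.tmul_zero_right _ _ a

lemma InducedIwasawaModule.tmul_zero_left (v : K) : InducedIwasawaModule.tmul χ 0 v = 0 :=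
  InducedModule.tmul_zero_left _ _ v

lemma InducedIwasawaModule.tmul_sum {J : Type*} (s : Finset J)
    (a : J → CompletedGroupRing K (GLTwo p)) (v : K) :
    InducedIwasawaModule.tmul χ (∑ j ∈ s, a j) v = ∑ j ∈ s, InducedIwasawaModule.tmul χ (a j) v :=
  map_sum (AddMonoidHom.mk' (fun a => InducedIwasawaModule.tmul χ a v)
    fun a b => InducedModule.tmul_add_left _ _ a b v) a s

lemma InducedIwasawaModule.exists_tmul_one (x : InducedIwasawaModule χ) :
    ∃ a, x = InducedIwasawaModule.tmul χ a 1 :=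
  InducedModule.exists_tmul_one _ _ (fun v => ⟨algebraMap K _ v,
    ((character χ).comp (mapCompleted K (projectionToTorus p))).commutes v⟩) x

/-- The element `δ_b - ψ(b)` of `K[[P]]`. -/
def diracSub (b : lowerTriangular p) : CompletedGroupRing K (lowerTriangular p) :=
  1 ⊗ₜ dirac K b - ((χ (projectionToTorus p b) : IntegerRing K) : K) ⊗ₜ 1

lemma mapCompleted_tmul {G₁ G₂ : Type*} [Group G₁] [TopologicalSpace G₁] [Group G₂]
    [TopologicalSpace G₂] (φ : G₁ →ₜ* G₂) (k : K) (μ : IntCompletedGroupRing K G₁) :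
    mapCompleted K φ (k ⊗ₜ μ) = k ⊗ₜ mapInt K φ μ :=
  Algebra.TensorProduct.map_tmul _ _ _ _

lemma character_tmul {G₁ : Type*} [Group G₁] [TopologicalSpace G₁] [IsTopologicalGroup G₁]
    [CompactSpace G₁] [TotallyDisconnectedSpace G₁] (ψ : G₁ →ₜ* (IntegerRing K)ˣ) (k : K)
    (μ : IntCompletedGroupRing K G₁) : character ψ (k ⊗ₜ μ) = k * intCharacter ψ μ :=
  Algebra.TensorProduct.lift_tmul _ _ _ _ _

lemma character_diracSub (b : lowerTriangular p) :
    character χ (mapCompleted K (projectionToTorus p) (diracSub χ b)) = 0 := by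
  rw [diracSub, map_sub, map_sub, mapCompleted_tmul, mapCompleted_tmul, character_tmul,
    character_tmul, mapInt_dirac, map_one, map_one, one_mul, mul_one, sub_eq_zero]
  exact integralCLM_dirac _ _

lemma tmul_mul_sub {R A B : Type*} [CommRing R] [CommRing A] [Algebra R A] [Ring B] [Algebra R B]
    (k : A) (c : R) (κ δ : B) :
    (k ⊗ₜ[R] κ) * (1 ⊗ₜ[R] δ - algebraMap R A c ⊗ₜ[R] 1) = k ⊗ₜ[R] (κ * δ - c • κ) := by
  rw [mul_sub, Algebra.TensorProduct.tmul_mul_tmul, Algebra.TensorProduct.tmul_mul_tmul, mul_one,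
    mul_one, TensorProduct.tmul_sub, ← TensorProduct.smul_tmul, Algebra.smul_def, mul_comm k]

lemma tmul_mul_diracSub (k : K) (κ : IntCompletedGroupRing K (GLTwo p)) (b : lowerTriangular p) :
    (k ⊗ₜ κ : CompletedGroupRing K (GLTwo p)) * mapCompleted K (inclusionLower p) (diracSub χ b) =
      k ⊗ₜ (κ * dirac K (b : GLTwo p) - (χ (projectionToTorus p b)).1 • κ) := by
  have h : mapCompleted K (inclusionLower p) (diracSub χ b) =
      1 ⊗ₜ dirac K (b : GLTwo p) - ((χ (projectionToTorus p b) : IntegerRing K) : K) ⊗ₜ 1 := by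
    rw [diracSub, map_sub, mapCompleted_tmul, mapCompleted_tmul, mapInt_dirac, map_one]
    rfl
  exact (congrArg (_ * ·) h).trans (tmul_mul_sub k _ κ _)

/-- Each factor `δ_b - χ⁻¹(b)` comes from `K[[P]]` and crosses the tensor sign as the scalar `0`.
The finiteness of the sum is essential. -/
lemma tmul_eq_zero_of_vanishing [ProperSpace K] (k : K) (μ : IntCompletedGroupRing K (GLTwo p))
    (hμ : ∀ f : Ind χ, integralCLM μ f.1 = 0) :
    InducedIwasawaModule.tmul χ⁻¹ (k ⊗ₜ μ) 1 = 0 := by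
  obtain ⟨J, _, b, κ, rfl⟩ := exists_measures_of_vanishing χ μ hμ
  have hsum : k ⊗ₜ[IntegerRing K] (∑ j, (κ j * dirac K (b j : GLTwo p) -
        ((χ (projectionToTorus p (b j)))⁻¹ : (IntegerRing K)ˣ).1 • κ j)) =
      ∑ j, (k ⊗ₜ κ j : CompletedGroupRing K (GLTwo p)) *
        mapCompleted K (inclusionLower p) (diracSub χ⁻¹ (b j)) := by
    rw [TensorProduct.tmul_sum]
    exact Finset.sum_congr rfl fun j _ => (tmul_mul_diracSub χ⁻¹ k (κ j) (b j)).symm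
  rw [hsum, InducedIwasawaModule.tmul_sum]
  refine Finset.sum_eq_zero fun j _ => ?_
  rw [InducedIwasawaModule.tmul_mul, character_diracSub, zero_mul,
    InducedIwasawaModule.tmul_zero_right]

lemma tmul_eq_zero_of_toDual [ProperSpace K] (a : CompletedGroupRing K (GLTwo p))
    (h : ∀ f : Ind χ, (toDual χ (InducedIwasawaModule.tmul χ⁻¹ a 1)).form f = 0) :
    InducedIwasawaModule.tmul χ⁻¹ a 1 = 0 := by
  obtain ⟨k, μ, rfl⟩ := exists_eq_tmul a
  rcases eq_or_ne k 0 with rfl | hk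
  · rw [TensorProduct.zero_tmul]
    exact InducedIwasawaModule.tmul_zero_left _ _
  refine tmul_eq_zero_of_vanishing χ k μ fun f => ?_
  have h := (toDual_tmul_form χ (k ⊗ₜ μ) 1 f).symm.trans (h f)
  rw [integralK_tmul, one_mul] at h
  exact (mul_eq_zero.1 h).resolve_left hk

lemma toDual_injective [ProperSpace K] : Function.Injective (toDual χ) := by
  refine (injective_iff_map_eq_zero (toDual χ)).2 fun x hx => ?_
  obtain ⟨a, rfl⟩ := InducedIwasawaModule.exists_tmul_one χ⁻¹ x
  exact tmul_eq_zero_of_toDual χ a fun f => congrArg (fun ℓ => ℓ.form f) hx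

/-- The isomorphism `M_{χ⁻¹} ≅ Ind_P^G(χ)'`. -/
def dualEquiv [ProperSpace K] : InducedIwasawaModule χ⁻¹ ≃ₗ[CompletedGroupRing K (GLTwo p)]
    (principalSeries χ).Dual :=
  LinearEquiv.ofBijective (toDual χ) ⟨toDual_injective χ, toDual_surjective χ⟩

end DualIso

end IwasawaRep
end

noncomputable section

namespace IwasawaRep

/-! ### Admissibility -/

section Uniformizer

variable (K : Type*) [NontriviallyNormedField K] [IsUltrametricDist K] [ProperSpace K]

/-- The open unit ball is also closed, hence compact, and the norm attains a maximum on it. -/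
lemma exists_uniformizer :
    ∃ π : K, π ≠ 0 ∧ ‖π‖ < 1 ∧ ∀ x : K, ‖x‖ < 1 → ‖x‖ ≤ ‖π‖ := by
  have hc : IsCompact (Metric.ball (0 : K) 1) :=
    (isCompact_closedBall 0 1).of_isClosed_subset (IsUltrametricDist.isClosed_ball 0 1)
      Metric.ball_subset_closedBall
  obtain ⟨π, hπ, hmax⟩ := hc.exists_isMaxOn ⟨0, Metric.mem_ball_self one_pos⟩
    continuous_norm.continuousOn
  have hmax' : ∀ x : K, ‖x‖ < 1 → ‖x‖ ≤ ‖π‖ := fun x hx => hmax (mem_ball_zero_iff.2 hx)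
  refine ⟨π, ?_, mem_ball_zero_iff.1 hπ, hmax'⟩
  obtain ⟨x, hx0, hx1⟩ := NormedField.exists_norm_lt_one K
  exact norm_pos_iff.1 (hx0.trans_le (hmax' x hx1))

end Uniformizer

section Cofinite

variable {K : Type*} [NontriviallyNormedField K] [IsUltrametricDist K]

variable (K) in
/-- The `o`-module `K/o`. -/
abbrev DivisibleQuotient : Type _ := K ⧸ LinearMap.range (Algebra.linearMap (IntegerRing K) K)

lemma mk_eq_zero_iff (x : K) : (Submodule.Quotient.mk x : DivisibleQuotient K) = 0 ↔ ‖x‖ ≤ 1 := by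
  rw [Submodule.Quotient.mk_eq_zero]
  exact ⟨fun ⟨y, hy⟩ => hy ▸ y.2, fun hx => ⟨⟨x, hx⟩, rfl⟩⟩

lemma mk_eq_mk_iff (x y : K) : (Submodule.Quotient.mk x : DivisibleQuotient K) =
    Submodule.Quotient.mk y ↔ ‖x - y‖ ≤ 1 := by
  rw [← sub_eq_zero, ← Submodule.Quotient.mk_sub, mk_eq_zero_iff]

lemma smul_mk (c : IntegerRing K) (x : K) :
    c • (Submodule.Quotient.mk x : DivisibleQuotient K) = Submodule.Quotient.mk ((c : K) * x) := rfl

variable [ProperSpace K]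

/-- Take the least `n` such that `I` has an element of norm at least `‖π‖ⁿ`. A strictly larger norm
in `I` would be larger by a factor of at least `‖π‖⁻¹`, contradicting minimality. -/
lemma exists_generator (I : Ideal (IntegerRing K)) (hI : I ≠ ⊥) :
    ∃ x ∈ I, (x : K) ≠ 0 ∧ ∀ y ∈ I, ‖(y : K)‖ ≤ ‖(x : K)‖ := by
  obtain ⟨π, hπ0, hπ1, hπ⟩ := exists_uniformizer K
  have hπ0' : 0 < ‖π‖ := norm_pos_iff.2 hπ0
  obtain ⟨z, hz, hz0⟩ := Submodule.exists_mem_ne_zero_of_ne_bot hI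
  have hz0' : 0 < ‖(z : K)‖ := norm_pos_iff.2 fun h => hz0 (Subtype.ext h)
  have hex : ∃ n : ℕ, ∃ x ∈ I, ‖π‖ ^ n ≤ ‖(x : K)‖ := by
    obtain ⟨n, hn⟩ := exists_pow_lt_of_lt_one hz0' hπ1
    exact ⟨n, z, hz, hn.le⟩
  classical
  obtain ⟨x, hx, hxn⟩ := Nat.find_spec hex
  have hx0 : 0 < ‖(x : K)‖ := (pow_pos hπ0' _).trans_le hxn
  refine ⟨x, hx, norm_pos_iff.1 hx0, fun y hy => ?_⟩
  by_contra! hlt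
  have hy0 : 0 < ‖(y : K)‖ := hx0.trans hlt
  have h1 : ‖(x : K)‖ ≤ ‖π‖ * ‖(y : K)‖ := by
    have := hπ (x / y) (by rwa [norm_div, div_lt_one hy0])
    rwa [norm_div, div_le_iff₀ hy0] at this
  rcases Nat.eq_zero_or_pos (Nat.find hex) with h0 | h0
  · rw [h0, pow_zero] at hxn
    have hy1 : ‖(y : K)‖ ≤ 1 := y.2
    linarith
  · refine Nat.find_min hex (Nat.sub_lt h0 one_pos) ⟨y, hy, ?_⟩
    refine le_of_mul_le_mul_left ?_ hπ0'
    rw [← pow_succ', Nat.sub_add_cancel (show 1 ≤ Nat.find hex from h0)]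
    exact hxn.trans h1

-- Baer's criterion: an element `x` of maximal norm generates the ideal, and a map on it extends by
-- dividing a lift of its value at `x` by `x`.
variable (K) in
lemma baer_divisibleQuotient : Module.Baer (IntegerRing K) (DivisibleQuotient K) := by
  intro I g
  rcases eq_or_ne I ⊥ with rfl | hI
  · refine ⟨0, fun x hx => ?_⟩
    obtain rfl : x = 0 := by simpa using hx
    exact (map_zero g).symm
  obtain ⟨x, hx, hx0, hmax⟩ := exists_generator I hI
  obtain ⟨z, hz⟩ := Submodule.Quotient.mk_surjective _ (g ⟨x, hx⟩)
  refine ⟨LinearMap.toSpanSingleton _ _ (Submodule.Quotient.mk (z / x)), fun y hy => ?_⟩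
  have hr : ‖(y : K) / x‖ ≤ 1 := by
    rw [norm_div, div_le_one (norm_pos_iff.2 hx0)]
    exact hmax y hy
  have hy' : (⟨y, hy⟩ : I) = (⟨(y : K) / x, hr⟩ : IntegerRing K) • ⟨x, hx⟩ :=
    Subtype.ext (Subtype.ext (div_mul_cancel₀ (y : K) hx0).symm)
  rw [hy', map_smul, ← hz, LinearMap.toSpanSingleton_apply, smul_mk, smul_mk]
  congr 1
  change (y : K) * (z / x) = y / x * z
  ring

/-- The value at the class of `π⁻ⁿ` determines the multiplier modulo `πⁿ`. The possible multipliers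
form nested compact balls, and a common point gives `c`. -/
lemma exists_eq_smul_id (φ : DivisibleQuotient K →ₗ[IntegerRing K] DivisibleQuotient K) :
    ∃ c : IntegerRing K, ∀ x, φ x = c • x := by
  obtain ⟨π, hπ0, hπ1, -⟩ := exists_uniformizer K
  have hπ0' : 0 < ‖π‖ := norm_pos_iff.2 hπ0
  let C (n : ℕ) : Set K := {c | φ (Submodule.Quotient.mk ((π ^ n)⁻¹)) =
    Submodule.Quotient.mk (c * (π ^ n)⁻¹)}
  have hC (n : ℕ) : ∃ z : K, C n = Metric.closedBall z (‖π‖ ^ n) := by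
    obtain ⟨z, hz⟩ := Submodule.Quotient.mk_surjective _ (φ (Submodule.Quotient.mk ((π ^ n)⁻¹)))
    refine ⟨z * π ^ n, Set.ext fun c => ?_⟩
    change φ _ = _ ↔ _
    rw [← hz, eq_comm, mk_eq_mk_iff, mem_closedBall_iff_norm,
      ← mul_le_mul_iff_left₀ (pow_pos hπ0' n), one_mul, ← norm_pow, ← norm_mul, sub_mul,
      inv_mul_cancel_right₀ (pow_ne_zero n hπ0)]
  have hanti (n : ℕ) : C (n + 1) ⊆ C n := fun c hc => by
    have h := congrArg ((⟨π, hπ1.le⟩ : IntegerRing K) • ·) hc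
    simp only [← map_smul, smul_mk] at h
    have e : π * (π ^ (n + 1))⁻¹ = (π ^ n)⁻¹ := by
      rw [pow_succ']; field_simp
    rw [mul_left_comm, e] at h
    exact h
  obtain ⟨c, hc⟩ := IsCompact.nonempty_iInter_of_sequence_nonempty_isCompact_isClosed C hanti
    (fun n => by
      obtain ⟨z, hz⟩ := hC n
      exact hz ▸ ⟨z, Metric.mem_closedBall_self (by positivity)⟩)
    (by obtain ⟨z, hz⟩ := hC 0; exact hz ▸ isCompact_closedBall _ _)
    (fun n => by obtain ⟨z, hz⟩ := hC n; exact hz ▸ Metric.isClosed_closedBall)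
  rw [Set.mem_iInter] at hc
  have hc1 : ‖c‖ ≤ 1 := by
    have h : φ (Submodule.Quotient.mk ((π ^ 0)⁻¹)) = Submodule.Quotient.mk (c * (π ^ 0)⁻¹) := hc 0
    rw [pow_zero, inv_one, mul_one, (mk_eq_zero_iff 1).2 norm_one.le, map_zero, eq_comm,
      mk_eq_zero_iff] at h
    exact h
  refine ⟨⟨c, hc1⟩, fun x => ?_⟩
  obtain ⟨x, rfl⟩ := Submodule.Quotient.mk_surjective _ x
  obtain ⟨n, hn⟩ : ∃ n : ℕ, ‖x * π ^ n‖ ≤ 1 := by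
    have : Tendsto (fun n : ℕ => ‖x * π ^ n‖) atTop (𝓝 0) := by
      have := ((tendsto_pow_atTop_nhds_zero_of_norm_lt_one hπ1).const_mul x).norm
      rwa [mul_zero, norm_zero] at this
    exact (this.eventually (ge_mem_nhds one_pos)).exists
  have hx : (Submodule.Quotient.mk x : DivisibleQuotient K) =
      (⟨x * π ^ n, hn⟩ : IntegerRing K) • Submodule.Quotient.mk ((π ^ n)⁻¹) := by
    rw [smul_mk, mul_inv_cancel_right₀ (pow_ne_zero n hπ0)]
  rw [hx, map_smul, show φ _ = _ from hc n, smul_mk, smul_mk, smul_mk]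
  congr 1
  change x * π ^ n * (c * (π ^ n)⁻¹) = c * (x * π ^ n * (π ^ n)⁻¹)
  ring

/-- By injectivity of `K/o` every form on `N` extends to `(K/o)^ι`, where it is given by one
multiplier in `o` per coordinate. So the dual is a quotient of `o^ι`. -/
lemma isOfCofiniteType_of_injective {N : Type*} [AddCommGroup N] [Module (IntegerRing K) N]
    {ι : Type*} [Finite ι] (j : N →ₗ[IntegerRing K] (ι → DivisibleQuotient K))
    (hj : Function.Injective j) : IsOfCofiniteType K N := by
  have := Fintype.ofFinite ι
  classical
  let Θ : (ι → IntegerRing K) →ₗ[IntegerRing K] (N →ₗ[IntegerRing K] DivisibleQuotient K) :=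
    Fintype.linearCombination (IntegerRing K) fun i => (LinearMap.proj i).comp j
  refine Module.Finite.of_surjective Θ fun ψ => ?_
  obtain ⟨φ, hφ⟩ := (baer_divisibleQuotient K).extension_property j hj ψ
  choose c hc using fun i : ι => exists_eq_smul_id
    (φ.comp (LinearMap.single (IntegerRing K) (fun _ : ι => DivisibleQuotient K) i))
  refine ⟨c, ?_⟩
  rw [← hφ]
  ext n
  have h : φ (j n) = ∑ i, φ (Pi.single i (j n i)) := by
    rw [← map_sum, Finset.univ_sum_single]
  rw [LinearMap.comp_apply, h, Fintype.linearCombination_apply, LinearMap.sum_apply]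
  exact Finset.sum_congr rfl fun i _ => (hc i (j n i)).symm

end Cofinite

section Admissible

variable {p : ℕ} [Fact p.Prime] {K : Type*} [NontriviallyNormedField K] [IsUltrametricDist K]
  [CompleteSpace K] (χ : torus p →ₜ* (IntegerRing K)ˣ)

/-- The functions in `Ind_P^G(χ)` with values in `o`. -/
def unitBall : Submodule (IntegerRing K) (Ind χ) where
  carrier := {f | ∀ g, ‖f.1 g‖ ≤ 1}
  zero_mem' g := by simp
  add_mem' hf hf' g := (IsUltrametricDist.norm_add_le_max _ _).trans (max_le (hf g) (hf' g))
  smul_mem' c f hf g := by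
    change ‖(c : K) * f.1 g‖ ≤ 1
    rw [norm_mul]
    exact mul_le_one₀ c.2 (norm_nonneg _) (hf g)

lemma mem_unitBall {f : Ind χ} : f ∈ unitBall χ ↔ ‖f‖ ≤ 1 :=
  (ContinuousMap.norm_le f.1 zero_le_one).symm

/-- The values modulo `o` of an element of `Ind_P^G(χ)/L` at representatives of `G/H`. -/
def valuesModulo (H : Subgroup (GLTwo p)) :
    (Ind χ ⧸ unitBall χ) →ₗ[IntegerRing K] (GLTwo p ⧸ H → DivisibleQuotient K) :=
  (unitBall χ).liftQ
    { toFun := fun f x => Submodule.Quotient.mk (f.1 x.out)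
      map_add' := fun _ _ => rfl
      map_smul' := fun _ _ => rfl }
    fun _ hf => funext fun x => (mk_eq_zero_iff _).2 (hf x.out)

/-- As `H` is normal, `g` and the representative of `gH` also differ by an element of `H` on the
left. A function fixed by `H` modulo `L` therefore changes by at most one between them. -/
lemma valuesModulo_injective (H : OpenNormalSubgroup (GLTwo p)) :
    Function.Injective ((valuesModulo χ H.toSubgroup).comp
      ((principalSeries χ).quotientInvariants (unitBall χ) H.toSubgroup).subtype) := by
  refine (injective_iff_map_eq_zero _).2 ?_
  rintro ⟨_, f, hf, rfl⟩ h0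
  refine Subtype.ext ((Submodule.Quotient.mk_eq_zero _).2 fun g => ?_)
  have h1 : ‖f.1 (g : GLTwo p ⧸ H.toSubgroup).out‖ ≤ 1 :=
    (mk_eq_zero_iff _).1 (congrFun h0 (g : GLTwo p ⧸ H.toSubgroup))
  set y := (g : GLTwo p ⧸ H.toSubgroup).out with hy
  have hyg : y⁻¹ * g ∈ H.toSubgroup := QuotientGroup.eq.1 (QuotientGroup.out_eq' _)
  have hmem : g * y⁻¹ ∈ H.toSubgroup := by
    have := H.isNormal'.conj_mem _ hyg y
    simpa [mul_assoc] using this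
  have h2 : ‖f.1 ((g * y⁻¹)⁻¹ * g) - f.1 g‖ ≤ 1 := hf _ hmem g
  rw [mul_inv_rev, inv_inv, inv_mul_cancel_right] at h2
  have h3 : f.1 g = f.1 y - (f.1 y - f.1 g) := (sub_sub_cancel _ _).symm
  rw [h3]
  exact (norm_sub_le_max' _ _).trans (max_le h1 h2)

theorem isAdmissible_principalSeries [ProperSpace K] : (principalSeries χ).IsAdmissible := by
  refine ⟨unitBall χ, fun g f hf h => hf (g⁻¹ * h), ?_, ?_, fun H => ?_⟩
  · exact (Metric.isBounded_closedBall (x := (0 : Ind χ)) (r := 1)).subset fun f hf =>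
      mem_closedBall_zero_iff.2 ((mem_unitBall χ).1 hf)
  · rw [Metric.isOpen_iff]
    refine fun f hf => ⟨1, one_pos, fun f' hf' => ?_⟩
    have : f' - f ∈ unitBall χ := (mem_unitBall χ).2 (mem_ball_iff_norm.1 hf').le
    simpa using (unitBall χ).add_mem this hf
  · have := finite_quotient H
    exact isOfCofiniteType_of_injective _ (valuesModulo_injective χ H)

end Admissible

end IwasawaRep
end

noncomputable section

namespace IwasawaRep

open fwdDiff

/-! ### Mahler coefficients -/

section Mahler

variable {p : ℕ} [Fact p.Prime] {K : Type*} [NontriviallyNormedField K] [IsUltrametricDist K]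
  [NormedAlgebra ℚ_[p] K]

/-- The `k`-th Mahler coefficient of a continuous function on `ℤ_p`. -/
def mahlerCoeff (k : ℕ) : C(ℤ_[p], K) →ₗ[K] K where
  toFun h := Δ_[1] ^[k] h 0
  map_add' h h' := by rw [ContinuousMap.coe_add, fwdDiff_iter_add]; rfl
  map_smul' c h := by rw [ContinuousMap.coe_smul, fwdDiff_iter_const_smul]; rfl

lemma mahlerCoeff_apply (k : ℕ) (h : C(ℤ_[p], K)) : mahlerCoeff k h = Δ_[1] ^[k] h 0 := rfl

lemma norm_mahlerCoeff_le (k : ℕ) (h : C(ℤ_[p], K)) : ‖mahlerCoeff k h‖ ≤ ‖h‖ :=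
  IsUltrametricDist.norm_fwdDiff_iter_apply_le 1 h 0 k

lemma mahlerCoeff_fwdDiff {h h' : C(ℤ_[p], K)} (hh : ∀ x, h' x = h (x + 1) - h x) (k : ℕ) :
    mahlerCoeff k h' = mahlerCoeff (k + 1) h := by
  have : (h' : ℤ_[p] → K) = Δ_[1] h := funext hh
  rw [mahlerCoeff_apply, this]
  rfl

variable (p K) in
/-- `K` as a module over `ℤ_p`. -/
abbrev padicIntModule : Module ℤ_[p] K := Module.compHom K (algebraMap ℤ_[p] ℚ_[p])

variable (p K) in
lemma isBoundedSMul_padicInt : letI := padicIntModule p K; IsBoundedSMul ℤ_[p] K :=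
  letI := padicIntModule p K
  IsBoundedSMul.of_norm_smul_le fun r x => norm_smul_le (r : ℚ_[p]) x

lemma tendsto_mahlerCoeff (h : C(ℤ_[p], K)) : Tendsto (mahlerCoeff · h) atTop (𝓝 0) :=
  let := padicIntModule p K
  have := isBoundedSMul_padicInt p K
  PadicInt.fwdDiff_tendsto_zero h

variable [CompleteSpace K]

lemma norm_le_of_mahlerCoeff_le {h : C(ℤ_[p], K)} {r : ℝ}
    (hr : ∀ k, ‖mahlerCoeff k h‖ ≤ r) : ‖h‖ ≤ r := by
  let := padicIntModule p K
  have := isBoundedSMul_padicInt p K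
  rw [← (PadicInt.hasSum_mahler h).tsum_eq]
  refine IsUltrametricDist.norm_tsum_le_of_forall_le fun k => ?_
  rw [PadicInt.norm_mahlerTerm]
  exact hr k

/-- The difference operator lowers the index of binomial functions by one, so a primitive is
obtained by shifting the Mahler coefficients up. -/
lemma exists_fwdDiff_eq (h : C(ℤ_[p], K)) : ∃ h' : C(ℤ_[p], K), ∀ x, h x = h' (x + 1) - h' x := by
  let := padicIntModule p K
  have := isBoundedSMul_padicInt p K
  let b (n : ℕ) : K := Nat.casesOn n 0 fun k => mahlerCoeff k h
  have hb : Tendsto b atTop (𝓝 0) := (tendsto_add_atTop_iff_nat 1).1 (tendsto_mahlerCoeff h)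
  let h' : C(ℤ_[p], K) := PadicInt.mahlerSeries b
  let d : C(ℤ_[p], K) := h'.comp ⟨fun x => x + 1, by fun_prop⟩ - h'
  refine ⟨h', fun x => ?_⟩
  have hd : ‖h - d‖ ≤ 0 := norm_le_of_mahlerCoeff_le fun k => by
    rw [map_sub, mahlerCoeff_fwdDiff (h' := d) (h := h') (fun _ => rfl), mahlerCoeff_apply (k + 1),
      PadicInt.fwdDiff_mahlerSeries hb, sub_self, norm_zero]
  have := congrArg (fun f : C(ℤ_[p], K) => f x) (sub_eq_zero.1 (norm_le_zero_iff.1 hd))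
  exact this

end Mahler

/-! ### Subspaces stable under differences -/

section Reduction

variable {p : ℕ} [Fact p.Prime] {K : Type*} [NontriviallyNormedField K] [IsUltrametricDist K]
  [NormedAlgebra ℚ_[p] K] [ProperSpace K]
  {E : Type*} [NormedAddCommGroup E] [NormedSpace K E]

lemma norm_sub_le_max_norm {F : Type*} [SeminormedAddCommGroup F] [IsUltrametricDist F] (x y : F) :
    ‖x - y‖ ≤ max ‖x‖ ‖y‖ := by
  rw [sub_eq_add_neg, ← norm_neg y]
  exact IsUltrametricDist.norm_add_le_max _ _

/-- Let `m ≥ n` be the last index at which a suitable `w` has a coefficient of norm at least one. It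
exists because the coefficients tend to zero, and `m - n` applications of `D` move it to index `n`.
-/
lemma exists_leading_mahlerCoeff {q : E → C(ℤ_[p], K)} (hq : ∀ w, ‖q w‖ ≤ ‖w‖)
    {D : E → E} (hD : ∀ w, ‖D w‖ ≤ ‖w‖) (hqD : ∀ w x, q (D w) x = q w (x + 1) - q w x)
    (h : ∀ d, ∃ w, ‖w‖ ≤ 1 ∧ ∃ k ≥ d, 1 ≤ ‖mahlerCoeff k (q w)‖) (n : ℕ) :
    ∃ w, ‖w‖ ≤ 1 ∧ ‖mahlerCoeff n (q w)‖ = 1 ∧ ∀ k > n, ‖mahlerCoeff k (q w)‖ < 1 := by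
  obtain ⟨w, hw, k, hk, hk1⟩ := h n
  obtain ⟨N, hN⟩ := eventually_atTop.1
    ((tendsto_mahlerCoeff (q w)).norm.eventually (gt_mem_nhds (by simp : ‖(0 : K)‖ < 1)))
  classical
  let P (k : ℕ) : Prop := 1 ≤ ‖mahlerCoeff k (q w)‖
  have hkN : k ≤ N := by
    by_contra! hlt
    exact (hN k hlt.le).not_ge hk1
  set m := Nat.findGreatest P N with hm
  have hPm : P m := Nat.findGreatest_spec hkN hk1
  have hkm : k ≤ m := Nat.le_findGreatest hkN hk1
  have hmax (j : ℕ) (hj : m < j) : ‖mahlerCoeff j (q w)‖ < 1 := by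
    rcases le_or_gt j N with h | h
    · exact not_le.1 (Nat.findGreatest_is_greatest hj h)
    · exact hN j h.le
  have hiter (i : ℕ) : ‖D^[i] w‖ ≤ 1 ∧ ∀ j, mahlerCoeff j (q (D^[i] w)) =
      mahlerCoeff (j + i) (q w) := by
    induction i with
    | zero => exact ⟨hw, fun _ => rfl⟩
    | succ i ih =>
      rw [Function.iterate_succ_apply']
      refine ⟨(hD _).trans ih.1, fun j => ?_⟩
      rw [mahlerCoeff_fwdDiff (hqD _), ih.2, add_right_comm, add_assoc]
  obtain ⟨h1, h2⟩ := hiter (m - n)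
  refine ⟨_, h1, ?_, fun j hj => ?_⟩
  · refine le_antisymm ((norm_mahlerCoeff_le _ _).trans ((hq _).trans h1)) ?_
    rw [h2, Nat.add_sub_cancel' (hk.trans hkm)]
    exact hPm
  · rw [h2]
    exact hmax _ (by omega)

/-- The reduction of `f` has finite degree. Subtract a multiple of the element with leading index
`N` to kill the top coefficient, and descend on the degree. -/
lemma exists_norm_sub_le_of_leading [IsUltrametricDist E] {q : E →ₗ[K] C(ℤ_[p], K)} {r : ℝ}
    (hr : ∀ x : K, ‖x‖ < 1 → ‖x‖ ≤ r) (hq : ∀ w, ‖q w‖ ≤ ‖w‖)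
    (h : ∀ n, ∃ w, ‖w‖ ≤ 1 ∧ ‖mahlerCoeff n (q w)‖ = 1 ∧ ∀ k > n, ‖mahlerCoeff k (q w)‖ < 1)
    (f : C(ℤ_[p], K)) (hf : ‖f‖ ≤ 1) : ∃ w, ‖w‖ ≤ 1 ∧ ‖f - q w‖ ≤ r := by
  have key (N : ℕ) (f : C(ℤ_[p], K)) (hf : ‖f‖ ≤ 1) (hN : ∀ k ≥ N, ‖mahlerCoeff k f‖ < 1) :
      ∃ w, ‖w‖ ≤ 1 ∧ ‖f - q w‖ ≤ r := by
    induction N generalizing f with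
    | zero =>
      refine ⟨0, by simp, norm_le_of_mahlerCoeff_le fun k => hr _ ?_⟩
      simpa using hN k (Nat.zero_le k)
    | succ N ih =>
      obtain ⟨w, hw, hwN, hwk⟩ := h N
      set c := mahlerCoeff N f / mahlerCoeff N (q w) with hc
      have hcw0 : mahlerCoeff N (q w) ≠ 0 := norm_pos_iff.1 (hwN ▸ one_pos)
      have hc1 : ‖c‖ ≤ 1 := by
        rw [hc, norm_div, hwN, div_one]
        exact (norm_mahlerCoeff_le _ _).trans hf
      have hcw : ‖c • w‖ ≤ 1 := by
        rw [norm_smul]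
        exact mul_le_one₀ hc1 (norm_nonneg _) hw
      obtain ⟨w', hw', hw''⟩ := ih (f - q (c • w))
        ((norm_sub_le_max_norm _ _).trans (max_le hf ((hq _).trans hcw)))
        (fun k hk => by
          rw [map_sub, map_smul, map_smul, smul_eq_mul]
          rcases hk.eq_or_lt with rfl | hk
          · rw [hc, div_mul_cancel₀ _ hcw0, sub_self, norm_zero]
            exact one_pos
          · refine (norm_sub_le_max_norm _ _).trans_lt (max_lt (hN k hk) ?_)
            rw [norm_mul]
            exact mul_lt_one_of_nonneg_of_lt_one_right hc1 (norm_nonneg _) (hwk k hk))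
      refine ⟨w' + c • w, (IsUltrametricDist.norm_add_le_max _ _).trans (max_le hw' hcw), ?_⟩
      rwa [map_add, add_comm, ← sub_sub]
  obtain ⟨N, hN⟩ := eventually_atTop.1
    ((tendsto_mahlerCoeff f).norm.eventually (gt_mem_nhds (by simp : ‖(0 : K)‖ < 1)))
  exact key N f hf hN

/-- Successive approximation: the error, divided by `π`, is again in the unit ball, and the
corrections sum to a convergent series in powers of `π`. -/
lemma surjective_of_exists_norm_sub_le {F : Type*} [NormedAddCommGroup F] [NormedSpace K F]
    [CompleteSpace E] {q : E →ₗ[K] F} (hq : ∀ w, ‖q w‖ ≤ ‖w‖) {π : K} (hπ0 : π ≠ 0)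
    (hπ1 : ‖π‖ < 1) (h : ∀ f : F, ‖f‖ ≤ 1 → ∃ w, ‖w‖ ≤ 1 ∧ ‖f - q w‖ ≤ ‖π‖) :
    Function.Surjective q := by
  have hball (f : F) (hf : ‖f‖ ≤ 1) : ∃ w, q w = f := by
    choose! a ha ha' using h
    let g (n : ℕ) : F := (fun f => π⁻¹ • (f - q (a f)))^[n] f
    have hg (n : ℕ) : ‖g n‖ ≤ 1 := by
      induction n with
      | zero => exact hf
      | succ n ih =>
        change ‖(fun f => π⁻¹ • (f - q (a f)))^[n + 1] f‖ ≤ 1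
        rw [Function.iterate_succ_apply', norm_smul, norm_inv,
          inv_mul_le_iff₀ (norm_pos_iff.2 hπ0), mul_one]
        exact ha' _ ih
    have hgs (n : ℕ) : π • g (n + 1) = g n - q (a (g n)) := by
      change π • (fun f => π⁻¹ • (f - q (a f)))^[n + 1] f = _
      rw [Function.iterate_succ_apply', smul_inv_smul₀ hπ0]
    have hsum (n : ℕ) : q (∑ i ∈ Finset.range n, π ^ i • a (g i)) = f - π ^ n • g n := by
      induction n with
      | zero =>
        rw [Finset.sum_range_zero, map_zero, pow_zero, one_smul]
        exact (sub_self f).symm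
      | succ n ih =>
        rw [Finset.sum_range_succ, map_add, ih, map_smul, pow_succ, mul_smul, hgs, smul_sub]
        abel
    have hs : Summable fun i => π ^ i • a (g i) := by
      refine Summable.of_norm_bounded (summable_geometric_of_lt_one (norm_nonneg π) hπ1) fun i => ?_
      rw [norm_smul, norm_pow]
      exact mul_le_of_le_one_right (by positivity) (ha _ (hg i))
    have hqc : Continuous q := AddMonoidHomClass.continuous_of_bound q 1 fun w => by
      rw [one_mul]; exact hq w
    refine ⟨_, tendsto_nhds_unique ((hqc.tendsto _).comp hs.hasSum.tendsto_sum_nat) ?_⟩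
    have h0 : Tendsto (fun n => π ^ n • g n) atTop (𝓝 0) := by
      refine squeeze_zero_norm (fun n => ?_) (tendsto_pow_atTop_nhds_zero_of_lt_one
        (norm_nonneg π) hπ1)
      rw [norm_smul, norm_pow]
      exact mul_le_of_le_one_right (by positivity) (hg n)
    have := (tendsto_const_nhds (x := f)).sub h0
    rw [sub_zero] at this
    exact this.congr fun n => (hsum n).symm
  intro f
  obtain ⟨k, hk⟩ := NormedField.exists_lt_norm K ‖f‖
  have hk0 : k ≠ 0 := norm_pos_iff.1 ((norm_nonneg f).trans_lt hk)
  obtain ⟨w, hw⟩ := hball (k⁻¹ • f) (by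
    rw [norm_smul, norm_inv, inv_mul_le_iff₀ (norm_pos_iff.2 hk0), mul_one]
    exact hk.le)
  exact ⟨k • w, by rw [map_smul, hw, smul_inv_smul₀ hk0]⟩

/-- A family of functions on `ℤ_p` which is stable under differences either exhausts all continuous
functions, or its reduction consists of polynomial functions of bounded degree. -/
theorem surjective_or_mahlerCoeff_lt_one [IsUltrametricDist E] [CompleteSpace E]
    {q : E →ₗ[K] C(ℤ_[p], K)} (hq : ∀ w, ‖q w‖ ≤ ‖w‖) {D : E → E} (hD : ∀ w, ‖D w‖ ≤ ‖w‖)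
    (hqD : ∀ w x, q (D w) x = q w (x + 1) - q w x) :
    Function.Surjective q ∨ ∃ d, ∀ w, ‖w‖ ≤ 1 → ∀ k ≥ d, ‖mahlerCoeff k (q w)‖ < 1 := by
  rw [or_iff_not_imp_right]
  intro h
  push Not at h
  obtain ⟨π, hπ0, hπ1, hπ⟩ := exists_uniformizer K
  exact surjective_of_exists_norm_sub_le hq hπ0 hπ1
    (exists_norm_sub_le_of_leading hπ hq
      (exists_leading_mahlerCoeff hq hD hqD h))

/-- The version of `surjective_or_mahlerCoeff_lt_one` for a closed subspace. -/
lemma surjective_or_mahlerCoeff_lt_one_of_isClosed [IsUltrametricDist E] [CompleteSpace E]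
    {q : E →ₗ[K] C(ℤ_[p], K)} (hq : ∀ w, ‖q w‖ ≤ ‖w‖) {D : E → E} (hD : ∀ w, ‖D w‖ ≤ ‖w‖)
    (hqD : ∀ w x, q (D w) x = q w (x + 1) - q w x) {V : Submodule K E}
    (hVc : IsClosed (V : Set E)) (hV : ∀ w ∈ V, D w ∈ V) :
    Function.Surjective (q.comp V.subtype) ∨
      ∃ d, ∀ w ∈ V, ‖w‖ ≤ 1 → ∀ k ≥ d, ‖mahlerCoeff k (q w)‖ < 1 := by
  have : CompleteSpace V := hVc.completeSpace_coe
  exact (surjective_or_mahlerCoeff_lt_one (q := q.comp V.subtype) (fun w => hq w)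
    (D := fun w => ⟨D w, hV w w.2⟩) (fun w => hD w) (fun w => hqD w)).imp_right
    fun ⟨d, hd⟩ => ⟨d, fun w hw => hd ⟨w, hw⟩⟩

/-- The first `d` Mahler coefficients in all charts determine `w`. If they vanish, scale `w` to norm
one: all coefficients then have norm at most `‖π‖ < 1`, which contradicts `hnorm`. -/
lemma finiteDimensional_of_mahlerCoeff_lt_one {ι : Type*} [Finite ι] {q : ι → E →ₗ[K] C(ℤ_[p], K)}
    {d : ℕ} (hb : ∀ i w, ‖w‖ ≤ 1 → ∀ k ≥ d, ‖mahlerCoeff k (q i w)‖ < 1)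
    (hnorm : ∀ w, (∀ i, ‖q i w‖ < 1) → ‖w‖ < 1) (hscale : ∀ w : E, w ≠ 0 → ∃ c : K, ‖c • w‖ = 1) :
    FiniteDimensional K E := by
  let Φ : E →ₗ[K] (ι × Fin d → K) := LinearMap.pi fun j => (mahlerCoeff j.2).comp (q j.1)
  refine FiniteDimensional.of_injective Φ ((injective_iff_map_eq_zero Φ).2 fun w hw => ?_)
  by_contra hw0
  obtain ⟨c, hc⟩ := hscale w hw0
  obtain ⟨π, hπ0, hπ1, hπ⟩ := exists_uniformizer K
  refine (hnorm (c • w) fun i => ?_).ne hc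
  refine (norm_le_of_mahlerCoeff_le fun k => ?_).trans_lt hπ1
  rcases lt_or_ge k d with hk | hk
  · have h0 : mahlerCoeff k (q i w) = 0 := congrFun hw (i, ⟨k, hk⟩)
    rw [map_smul, map_smul, h0, smul_zero, norm_zero]
    exact norm_nonneg _
  · exact hπ _ (hb i _ hc.le k hk)

end Reduction

/-! ### Endomorphisms conjugate to a power of themselves -/

section PowerConjugate

open Polynomial

variable {K M : Type*} [Field K] [AddCommGroup M] [Module K M]

lemma aeval_comp_eq {A S B : Module.End K M} (h : A * S = S * B) (f : K[X]) :
    aeval A f * S = S * aeval B f := by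
  induction f using Polynomial.induction_on' with
  | add f g hf hg => rw [map_add, map_add, add_mul, mul_add, hf, hg]
  | monomial n c =>
    have hn : A ^ n * S = S * B ^ n := by
      induction n with
      | zero => simp
      | succ n ih => rw [pow_succ, mul_assoc, h, ← mul_assoc, ih, mul_assoc, ← pow_succ]
    rw [aeval_monomial, aeval_monomial, mul_assoc, hn, ← mul_assoc, Algebra.commutes, mul_assoc]

/-- If an injective endomorphism `A` is conjugate to its power `A ^ a` with `a ≥ 2`, then some
power of `A` has a nonzero fixed vector. -/
theorem exists_pow_fixed [FiniteDimensional K M] [Nontrivial M] {A S : Module.End K M}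
    (hA : Function.Injective A) (hS : Function.Injective S) {a : ℕ} (ha : 2 ≤ a)
    (h : A * S = S * A ^ a) : ∃ N > 0, ∃ v ≠ 0, (A ^ N) v = v := by
  have hint : IsIntegral K A := Algebra.IsIntegral.isIntegral A
  set m := minpoly K A with hm
  have hm0 : m ≠ 0 := minpoly.ne_zero hint
  -- The injective `S` intertwines `A ^ a` with `A`, so `m` kills both. Hence `m` divides `m(X^a)`,
  -- and the roots of `m` are stable under `t ↦ t ^ a`.
  have hmA : aeval (A ^ a) m = 0 := by
    refine LinearMap.ext fun v => hS ?_
    have := congrArg (fun T : Module.End K M => T v) (aeval_comp_eq h m)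
    simp only [hm, minpoly.aeval, Module.End.mul_apply, LinearMap.zero_apply] at this
    rw [LinearMap.zero_apply, map_zero]
    exact this.symm
  have hdvd : m ∣ m.comp (X ^ a) := minpoly.dvd K A (by rw [aeval_comp, map_pow, aeval_X, hmA])
  let L := AlgebraicClosure K
  obtain ⟨t, ht⟩ : ∃ t : L, aeval t m = 0 :=
    IsAlgClosed.exists_aeval_eq_zero L m (minpoly.degree_pos hint).ne'
  have ht0 : t ≠ 0 := by
    rintro rfl
    refine LinearMap.minpoly_coeff_zero_of_injective hA ?_
    rw [← hm, ← (algebraMap K L).injective.eq_iff, map_zero, coeff_zero_eq_aeval_zero']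
    exact ht
  have hroots (i : ℕ) : aeval (t ^ a ^ i) m = 0 := by
    induction i with
    | zero => rwa [pow_zero, pow_one]
    | succ i ih =>
      obtain ⟨g, hg⟩ := hdvd
      have := congrArg (aeval (t ^ a ^ i)) hg
      rwa [map_mul, ih, zero_mul, aeval_comp, map_pow, aeval_X, ← pow_mul, ← pow_succ] at this
  -- There are finitely many roots, so two iterates agree and the nonzero root `t` is a root of
  -- unity.
  obtain ⟨i, j, hij, heq⟩ : ∃ i j : ℕ, i < j ∧ t ^ a ^ i = t ^ a ^ j := by
    have hmaps : Set.MapsTo (fun i : ℕ => t ^ a ^ i) Set.univ (m.rootSet L) := fun i _ =>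
      mem_rootSet.2 ⟨hm0, hroots i⟩
    obtain ⟨i, -, j, -, hij, heq⟩ :=
      Set.infinite_univ.exists_ne_map_eq_of_mapsTo hmaps (m.rootSet_finite L)
    rcases lt_or_gt_of_ne hij with h | h
    · exact ⟨i, j, h, heq⟩
    · exact ⟨j, i, h, heq.symm⟩
  have hlt : a ^ i < a ^ j := Nat.pow_lt_pow_right (by omega) hij
  refine ⟨a ^ j - a ^ i, Nat.sub_pos_of_lt hlt, ?_⟩
  set N := a ^ j - a ^ i with hN
  have htN : t ^ N = 1 := by
    refine mul_left_cancel₀ (pow_ne_zero (a ^ i) ht0) ?_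
    rw [← pow_add, hN, Nat.add_sub_cancel' hlt.le, mul_one, heq]
  set P := minpoly K t with hP
  have htint : IsIntegral K t := Algebra.IsIntegral.isIntegral t
  obtain ⟨m', hm'⟩ : P ∣ m := minpoly.dvd K t ht
  obtain ⟨g, hg⟩ : P ∣ X ^ N - 1 := minpoly.dvd K t (by simp [htN])
  -- The cofactor `m' = m / P` is too small to kill `A`. Its image is killed by `P(A)`, hence by `A
  -- ^ N - 1`, and so consists of fixed vectors of `A ^ N`.
  have hm'A : aeval A m' ≠ 0 := fun h0 => by
    have hm'0 : m' ≠ 0 := by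
      rintro rfl
      rw [mul_zero] at hm'
      exact hm0 hm'
    obtain ⟨e, he⟩ : m ∣ m' := minpoly.dvd K A h0
    refine minpoly.not_isUnit K t (IsUnit.of_mul_eq_one e (mul_right_cancel₀ hm'0 ?_))
    rw [one_mul, mul_right_comm, ← hP, ← hm', ← he]
  obtain ⟨v, hv⟩ : ∃ v, aeval A m' v ≠ 0 := by
    by_contra! h0
    exact hm'A (LinearMap.ext h0)
  refine ⟨_, hv, ?_⟩
  rw [← sub_eq_zero]
  have : aeval A (X ^ N - 1 : K[X]) (aeval A m' v) = 0 := by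
    rw [hg, mul_comm, map_mul, Module.End.mul_apply, ← Module.End.mul_apply (aeval A P), ← map_mul,
      ← hm', hm, minpoly.aeval, LinearMap.zero_apply, map_zero]
  simpa only [map_sub, map_pow, aeval_X, map_one, LinearMap.sub_apply, Module.End.one_apply]
    using this

end PowerConjugate

end IwasawaRep
end

noncomputable section

namespace IwasawaRep

/-! ### The action of `G` on functions on `ℤ_p` -/

section Charts

variable {p : ℕ} [Fact p.Prime] {K : Type*} [NontriviallyNormedField K] [IsUltrametricDist K]
  (χ : torus p →ₜ* (IntegerRing K)ˣ)

/-- The character `a ↦ χ(diag(a⁻¹, a))` of `ℤ_pˣ`. -/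
def antidiagonalCharacter : ℤ_[p]ˣ →* K where
  toFun a := ((χ (diagonalElement p a⁻¹ a) : IntegerRing K) : K)
  map_one' := by rw [inv_one, diagonalElement_one, map_one]; rfl
  map_mul' a b := by rw [mul_inv, diagonalElement_mul, map_mul]; rfl

lemma antidiagonalCharacter_apply (a : ℤ_[p]ˣ) :
    antidiagonalCharacter χ a = ((χ (diagonalElement p a⁻¹ a) : IntegerRing K) : K) := rfl

lemma continuous_antidiagonalCharacter : Continuous (antidiagonalCharacter χ) :=
  continuous_subtype_val.comp (Units.continuous_val.comp (χ.continuous_toFun.comp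
    (continuous_diagonalElement.comp (continuous_inv.prodMk continuous_id))))

lemma charP_lower (c : ℤ_[p]) : charP χ ⟨lower c, lower_mem c⟩ = 1 := by
  rw [charP, projectionToTorus_eq (a := 1) (d := 1) _ (by simp [lower_val]) (by simp [lower_val]),
    diagonalElement_one, map_one]
  rfl

lemma charP_diagonal (a d : ℤ_[p]ˣ) :
    charP χ ⟨diagonalElement p a d, diagonalElement_mem a d⟩ =
      ((χ (diagonalElement p a d) : IntegerRing K) : K) := by
  rw [charP, projectionToTorus_eq (a := a) (d := d) _ rfl rfl]

variable {χ}

lemma Ind.apply_mul_lower (f : Ind χ) (g : GLTwo p) (c : ℤ_[p]) :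
    f.1 (g * lower c) = f.1 g := by
  rw [Ind.apply_mul f g ⟨lower c, lower_mem c⟩, charP_lower, inv_one, one_mul]

lemma Ind.apply_mul_diagonal (f : Ind χ) (g : GLTwo p) (a d : ℤ_[p]ˣ) :
    f.1 (g * diagonalElement p a d) = ((χ (diagonalElement p a d) : IntegerRing K) : K)⁻¹ *
      f.1 g := by
  rw [Ind.apply_mul f g ⟨diagonalElement p a d, diagonalElement_mem a d⟩, charP_diagonal]

variable (χ)

/-- The restriction of functions in `Ind_P^G(χ)` to the upper unipotent matrices with entry in
`t ℤ_p`. -/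
def chart (t : ℤ_[p]) : Ind χ →ₗ[K] C(ℤ_[p], K) where
  toFun f := f.1.comp ⟨fun x => upper (t * x), continuous_upper.comp (continuous_const_mul t)⟩
  map_add' _ _ := rfl
  map_smul' _ _ := rfl

lemma chart_apply (t x : ℤ_[p]) (f : Ind χ) : chart χ t f x = f.1 (upper (t * x)) := rfl

lemma norm_chart_le (t : ℤ_[p]) (f : Ind χ) : ‖chart χ t f‖ ≤ ‖f‖ :=
  (ContinuousMap.norm_le _ (norm_nonneg f)).2 fun _ => f.1.norm_coe_le_norm _

variable [CompleteSpace K]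

lemma action_apply (g h : GLTwo p) (f : Ind χ) :
    ((principalSeries χ).action g f).1 h = f.1 (g⁻¹ * h) := rfl

lemma chart_action_upper (t s x : ℤ_[p]) (f : Ind χ) :
    chart χ t ((principalSeries χ).action (upper (-(t * s))) f) x = chart χ t f (x + s) := by
  rw [chart_apply, action_apply, upper_inv, neg_neg, ← upper_add, ← mul_add, add_comm s, chart_apply]

lemma chart_action_diagonal (t x : ℤ_[p]) (a : ℤ_[p]ˣ) (f : Ind χ) :
    chart χ t ((principalSeries χ).action (diagonalElement p a 1 : GLTwo p)⁻¹ f) x =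
      ((χ (diagonalElement p a 1) : IntegerRing K) : K)⁻¹ * chart χ t f (a * x) := by
  have h : (diagonalElement p a 1 : GLTwo p) * upper (t * x) =
      upper (t * ((a : ℤ_[p]) * x)) * (diagonalElement p a 1 : GLTwo p) := by
    refine Units.ext ?_
    simp [diagonalElement, upper_val, mul_left_comm]
  rw [chart_apply, action_apply, inv_inv, h, Ind.apply_mul_diagonal f, chart_apply]

lemma lower_inv (c : ℤ_[p]) : (lower c)⁻¹ = lower (-c) := Units.ext rfl

/-- Lower unipotents act by the fractional linear map `x ↦ x / (1 + ctx)` with an automorphy factor.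
Both come from writing `lower c * upper (t x)` as an upper unipotent times a lower unipotent times
`diag(a, a⁻¹)`. -/
lemma chart_action_lower {t c x : ℤ_[p]} {a : ℤ_[p]ˣ} (ha : a * (1 + c * t * x) = 1) (f : Ind χ) :
    chart χ t ((principalSeries χ).action (lower (-c)) f) x =
      antidiagonalCharacter χ a * chart χ t f (a * x) := by
  have hv : ((a⁻¹ : ℤ_[p]ˣ) : ℤ_[p]) = 1 + c * t * x := by
    rw [← Units.mul_right_inj a, Units.mul_inv, ha]
  have h : lower c * upper (t * x) =
      upper (t * ((a : ℤ_[p]) * x)) * lower (c * ((a⁻¹ : ℤ_[p]ˣ) : ℤ_[p])) *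
        (diagonalElement p a a⁻¹ : GLTwo p) := by
    refine Units.ext ?_
    simp only [Units.val_mul, lower_val, upper_val, diagonalElement]
    ext i j
    have h2 := a.mul_inv
    rw [hv] at h2
    fin_cases i <;> fin_cases j <;>
      simp [Matrix.mul_apply, Fin.sum_univ_two, hv] <;> grind
  have hinv : ((χ (diagonalElement p a a⁻¹) : IntegerRing K) : K)⁻¹ =
      antidiagonalCharacter χ a := by
    have := antidiagonalCharacter_apply χ a⁻¹
    rw [inv_inv] at this
    rw [← this]
    exact (eq_inv_of_mul_eq_one_left (by rw [← map_mul, mul_inv_cancel, map_one])).symm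
  rw [chart_apply, action_apply, lower_inv, neg_neg, h, Ind.apply_mul_diagonal f, Ind.apply_mul_lower f,
    hinv, chart_apply]

end Charts

/-! ### Finite-dimensional stable subspaces contain a constant function -/

section Stable

variable {p : ℕ} [Fact p.Prime] {K : Type*} [NontriviallyNormedField K] [IsUltrametricDist K]
  [CompleteSpace K] (χ : torus p →ₜ* (IntegerRing K)ˣ)

variable (p) in
/-- The subgroup of the matrices which are lower triangular modulo `p`. -/
def lowerModP : Subgroup (GLTwo p) where
  carrier := {g | (p : ℤ_[p]) ∣ g.1 0 1}
  one_mem' := by simp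
  mul_mem' {g h} hg hh := by
    change (p : ℤ_[p]) ∣ (g.1 * h.1) 0 1
    rw [Matrix.mul_apply, Fin.sum_univ_two]
    exact dvd_add (hh.mul_left _) (hg.mul_right _)
  inv_mem' {g} hg := by
    change (p : ℤ_[p]) ∣ (g⁻¹).1 0 1
    rw [Matrix.coe_units_inv, Matrix.inv_def, Matrix.adjugate_fin_two]
    have hg' : (p : ℤ_[p]) ∣ g.1 0 1 := hg
    simpa using hg'

lemma mem_lowerModP {g : GLTwo p} : g ∈ lowerModP p ↔ (p : ℤ_[p]) ∣ g.1 0 1 := Iff.rfl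

lemma upper_mem_lowerModP (x : ℤ_[p]) : upper ((p : ℤ_[p]) * x) ∈ lowerModP p := by
  rw [mem_lowerModP]
  exact Dvd.intro x rfl

lemma mem_lowerModP_of_lower {g : GLTwo p} (hg : g ∈ lowerTriangular p) : g ∈ lowerModP p := by
  rw [mem_lowerModP, show g.1 0 1 = 0 from hg]
  exact dvd_zero _

variable {χ} {V : Submodule K (Ind χ)}
  (hV : ∀ g ∈ lowerModP p, ∀ f ∈ V, (principalSeries χ).action g f ∈ V)

-- With `A` the shift `x ↦ x + 1` and `S` the dilation by the unit `1 + p`, one has `A S = S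
-- A^(1+p)`. Both preserve the image of `V`, so `exists_pow_fixed` gives a periodic function.
include hV in
lemma exists_periodic [FiniteDimensional K V] (hne : ∃ f ∈ V, chart χ p f ≠ 0) :
    ∃ N > 0, ∃ f ∈ V, chart χ p f ≠ 0 ∧ ∀ x, chart χ p f (x + (N : ℕ)) = chart χ p f x := by
  let shift : Module.End K C(ℤ_[p], K) :=
    { toFun := fun h => h.comp ⟨fun x => x + 1, by fun_prop⟩
      map_add' := fun _ _ => rfl
      map_smul' := fun _ _ => rfl }
  obtain ⟨a, ha⟩ : IsUnit ((1 + p : ℕ) : ℤ_[p]) := by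
    rw [PadicInt.isUnit_iff, PadicInt.norm_natCast_eq_one_iff]
    simp
  let dilate : Module.End K C(ℤ_[p], K) :=
    { toFun := fun h => h.comp ⟨fun x => a * x, by fun_prop⟩
      map_add' := fun _ _ => rfl
      map_smul' := fun _ _ => rfl }
  have hshift_pow (n : ℕ) (h : C(ℤ_[p], K)) (x : ℤ_[p]) : (shift ^ n) h x = h (x + n) := by
    induction n generalizing x with
    | zero => simp
    | succ n ih =>
      rw [pow_succ']
      change (shift ^ n) h (x + 1) = _
      rw [ih, Nat.cast_succ, add_right_comm, add_assoc]
  let H : Submodule K C(ℤ_[p], K) := V.map (chart χ p)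
  have h1 : ∀ h ∈ H, shift h ∈ H := by
    rintro _ ⟨f, hf, rfl⟩
    refine ⟨(principalSeries χ).action (upper (-((p : ℤ_[p]) * 1))) f,
      hV _ (by rw [← mul_neg]; exact upper_mem_lowerModP _) f hf, ?_⟩
    ext x
    exact chart_action_upper χ p 1 x f
  have h2 : ∀ h ∈ H, dilate h ∈ H := by
    rintro _ ⟨f, hf, rfl⟩
    have : dilate (chart χ p f) = ((χ (diagonalElement p a 1) : IntegerRing K) : K) •
        chart χ p ((principalSeries χ).action (diagonalElement p a 1 : GLTwo p)⁻¹ f) := by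
      ext x
      rw [ContinuousMap.smul_apply, chart_action_diagonal, smul_eq_mul, mul_inv_cancel_left₀]
      · rfl
      · exact norm_ne_zero_iff.1 (by rw [norm_unit_eq_one]; exact one_ne_zero)
    rw [this]
    refine H.smul_mem _ ⟨_, hV _ ?_ f hf, rfl⟩
    exact inv_mem (mem_lowerModP_of_lower (diagonalElement_mem a 1))
  have hshift : Function.Injective shift := fun h h' hh => by
    ext x
    have := congrArg (fun f : C(ℤ_[p], K) => f (x - 1)) hh
    change h (x - 1 + 1) = h' (x - 1 + 1) at this
    rwa [sub_add_cancel] at this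
  have hdilate : Function.Injective dilate := fun h h' hh => by
    ext x
    have := congrArg (fun f : C(ℤ_[p], K) => f ((a⁻¹ : ℤ_[p]ˣ) * x)) hh
    change h (a * ((a⁻¹ : ℤ_[p]ˣ) * x)) = h' (a * ((a⁻¹ : ℤ_[p]ˣ) * x)) at this
    rwa [Units.mul_inv_cancel_left] at this
  have hnt : Nontrivial H := by
    obtain ⟨f, hf, hf0⟩ := hne
    exact ⟨⟨⟨_, f, hf, rfl⟩, 0, fun h => hf0 (congrArg Subtype.val h)⟩⟩
  obtain ⟨N, hN, ⟨_, f, hf, rfl⟩, hv, hfix⟩ := exists_pow_fixed (A := shift.restrict h1)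
    (S := dilate.restrict h2)
    (fun h h' hh => Subtype.ext (hshift (congrArg Subtype.val hh)))
    (fun h h' hh => Subtype.ext (hdilate (congrArg Subtype.val hh)))
    (a := 1 + p) (by have := (Fact.out : p.Prime).pos; omega) (by
      rw [Module.End.pow_restrict]
      refine LinearMap.ext fun h => Subtype.ext (ContinuousMap.ext fun x => ?_)
      change h.1 (a * (x + 1)) = (shift ^ (1 + p)) h.1 (a * x)
      rw [hshift_pow, mul_add, mul_one, ha])
  refine ⟨N, hN, f, hf, fun h => hv (Subtype.ext h), fun x => ?_⟩
  rw [← hshift_pow]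
  rw [Module.End.pow_restrict] at hfix
  exact congrArg (fun h : H => h.1 x) hfix

-- By density of `ℕ`, a function of period `N` is invariant under `N ℤ_p`. Translating a nonzero
-- value to the origin and rescaling makes it `1` on the smaller chart.
include hV in
lemma exists_chart_eq_one [FiniteDimensional K V] (hne : ∃ f ∈ V, chart χ p f ≠ 0) :
    ∃ N : ℕ, 0 < N ∧ ∃ f ∈ V, ∀ x, chart χ (p * N) f x = 1 := by
  obtain ⟨N, hN, f, hf, hf0, hper⟩ := exists_periodic hV hne
  have hper' (x y : ℤ_[p]) : chart χ p f (x + N * y) = chart χ p f x := by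
    refine congrFun (PadicInt.denseRange_natCast.equalizer (f := ((↑) : ℕ → ℤ_[p]))
      (g := fun y => chart χ p f (x + N * y)) (h := fun _ => chart χ p f x)
      (by fun_prop) continuous_const (funext fun n => ?_)) y
    induction n with
    | zero => simp
    | succ n ih =>
      simp only [Function.comp_apply] at ih ⊢
      rw [Nat.cast_succ, mul_add, mul_one, ← add_assoc, hper, ih]
  obtain ⟨n, hn⟩ : ∃ n : ℕ, chart χ p f n ≠ 0 := by
    by_contra! h0
    refine hf0 (ContinuousMap.ext fun y => ?_)
    exact congrFun (PadicInt.denseRange_natCast.equalizer (f := ((↑) : ℕ → ℤ_[p]))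
      (chart χ p f).continuous continuous_const (funext h0)) y
  refine ⟨N, hN, (chart χ p f n)⁻¹ • (principalSeries χ).action (upper (-((p : ℤ_[p]) * n))) f,
    V.smul_mem _ (hV _ (by rw [← mul_neg]; exact upper_mem_lowerModP _) f hf), fun x => ?_⟩
  have : chart χ (p * N) ((principalSeries χ).action (upper (-((p : ℤ_[p]) * n))) f) x =
      chart χ p ((principalSeries χ).action (upper (-((p : ℤ_[p]) * n))) f) (N * x) := by
    rw [chart_apply, chart_apply, mul_assoc]
  rw [map_smul, ContinuousMap.smul_apply, this, chart_action_upper, add_comm, hper', smul_eq_mul,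
    inv_mul_cancel₀ hn]

end Stable

end IwasawaRep
end

noncomputable section

namespace IwasawaRep

/-! ### From the constant function to all monomials -/

section Monomials

open Polynomial

variable {p : ℕ} [Fact p.Prime] {K : Type*} [NontriviallyNormedField K] [IsUltrametricDist K]
  [CompleteSpace K] [NormedAlgebra ℚ_[p] K]

variable (p K) in
/-- The embedding `ℤ_p → K`. -/
def intEmbedding : ℤ_[p] →+* K := (algebraMap ℚ_[p] K).comp PadicInt.Coe.ringHom

lemma norm_intEmbedding (x : ℤ_[p]) : ‖intEmbedding p K x‖ = ‖x‖ := norm_algebraMap' K (x : ℚ_[p])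

lemma intEmbedding_injective : Function.Injective (intEmbedding p K) :=
  (injective_iff_map_eq_zero _).2 fun x hx => by
    rw [← norm_eq_zero, ← norm_intEmbedding (K := K), hx, norm_zero]

variable (p K) in
/-- The embedding `ℤ_p → K` as a continuous function. -/
def intCoordinate : C(ℤ_[p], K) where
  toFun := intEmbedding p K
  continuous_toFun := (continuous_algebraMap ℚ_[p] K).comp continuous_subtype_val

/-- A polynomial vanishing on the infinite set `ℤ_p` is zero, so `K[X]` would embed into `H`. -/
lemma not_finiteDimensional_of_monomials {H : Submodule K C(ℤ_[p], K)}
    (h : ∀ n : ℕ, intCoordinate p K ^ n ∈ H) : ¬ FiniteDimensional K H := by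
  intro hH
  have hmem (P : K[X]) : aeval (intCoordinate p K) P ∈ H := by
    rw [aeval_eq_sum_range]
    exact H.sum_mem fun n _ => H.smul_mem _ (h n)
  let Φ : K[X] →ₗ[K] H := (aeval (intCoordinate p K)).toLinearMap.codRestrict H hmem
  refine Polynomial.not_finite (R := K)
    (FiniteDimensional.of_injective Φ ((injective_iff_map_eq_zero Φ).2 fun P hP => ?_))
  refine eq_zero_of_infinite_isRoot P ((Set.infinite_range_of_injective
    (intEmbedding_injective (p := p) (K := K))).mono ?_)
  rintro _ ⟨x, rfl⟩
  have h1 : aeval (intCoordinate p K) P = 0 := congrArg Subtype.val hP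
  have h2 := congrArg (ContinuousMap.evalAlgHom K K x) h1
  rw [← aeval_algHom_apply, map_zero] at h2
  rwa [Set.mem_ofPred_eq, IsRoot.def, ← coe_aeval_eq_eval]

end Monomials

section Derivative

variable {p : ℕ} [Fact p.Prime] {K : Type*} [NontriviallyNormedField K] [IsUltrametricDist K]
  [CompleteSpace K] [NormedAlgebra ℚ_[p] K]

lemma tendsto_intEmbedding_unit : Tendsto (fun a : ℤ_[p]ˣ => intEmbedding p K a) (𝓝 1) (𝓝 1) :=
  tendsto_algebraMap_unit K

/-- If `θ` has logarithmic derivative `c` at `1`, then `a ↦ θ(a) aⁿ` has logarithmic derivative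
`c + n`. -/
lemma norm_mul_pow_sub_le {θ : ℤ_[p]ˣ → K} {c : K}
    (hθ : ∀ ε : ℝ, 0 < ε → ∀ᶠ a : ℤ_[p]ˣ in 𝓝 1,
      ‖θ a - 1 - c * (intEmbedding p K a - 1)‖ ≤ ε * ‖intEmbedding p K a - 1‖) (n : ℕ) :
    ∀ ε : ℝ, 0 < ε → ∀ᶠ a : ℤ_[p]ˣ in 𝓝 1,
      ‖θ a * intEmbedding p K a ^ n - 1 - (c + n) * (intEmbedding p K a - 1)‖ ≤
        ε * ‖intEmbedding p K a - 1‖ := by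
  induction n with
  | zero => simpa using hθ
  | succ n ih =>
    intro ε hε
    have h0 : Tendsto (fun a : ℤ_[p]ˣ => ‖(c + n) * (intEmbedding p K a - 1)‖) (𝓝 1) (𝓝 0) := by
      have := (((tendsto_intEmbedding_unit (p := p) (K := K)).sub_const 1).const_mul (c + n)).norm
      rwa [sub_self, mul_zero, norm_zero] at this
    filter_upwards [ih ε hε, h0.eventually (ge_mem_nhds hε)] with a ha ha'
    have e : θ a * intEmbedding p K a ^ (n + 1) - 1 - (c + (n + 1 : ℕ)) * (intEmbedding p K a - 1) =
        intEmbedding p K a *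
          (θ a * intEmbedding p K a ^ n - 1 - (c + n) * (intEmbedding p K a - 1)) +
        (c + n) * (intEmbedding p K a - 1) * (intEmbedding p K a - 1) := by
      push_cast
      ring
    rw [e]
    refine (IsUltrametricDist.norm_add_le_max _ _).trans (max_le ?_ ?_)
    · rw [norm_mul, norm_intEmbedding, PadicInt.norm_units, one_mul]
      exact ha
    · rw [norm_mul]
      exact mul_le_mul_of_nonneg_right ha' (norm_nonneg _)

lemma exists_forall_norm_sub_one_lt {P : ℤ_[p]ˣ → Prop} (h : ∀ᶠ a in 𝓝 1, P a) :
    ∃ δ > 0, ∀ a : ℤ_[p]ˣ, ‖(a : ℤ_[p]) - 1‖ < δ → P a := by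
  rw [(Units.isOpenEmbedding_val (R := ℤ_[p])).isInducing.nhds_eq_comap, eventually_comap,
    Metric.eventually_nhds_iff] at h
  obtain ⟨δ, hδ, h⟩ := h
  exact ⟨δ, hδ, fun a ha => h (by rwa [dist_eq_norm]) a rfl⟩

variable {χ : torus p →ₜ* (IntegerRing K)ˣ} {V : Submodule K (Ind χ)}

lemma exists_unit_mul_eq_one {z : ℤ_[p]} (hz : ‖z‖ < 1) :
    ∃ a : ℤ_[p]ˣ, a * (1 + z) = 1 ∧ ‖(a : ℤ_[p]) - 1‖ = ‖z‖ := by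
  obtain ⟨v, hv⟩ : IsUnit (1 + z) := by
    rw [PadicInt.isUnit_iff, IsUltrametricDist.norm_add_eq_max_of_norm_ne_norm, norm_one,
      max_eq_left hz.le]
    rw [norm_one]
    exact hz.ne'
  have ha : ((v⁻¹ : ℤ_[p]ˣ) : ℤ_[p]) * (1 + z) = 1 := by rw [← hv, Units.inv_mul]
  refine ⟨v⁻¹, ha, ?_⟩
  have : ((v⁻¹ : ℤ_[p]ˣ) : ℤ_[p]) - 1 = -(((v⁻¹ : ℤ_[p]ˣ) : ℤ_[p]) * z) := by
    rw [mul_add, mul_one] at ha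
    linear_combination ha
  rw [this, norm_neg, norm_mul, PadicInt.norm_units, one_mul]

/-- The infinitesimal action of the lower unipotents. For small `b`, `lower (-b)` multiplies `xⁿ` by
`ψ(a) aⁿ ≈ 1 + (c+n)(a-1)` with `a - 1 ≈ -btx`, so the difference quotients by `bt` tend to `-(c+n)
xⁿ⁺¹`. The limit stays in the finite-dimensional, hence closed, image, and `c ≠ -n` allows division.
-/
lemma pow_succ_mem_map_chart [FiniteDimensional K V]
    (hV : ∀ g ∈ lowerModP p, ∀ f ∈ V, (principalSeries χ).action g f ∈ V) {c : K}
    (hc : HasExponent χ c) {n : ℕ} (hn : c ≠ -n) {t : ℤ_[p]} (ht0 : t ≠ 0) (ht : ‖t‖ < 1)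
    (h : intCoordinate p K ^ n ∈ V.map (chart χ t)) :
    intCoordinate p K ^ (n + 1) ∈ V.map (chart χ t) := by
  set H := V.map (chart χ t)
  have hclosed : IsClosed (H : Set C(ℤ_[p], K)) := Submodule.closed_of_finiteDimensional H
  have hcn : c + n ≠ 0 := fun h0 => hn (eq_neg_of_add_eq_zero_left h0)
  suffices hmem : -(c + n) • intCoordinate p K ^ (n + 1) ∈ closure (H : Set C(ℤ_[p], K)) by
    rw [hclosed.closure_eq] at hmem
    exact (H.smul_mem_iff (neg_ne_zero.2 hcn)).1 hmem
  obtain ⟨f, hf, hfn⟩ := h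
  have hfn' (y : ℤ_[p]) : chart χ t f y = intEmbedding p K y ^ n := by rw [hfn]; rfl
  refine Metric.mem_closure_iff.2 fun ε hε => ?_
  have hε2 := half_pos hε
  have hψ := norm_mul_pow_sub_le (K := K) (fun ε hε => norm_character_sub_le hc hε) n
  have h0 : Tendsto (fun a : ℤ_[p]ˣ => ‖(c + n) * (intEmbedding p K a - 1)‖) (𝓝 1) (𝓝 0) := by
    have := (((tendsto_intEmbedding_unit (p := p) (K := K)).sub_const 1).const_mul (c + n)).norm
    rwa [sub_self, mul_zero, norm_zero] at this
  obtain ⟨δ, hδ, hsmall⟩ := exists_forall_norm_sub_one_lt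
    ((hψ _ hε2).and (h0.eventually (ge_mem_nhds hε2)))
  -- The exponent `k` makes `b = p^k` so small that `‖a - 1‖ < δ` uniformly in `y`.
  obtain ⟨k, hk⟩ := exists_pow_lt_of_lt_one hδ (norm_natPrime_lt_one (p := p))
  set b : ℤ_[p] := (p : ℤ_[p]) ^ k with hb
  have hb0 : b ≠ 0 := pow_ne_zero _ (Nat.cast_ne_zero.2 (Fact.out : p.Prime).ne_zero)
  set T : K := intEmbedding p K (b * t) with hT
  have hT0 : T ≠ 0 := fun h => mul_ne_zero hb0 ht0 (intEmbedding_injective (h.trans (map_zero _).symm))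
  refine ⟨T⁻¹ • (chart χ t ((principalSeries χ).action (lower (-b)) f) - chart χ t f),
    H.smul_mem _ (H.sub_mem ⟨_, hV _ (mem_lowerModP_of_lower (lower_mem _)) f hf, rfl⟩
      ⟨f, hf, rfl⟩), ?_⟩
  rw [dist_eq_norm]
  refine ((ContinuousMap.norm_le _ hε2.le).2 fun y => ?_).trans_lt (half_lt_self hε)
  have hnorm : ‖b * t * y‖ ≤ ‖b‖ * ‖t‖ := by
    rw [norm_mul, norm_mul]
    exact mul_le_of_le_one_right (by positivity) (PadicInt.norm_le_one y)
  have hbk : ‖b‖ = ‖(p : ℤ_[p])‖ ^ k := norm_pow _ _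
  obtain ⟨a, ha, ha1⟩ := exists_unit_mul_eq_one (z := b * t * y)
    (hnorm.trans_lt (mul_lt_one_of_nonneg_of_lt_one_right (PadicInt.norm_le_one b)
      (norm_nonneg _) ht))
  obtain ⟨hs1, hs2⟩ := hsmall a (by
    rw [ha1]
    exact (hnorm.trans (mul_le_of_le_one_right (norm_nonneg _) ht.le)).trans_lt (hbk ▸ hk))
  have haK : intEmbedding p K a * (1 + T * intEmbedding p K y) = 1 := by
    rw [hT, ← map_mul, ← map_one (intEmbedding p K), ← map_add, ← map_mul, ha]
  change ‖-(c + n) * intEmbedding p K y ^ (n + 1) - T⁻¹ *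
    (chart χ t ((principalSeries χ).action (lower (-b)) f) y - chart χ t f y)‖ ≤ ε / 2
  rw [chart_action_lower χ ha, hfn', hfn', map_mul]
  change ‖((χ (diagonalElement p a⁻¹ a) : IntegerRing K) : K) * intEmbedding p K a ^ n - 1 -
    (c + n) * (intEmbedding p K a - 1)‖ ≤ _ at hs1
  rw [← antidiagonalCharacter_apply] at hs1
  set ψ := antidiagonalCharacter χ a
  set A := intEmbedding p K a
  set Y := intEmbedding p K y
  -- Here `T⁻¹ (A - 1) = -A Y` exactly. The error splits into a term from replacing `A` by `1` and
  -- the remainder of the derivative estimate, which survives division by `T` because `‖A - 1‖ ≤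
  -- ‖T‖`.
  have e : -(c + n) * Y ^ (n + 1) - T⁻¹ * (ψ * (A * Y) ^ n - Y ^ n) =
      Y ^ n * ((c + n) * (A - 1) * Y - T⁻¹ * (ψ * A ^ n - 1 - (c + n) * (A - 1))) := by
    have h1 : T⁻¹ * (A - 1) = - A * Y := by
      field_simp
      linear_combination haK
    linear_combination (-(Y ^ n * (c + n))) * h1
  have hY : ‖Y‖ ≤ 1 := (norm_intEmbedding y).trans_le (PadicInt.norm_le_one y)
  have hA : ‖A - 1‖ ≤ ‖T‖ := by
    have : A - 1 = intEmbedding p K ((a : ℤ_[p]) - 1) := by rw [map_sub, map_one]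
    rw [this, norm_intEmbedding, ha1, hT, norm_intEmbedding, norm_mul]
    exact mul_le_of_le_one_right (norm_nonneg _) (PadicInt.norm_le_one y)
  rw [e, norm_mul, norm_pow]
  refine (mul_le_of_le_one_left (norm_nonneg _) (pow_le_one₀ (norm_nonneg _) hY)).trans
    ((norm_sub_le_max' _ _).trans (max_le ?_ ?_))
  · rw [norm_mul]
    exact (mul_le_of_le_one_right (norm_nonneg _) hY).trans hs2
  · rw [norm_mul, norm_inv, inv_mul_le_iff₀ (norm_pos_iff.2 hT0), mul_comm ‖T‖]
    exact hs1.trans (mul_le_mul_of_nonneg_left hA hε2.le)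

/-- If `c(χ) ≠ -n` for all `n ≥ 0`, then no finite dimensional subspace of `Ind_P^G(χ)` is stable
under the matrices which are lower triangular modulo `p`, unless it vanishes on them. -/
theorem chart_eq_zero_of_finiteDimensional [FiniteDimensional K V]
    (hV : ∀ g ∈ lowerModP p, ∀ f ∈ V, (principalSeries χ).action g f ∈ V) {c : K}
    (hc : HasExponent χ c) (hn : ∀ n : ℕ, c ≠ -(n : K)) {f : Ind χ} (hf : f ∈ V) :
    chart χ p f = 0 := by
  by_contra hf0
  obtain ⟨N, hN, f, hf, hf1⟩ := exists_chart_eq_one hV ⟨f, hf, hf0⟩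
  have hmem (n : ℕ) : intCoordinate p K ^ n ∈ V.map (chart χ (p * N)) := by
    induction n with
    | zero =>
      exact ⟨f, hf, ContinuousMap.ext fun x => by rw [hf1, pow_zero, ContinuousMap.one_apply]⟩
    | succ n ih =>
      refine pow_succ_mem_map_chart hV hc (hn n) (mul_ne_zero
        (Nat.cast_ne_zero.2 (Fact.out : p.Prime).ne_zero) (Nat.cast_ne_zero.2 hN.ne')) ?_ ih
      rw [norm_mul]
      exact mul_lt_one_of_nonneg_of_lt_one_left (norm_nonneg _) norm_natPrime_lt_one
        (PadicInt.norm_le_one _)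
  exact not_finiteDimensional_of_monomials hmem inferInstance

end Derivative

end IwasawaRep
end

noncomputable section

namespace IwasawaRep

/-! ### The two cells of `G/P` -/

section Cells

variable {p : ℕ} [Fact p.Prime] {K : Type*} [NontriviallyNormedField K] [IsUltrametricDist K]
  [CompleteSpace K] {χ : torus p →ₜ* (IntegerRing K)ˣ}

lemma norm_apply_cosetSection (f : Ind χ) (g : GLTwo p) :
    ‖f.1 g‖ = ‖f.1 (cosetSection g)‖ := by
  conv_lhs => rw [← cosetSection_mul_lowerFactor g]
  rw [Ind.apply_mul, norm_mul, norm_inv, norm_charP, inv_one, one_mul]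

lemma cosetSection_of_isUnit {g : GLTwo p} (h : IsUnit (g.1 1 1)) :
    cosetSection g = upper (g.1 0 1 * Ring.inverse (g.1 1 1)) := if_pos h

lemma cosetSection_of_not_isUnit {g : GLTwo p} (h : ¬ IsUnit (g.1 1 1)) :
    cosetSection g = swap p * upper (g.1 1 1 * Ring.inverse (g.1 0 1)) := if_neg h

lemma isUnit_of_not_mem_lowerModP {g : GLTwo p} (hg : g ∉ lowerModP p) : IsUnit (g.1 0 1) := by
  rw [PadicInt.isUnit_iff]
  refine le_antisymm (PadicInt.norm_le_one _) (not_lt.1 fun h => hg ?_)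
  exact (PadicInt.norm_lt_one_iff_dvd _).1 h

lemma isUnit_of_mem_lowerModP {g : GLTwo p} (hg : g ∈ lowerModP p) : IsUnit (g.1 1 1) := by
  by_contra h
  have h1 := PadicInt.isUnit_iff.1 (isUnit_entry h)
  exact ((PadicInt.norm_lt_one_iff_dvd _).2 hg).ne h1

lemma isOpen_lowerModP : IsOpen (lowerModP p : Set (GLTwo p)) := by
  have : (lowerModP p : Set (GLTwo p)) = {g | ‖g.1 0 1‖ < 1} :=
    Set.ext fun g => (PadicInt.norm_lt_one_iff_dvd _).symm
  rw [this]
  exact isOpen_lt (continuous_entry p 0 1).norm continuous_const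

lemma norm_action_le (g : GLTwo p) (f : Ind χ) : ‖(principalSeries χ).action g f‖ ≤ ‖f‖ :=
  (ContinuousMap.norm_le _ (norm_nonneg f)).2 fun _ => f.1.norm_coe_le_norm _

lemma norm_lt_one_of_chart {f : Ind χ} (h1 : ‖chart χ 1 f‖ < 1)
    (h2 : ‖chart χ 1 ((principalSeries χ).action (swap p) f)‖ < 1) : ‖f‖ < 1 := by
  refine (ContinuousMap.norm_lt_iff f.1 one_pos).2 fun g => ?_
  rw [norm_apply_cosetSection]
  by_cases h : IsUnit (g.1 1 1)
  · rw [cosetSection_of_isUnit h, ← one_mul (_ * _), ← chart_apply]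
    exact (ContinuousMap.norm_coe_le_norm _ _).trans_lt h1
  · rw [cosetSection_of_not_isUnit h, ← one_mul (_ * Ring.inverse _)]
    exact (ContinuousMap.norm_coe_le_norm _ (g.1 1 1 * Ring.inverse (g.1 0 1))).trans_lt h2

variable (χ) in
/-- The functions in `Ind_P^G(χ)` supported on the matrices which are lower triangular
modulo `p`. -/
def supportedLowerModP : Submodule K (Ind χ) where
  carrier := {f | ∀ g ∉ lowerModP p, f.1 g = 0}
  zero_mem' _ _ := rfl
  add_mem' {f f'} hf hf' g hg := by
    change f.1 g + f'.1 g = 0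
    rw [hf g hg, hf' g hg, add_zero]
  smul_mem' c f hf g hg := by
    change c * f.1 g = 0
    rw [hf g hg, mul_zero]

lemma isClosed_supportedLowerModP : IsClosed (supportedLowerModP χ : Set (Ind χ)) := by
  have : (supportedLowerModP χ : Set (Ind χ)) = ⋂ g ∈ (lowerModP p : Set (GLTwo p))ᶜ,
      {f | f.1 g = 0} := by
    ext f
    simp only [Set.mem_iInter, Set.mem_compl_iff, SetLike.mem_coe, Set.mem_ofPred_eq]
    rfl
  rw [this]
  exact isClosed_biInter fun g _ =>
    isClosed_eq ((continuous_eval_const g).comp continuous_subtype_val) continuous_const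

/-- Modulo `P`, the matrices of `lowerModP` are represented by `upper (p x)`, so the chart at `p`
controls the norm of such a function. -/
lemma norm_apply_le_of_supported {f : Ind χ} (hf : f ∈ supportedLowerModP χ) (g : GLTwo p) :
    ‖f.1 g‖ ≤ ‖chart χ p f‖ := by
  by_cases hg : g ∈ lowerModP p
  · obtain ⟨x, hx⟩ := mem_lowerModP.1 hg
    rw [norm_apply_cosetSection, cosetSection_of_isUnit (isUnit_of_mem_lowerModP hg), hx, mul_assoc]
    exact ContinuousMap.norm_coe_le_norm (chart χ p f) _
  · rw [hf g hg, norm_zero]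
    exact norm_nonneg _

lemma eq_zero_of_supported {f : Ind χ} (hf : f ∈ supportedLowerModP χ) (h : chart χ p f = 0) :
    f = 0 := by
  refine Subtype.ext (ContinuousMap.ext fun g => ?_)
  have := norm_apply_le_of_supported hf g
  rw [h, norm_zero] at this
  exact norm_le_zero_iff.1 this

lemma action_mem_supported {g : GLTwo p} (hg : g ∈ lowerModP p) {f : Ind χ}
    (hf : f ∈ supportedLowerModP χ) : (principalSeries χ).action g f ∈ supportedLowerModP χ :=
  fun _ hh => hf _ fun h' => hh ((Subgroup.mul_mem_cancel_left _ (inv_mem hg)).1 h')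

/-- The cell of the matrices `upper x` consists of the `g` with `g₁₁` a unit. Exchanging the rows
sends its complement into `lowerModP`. -/
lemma swap_action_mem_supported {f : Ind χ} (hf : chart χ 1 f = 0) :
    (principalSeries χ).action (swap p) f ∈ supportedLowerModP χ := fun g hg => by
  have h11 : (swap p * g).1 1 1 = g.1 0 1 := by
    simp [swap_val, Matrix.mul_apply, Fin.sum_univ_two]
  have h : IsUnit ((swap p * g).1 1 1) := h11 ▸ isUnit_of_not_mem_lowerModP hg
  rw [action_apply, swap_inv, ← norm_eq_zero, norm_apply_cosetSection, cosetSection_of_isUnit h,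
    ← one_mul (_ * _), ← chart_apply, hf, ContinuousMap.zero_apply, norm_zero]

lemma exists_norm_smul_eq_one {f : Ind χ} (hf : f ≠ 0) : ∃ c : K, ‖c • f‖ = 1 := by
  have hne : ‖f‖ ≠ 0 := norm_ne_zero_iff.2 hf
  obtain ⟨g, -, hg⟩ := isCompact_univ.exists_isMaxOn (s := (Set.univ : Set (GLTwo p)))
    ⟨1, trivial⟩ f.1.continuous.norm.continuousOn
  have h : ‖f‖ = ‖f.1 g‖ := le_antisymm
    ((ContinuousMap.norm_le _ (norm_nonneg _)).2 fun x => hg (Set.mem_univ x))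
    (f.1.norm_coe_le_norm g)
  exact ⟨(f.1 g)⁻¹, by rw [norm_smul, norm_inv, ← h, inv_mul_cancel₀ hne]⟩

lemma eq_zero_of_forall_action {f : Ind χ} (h₀ : GLTwo p)
    (h : ∀ g, ((principalSeries χ).action g f).1 h₀ = 0) : f = 0 := by
  refine Subtype.ext (ContinuousMap.ext fun g => ?_)
  have := h (h₀ * g⁻¹)
  rwa [action_apply, mul_inv_rev, inv_inv, inv_mul_cancel_right] at this

/-- A `G`-stable subspace which contains the functions supported on the matrices which are lower
triangular modulo `p` is the whole space. -/
lemma eq_top_of_supported_le {W : Submodule K (Ind χ)}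
    (hW : ∀ g, ∀ f ∈ W, (principalSeries χ).action g f ∈ W) (h : supportedLowerModP χ ≤ W) :
    W = ⊤ := by
  classical
  refine eq_top_iff.2 fun f _ => ?_
  have hfin : Finite (GLTwo p ⧸ lowerModP p) := Subgroup.quotient_finite_of_isOpen _ isOpen_lowerModP
  have := Fintype.ofFinite (GLTwo p ⧸ lowerModP p)
  have hdisc : DiscreteTopology (GLTwo p ⧸ lowerModP p) :=
    QuotientGroup.discreteTopology isOpen_lowerModP
  -- Cut `f` by the indicators of the finitely many cosets of `lowerModP`. Since this subgroup
  -- contains `P`, the pieces stay in `Ind_P^G(χ)`, and each is a translate of a function supported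
  -- on `lowerModP`.
  let e (x : GLTwo p ⧸ lowerModP p) : C(GLTwo p, K) :=
    ⟨fun g => (Pi.single x 1 : GLTwo p ⧸ lowerModP p → K) g,
      continuous_of_discreteTopology.comp continuous_quotient_mk'⟩
  let F (x : GLTwo p ⧸ lowerModP p) : Ind χ := ⟨e x * f.1, fun g b => by
    have hb : ((g * b : GLTwo p) : GLTwo p ⧸ lowerModP p) = g :=
      QuotientGroup.mk_mul_of_mem g (mem_lowerModP_of_lower b.2)
    change (Pi.single x 1 : GLTwo p ⧸ lowerModP p → K) (g * b : GLTwo p) * f.1 (g * b) =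
      _ * ((Pi.single x 1 : GLTwo p ⧸ lowerModP p → K) g * f.1 g)
    rw [hb, f.2 g b, mul_left_comm]⟩
  have hF (x : GLTwo p ⧸ lowerModP p) : F x ∈ W := by
    have h1 : (principalSeries χ).action x.out⁻¹ (F x) ∈ supportedLowerModP χ := fun g hg => by
      rw [action_apply, inv_inv]
      change (Pi.single x 1 : GLTwo p ⧸ lowerModP p → K) (x.out * g : GLTwo p) * f.1 _ = 0
      rw [Pi.single_eq_of_ne, zero_mul]
      intro heq
      rw [← QuotientGroup.out_eq' x, QuotientGroup.out_eq', eq_comm, ← QuotientGroup.out_eq' x,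
        QuotientGroup.eq, QuotientGroup.out_eq', inv_mul_cancel_left] at heq
      exact hg heq
    have h2 := hW x.out _ (h h1)
    rwa [← mul_apply_eq_comp, ← map_mul, mul_inv_cancel, map_one] at h2
  have hsum : f = ∑ x, F x := by
    refine Subtype.ext (ContinuousMap.ext fun g => ?_)
    rw [AddSubmonoidClass.coe_finsetSum, ContinuousMap.coe_sum, Finset.sum_apply]
    change f.1 g = ∑ x, (Pi.single x 1 : GLTwo p ⧸ lowerModP p → K) g * f.1 g
    rw [← Finset.sum_mul]
    simp [Pi.single_apply]
  rw [hsum]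
  exact W.sum_mem fun x _ => hF x

lemma nontrivial_Ind : Nontrivial (Ind χ) := by
  refine ⟨⟨retraction χ 1, 0, fun h => ?_⟩⟩
  have h1 := congrArg (fun f : Ind χ => ‖f.1 1‖) h
  simp only [retraction_apply, norm_unitFunction, ContinuousMap.one_apply,
    mul_one, ZeroMemClass.coe_zero, ContinuousMap.zero_apply, norm_zero] at h1
  exact one_ne_zero h1

end Cells

/-! ### Topological irreducibility -/

section Irreducible

variable {p : ℕ} [Fact p.Prime] {K : Type*} [NontriviallyNormedField K] [IsUltrametricDist K]
  [CompleteSpace K] [NormedAlgebra ℚ_[p] K] [ProperSpace K] {χ : torus p →ₜ* (IntegerRing K)ˣ}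

lemma surjective_chart_or {V : Submodule K (Ind χ)} (hVc : IsClosed (V : Set (Ind χ))) (t : ℤ_[p])
    (hV : ∀ f ∈ V, (principalSeries χ).action (upper (-(t * 1))) f ∈ V) :
    Function.Surjective ((chart χ t).comp V.subtype) ∨
      ∃ d, ∀ f ∈ V, ‖f‖ ≤ 1 → ∀ k ≥ d, ‖mahlerCoeff k (chart χ t f)‖ < 1 := by
  have hq (f : Ind χ) : ‖chart χ t f‖ ≤ ‖f‖ := norm_chart_le χ t f
  have hD (f : Ind χ) : ‖(principalSeries χ).action (upper (-(t * 1))) f - f‖ ≤ ‖f‖ :=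
    (norm_sub_le_max_norm _ _).trans (max_le (norm_action_le (upper (-(t * 1))) f) le_rfl)
  have hqD (f : Ind χ) (x : ℤ_[p]) : chart χ t ((principalSeries χ).action (upper (-(t * 1))) f - f)
      x = chart χ t f (x + 1) - chart χ t f x :=
    congrArg (· - chart χ t f x) (chart_action_upper χ t 1 x f)
  exact surjective_or_mahlerCoeff_lt_one_of_isClosed hq hD hqD hVc
    fun f hf => V.sub_mem (hV f hf) hf

/-- Every continuous function on `ℤ_p` is a difference, so bijectivity of the chart on `W` makes
each `f` in `W` of the form `u f' - f'` with `u` upper unipotent. The coset of `swap p` is fixed by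
`u`, so `f` vanishes there, as do all its translates. -/
lemma eq_zero_of_injective_chart {W : Submodule K (Ind χ)}
    (hW : ∀ g, ∀ f ∈ W, (principalSeries χ).action g f ∈ W)
    (hinj : ∀ f ∈ W, chart χ 1 f = 0 → f = 0)
    (hsurj : Function.Surjective ((chart χ 1).comp W.subtype)) : W = ⊥ := by
  have hswap : ∀ f ∈ W, f.1 (swap p) = 0 := fun f hf => by
    obtain ⟨h', hh'⟩ := exists_fwdDiff_eq (chart χ 1 f)
    obtain ⟨⟨f', hf'⟩, hff'⟩ := hsurj h'
    set f'' := (principalSeries χ).action (upper (-(1 * 1))) f'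
    have h0 : f - (f'' - f') = 0 := by
      refine hinj _ (W.sub_mem hf (W.sub_mem (hW _ _ hf') hf')) (ContinuousMap.ext fun x => ?_)
      have e : chart χ 1 f' = h' := hff'
      rw [map_sub, map_sub, ContinuousMap.sub_apply, ContinuousMap.sub_apply, chart_action_upper,
        e, hh', ContinuousMap.zero_apply, sub_self]
    have hs : upper (1 : ℤ_[p]) * swap p = swap p * lower 1 := by
      refine Units.ext ?_
      simp [upper_val, lower_val, swap_val]
    rw [sub_eq_zero.1 h0]
    change f'.1 ((upper (-(1 * 1)))⁻¹ * swap p) - f'.1 (swap p) = 0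
    rw [upper_inv, neg_neg, mul_one, hs, Ind.apply_mul_lower, sub_self]
  exact (Submodule.eq_bot_iff _).2 fun f hf =>
    eq_zero_of_forall_action (swap p) fun g => hswap _ (hW g f hf)

/-- If `c(χ) ≠ -n` for all `n ≥ 0`, then `Ind_P^G(χ)` is topologically irreducible. -/
theorem isTopologicallyIrreducible_principalSeries {c : K} (hc : HasExponent χ c)
    (hn : ∀ n : ℕ, c ≠ -(n : K)) : (principalSeries χ).IsTopologicallyIrreducible := by
  refine ⟨nontrivial_Ind, fun W hWc hW => ?_⟩
  rw [or_iff_not_imp_left]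
  intro hW0
  -- Otherwise reductions have bounded degree in both charts, the second being the first after `swap
  -- p`, and `W` is finite-dimensional. Then all translates vanish at `1`, so `W = 0`.
  have hsurj : Function.Surjective ((chart χ 1).comp W.subtype) := by
    refine (surjective_chart_or hWc 1 fun f hf => hW _ f hf).resolve_right ?_
    rintro ⟨d, hd⟩
    have : FiniteDimensional K W := finiteDimensional_of_mahlerCoeff_lt_one (d := d)
      (q := fun i : Fin 2 => (chart χ 1).comp
        (((principalSeries χ).action (![1, swap p] i)).toLinearMap.comp W.subtype))
      (fun i w hw => hd _ (hW _ _ w.2) ((norm_action_le _ _).trans hw))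
      (fun w hw => norm_lt_one_of_chart (by simpa using hw 0) (by simpa using hw 1))
      (fun w hw => exists_norm_smul_eq_one (f := w.1) fun h => hw (Subtype.ext h))
    refine hW0 ((Submodule.eq_bot_iff _).2 fun f hf => eq_zero_of_forall_action 1 fun g => ?_)
    have h := chart_eq_zero_of_finiteDimensional (fun g _ => hW g) hc hn (hW g f hf)
    have h0 := congrArg (fun h : C(ℤ_[p], K) => h 0) h
    simp only [chart_apply, mul_zero, upper_zero] at h0
    exact h0
  obtain ⟨f₀, hf₀, hf₀0, hf₀1⟩ : ∃ f ∈ W, chart χ 1 f = 0 ∧ f ≠ 0 := by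
    by_contra! hinj
    exact hW0 (eq_zero_of_injective_chart hW hinj hsurj)
  -- The function `f₀` vanishes on the large cell, so its translate by `swap p` is a nonzero element
  -- of `E`, and the dichotomy can be run again with the chart at `p`.
  let E := W ⊓ supportedLowerModP χ
  have hE : ∀ g ∈ lowerModP p, ∀ f ∈ E, (principalSeries χ).action g f ∈ E := fun g hg f hf =>
    ⟨hW g f hf.1, action_mem_supported hg hf.2⟩
  have hE0 : ∃ f ∈ E, chart χ p f ≠ 0 := by
    refine ⟨_, ⟨hW (swap p) f₀ hf₀, swap_action_mem_supported hf₀0⟩, fun h => hf₀1 ?_⟩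
    have h1 := congrArg ((principalSeries χ).action (swap p))
      (eq_zero_of_supported (swap_action_mem_supported hf₀0) h)
    have h2 : swap p * swap p = 1 := inv_mul_cancel (swap p)
    rwa [← mul_apply_eq_comp, ← map_mul, h2, map_one, map_zero] at h1
  have hsurjE : Function.Surjective ((chart χ p).comp E.subtype) := by
    refine (surjective_chart_or (hWc.inter isClosed_supportedLowerModP) p
      fun f hf => hE _ (by rw [← mul_neg]; exact upper_mem_lowerModP _) f hf).resolve_right ?_
    rintro ⟨d, hd⟩
    have : FiniteDimensional K E := finiteDimensional_of_mahlerCoeff_lt_one (d := d)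
      (q := fun _ : Unit => (chart χ p).comp E.subtype)
      (fun _ w hw => hd _ w.2 hw)
      (fun w hw => ((ContinuousMap.norm_le _ (norm_nonneg _)).2
        (norm_apply_le_of_supported w.2.2)).trans_lt (hw ()))
      (fun w hw => exists_norm_smul_eq_one (f := w.1) fun h => hw (Subtype.ext h))
    obtain ⟨f, hf, hf0⟩ := hE0
    exact hf0 (chart_eq_zero_of_finiteDimensional hE hc hn hf)
  -- The chart at `p` is injective on functions supported on `lowerModP` and already surjective on
  -- `E`, so `E` contains all of them.
  refine eq_top_of_supported_le hW fun f hf => ?_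
  obtain ⟨⟨e, he⟩, hef⟩ := hsurjE (chart χ p f)
  have h0 := eq_zero_of_supported (Submodule.sub_mem _ he.2 hf)
    (by rw [map_sub]; exact sub_eq_zero.2 hef)
  exact sub_eq_zero.1 h0 ▸ he.1

end Irreducible

end IwasawaRep
end

theorem mainTheorem8 (p : ℕ) [Fact p.Prime]
    (K : Type*) [NontriviallyNormedField K] [IsUltrametricDist K] [CompleteSpace K]
    [NormedAlgebra ℚ_[p] K] [FiniteDimensional ℚ_[p] K]
    (χ : IwasawaRep.torus p →ₜ* (IwasawaRep.IntegerRing K)ˣ) :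
    -- the dual of `Ind_P^G(χ)` is `M_{χ⁻¹}`, through integration of functions against measures
    (∃ Φ : IwasawaRep.InducedIwasawaModule χ⁻¹
        ≃ₗ[IwasawaRep.CompletedGroupRing K (IwasawaRep.GLTwo p)]
          (IwasawaRep.principalSeries χ).Dual,
      ∀ (a : IwasawaRep.CompletedGroupRing K (IwasawaRep.GLTwo p)) (v : K)
        (f : IwasawaRep.Ind χ),
        (Φ (IwasawaRep.InducedIwasawaModule.tmul χ⁻¹ a v)).form f =
          v * IwasawaRep.integralK (f : C(IwasawaRep.GLTwo p, K)) a) ∧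
    -- admissibility
    (IwasawaRep.principalSeries χ).IsAdmissible ∧
    -- the number `c(χ)` exists and is unique
    (∃! c : K, IwasawaRep.HasExponent χ c) ∧
    -- irreducibility
    (∀ c : K, IwasawaRep.HasExponent χ c → (∀ n : ℕ, c ≠ -(n : K)) →
      (IwasawaRep.principalSeries χ).IsTopologicallyIrreducible) := by
  have : ProperSpace K := FiniteDimensional.proper ℚ_[p] K
  exact ⟨⟨IwasawaRep.dualEquiv χ, IwasawaRep.toDual_tmul_form χ⟩,
    IwasawaRep.isAdmissible_principalSeries χ,
    IwasawaRep.existsUnique_exponent (IwasawaRep.antidiagonalCharacter χ)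
      (IwasawaRep.continuous_antidiagonalCharacter χ),
    fun _ hc hn => IwasawaRep.isTopologicallyIrreducible_principalSeries hc hn⟩
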